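/- **Economy.** Time is $t=0,1,2,\dots$; variables dated $t$ are measurable functions of the date-$t$ history, and $\mathbb E_t$ is the conditional expectation given that history (histories evolve by Markov kernels; $\mathbb E_t$ is taken pointwise at every history). $\mathbf 1_{\mathbb N}(t)$ equals $1$ for $t\ge1$ and $0$ for $t=0$. Bankers, entrepreneurs and workers have consumptions $C^b,C^e,C^w>0$, Pareto weights $\omega_b,\omega_e>0$, $\omega_w\ge0$, felicities $U^b(C^b),U^e(C^e),U^w(C^w,N)$ that are $C^2$ on the positive domain ($U^b,U^e$ increasing and concave; $U^w$ strictly concave, increasing in $C^w$, decreasing in $N$, with $U^w_C\to\infty$ as $C^w\to0$), and discount factors $\beta_b,\beta_e\in(0,\beta]$ and $\beta\in(0,1)$. Technology is $F(k,n)=k^\alpha n^{1-\alpha}$, $\alpha\in(0,1)$, with depreciation rate $\delta\in[0,1]$; capital goods satisfy $K_t=(1-\delta)\xi_tK_{t-1}+\Phi(I_t/K_{t-1})K_{t-1}$, $I_t>0$, with $\Phi$ a $C^2$, increasing and concave function on $(0,\infty)$, $\Phi'(0+)=\infty$, $\Phi'(\infty)=0$. Solving for investment gives $I_t=I(K_{t-1},K_t,\xi_t)$,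 and the capital price is $Q_t=Q(K_{t-1},K_t,\xi_t)=1/\Phi'(I_t/K_{t-1})$, with partial derivatives $Q_{1,t},Q_{2,t}$ in its first two arguments. Write $W(C,N)=-U^w_N(C,N)/U^w_C(C,N)$, $R_t=U^w_{C,t}/(\beta\mathbb E_tU^w_{C,t+1})$, $F_{K,t},F_{N,t}$ for the marginal products of $F$ at $(\xi_tK_{t-1},N_t)$. Exogenous or policy processes: $A_t,\xi_t>0$, $\kappa_t,m_t\in[0,1]$, and gross inflation $\Pi_t>0$, with relative price $\widetilde P_t>0$ and dispersion $\Delta_t>0$ satisfying $\Pi_t^{1-\epsilon}=\theta+(1-\theta)(\Pi_t\widetilde P_t)^{1-\epsilon}$ and $\Delta_t=\theta\Pi_t^\epsilon\Delta_{t-1}+(1-\theta)\widetilde P_t^{-\epsilon}$, where $\epsilon>1$, $\theta\in[0,1]$. The initial values $K_{-1},L_{-1}>0$, $D_{-1},R_{-1},\Delta_{-1}$ are given. Expectations that appear in equilibrium conditions and in the planner's constraints are assumed to exist. **Regulated competitive equilibrium (CE).** Given taxes $(\tau^D,\tau^N,\tau^L,\tau^K)$ rebated lump sum, it consists of allocations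 with positive consumptions, $K,L,N,I$, $D_t\ge0$, prices $P^w,Q,R,R^L,W$, retailers' auxiliary variables $\Omega_1,\Omega_2>0$, and private multipliers $\hat\lambda^b_t,\hat\lambda^e_t\ge0$ with: * workers: $W_t=W(C^w_t,N_t)$ and $U^w_{C,t}=\beta R_t\mathbb E_tU^w_{C,t+1}$; * bankers: $C^b_t+L_t=R^L_tL_{t-1}-R_{t-1}D_{t-1}+(1-\tau^D_t)D_t+T^b_t$, $T^b_t=\tau^D_tD_t$; $D_t\le(1-\kappa_t)L_t$ with complementary slackness for $\hat\lambda^b_t$; $U^b_{C,t}(1-\tau^D_t)\le\beta_bR_t\mathbb E_tU^b_{C,t+1}+\hat\lambda^b_t$, with equality if $D_t>0$; $U^b_{C,t}=\beta_b\mathbb E_t(U^b_{C,t+1}R^L_{t+1})+\hat\lambda^b_t(1-\kappa_t)$; * entrepreneurs: $C^e_t+(1+\tau^K_t)Q_tK_t+(1+\tau^N_t)W_tN_t+R^L_tL_{t-1}=P^w_tA_tF(\xi_tK_{t-1},N_t)+Q_t(1-\delta)\xi_tK_{t-1}+(1-\tau^L_t)L_t+T^e_t$, $T^e_t=\tau^K_tQ_tK_t+\tau^N_tW_tN_t+\tau^L_tL_t$;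 $\mathbb E_t(R^L_{t+1})L_t\le m_t\mathbb E_t(Q_{t+1}\xi_{t+1})K_t$ with complementary slackness for $\hat\lambda^e_t$; $(1+\tau^N_t)W_t=P^w_tA_tF_{N,t}$; $U^e_{C,t}(1-\tau^L_t)=\beta_e\mathbb E_t(U^e_{C,t+1}R^L_{t+1})+\hat\lambda^e_t\mathbb E_tR^L_{t+1}$; $U^e_{C,t}(1+\tau^K_t)Q_t=\beta_e\mathbb E_t(U^e_{C,t+1}X_{t+1})+\hat\lambda^e_tm_t\mathbb E_t(Q_{t+1}\xi_{t+1})$, where $X_t=[P^w_tA_tF_{K,t}+(1-\delta)Q_t]\xi_t$; * retailers: $\widetilde P_t=\frac{\epsilon}{\epsilon-1}\frac{\Omega_{1,t}}{\Omega_{2,t}}$, $\Omega_{1,t}=P^w_tY_t+\theta\mathbb E_t\big[\beta\frac{U^w_{C,t+1}}{U^w_{C,t}}\Pi_{t+1}^{\epsilon}\Omega_{1,t+1}\big]$, $\Omega_{2,t}=Y_t+\theta\mathbb E_t\big[\beta\frac{U^w_{C,t+1}}{U^w_{C,t}}\Pi_{t+1}^{\epsilon-1}\Omega_{2,t+1}\big]$;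 * capital good supply and market clearing: $Q_t=1/\Phi'(I_t/K_{t-1})$, the capital accumulation equation, $A_tF(\xi_tK_{t-1},N_t)=\Delta_tY_t$, $Y_t=C^b_t+C^e_t+C^w_t+I_t$. A CE is a regulated CE with zero taxes in which the deposit Euler condition holds with equality. **Planner.** A constrained efficient allocation (CEA) is a plan $(C^b,C^e,C^w,D,K,L,N,\Omega_1)$, with $D_t\ge0$, the other controls and investment positive, and well-defined welfare, that at every initial history maximizes $\mathbb E_0\sum_t\beta^t\sum_i\omega_iU^i_t$ subject to the following constraints (multipliers on the left), with $G_t:=U^b_{C,t}L_t-\beta_b\mathbb E_t[U^b_{C,t+1}(C^b_{t+1}+L_{t+1}-D_{t+1}+R_tD_t)]$: $$\begin{aligned} \lambda^b_t:\;&0\le(1-\kappa_t)L_t-D_t,\qquad \lambda^L_{1,t}:\;0\le G_t\ (\text{with equality if }D_t=0),\qquad \lambda^L_{2,t}:\;0=G_t[(1-\kappa_t)L_t-D_t],\\ \lambda^C_t:\;&0=\Delta_t\Big\{\Omega_{1,t}-\tfrac{\beta\theta\mathbb E_t[U^w_{C,t+1}\Pi_{t+1}^\epsilon\Omega_{1,t+1}]}{U^w_{C,t}}\Big\}-Q_t[K_t-(1-\delta)\xi_tK_{t-1}]-W_tN_t+D_t-R_{t-1}D_{t-1}-C^b_t-C^e_t,\\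 \lambda^e_t:\;&0\le m_t\mathbb E_t(Q_{t+1}\xi_{t+1})K_t-\mathbb E_t(C^b_{t+1}+L_{t+1}-D_{t+1}+R_tD_t),\\ \lambda^Y_t:\;&0=\tfrac{A_t}{\Delta_t}F(\xi_tK_{t-1},N_t)-\textstyle\sum_iC^i_t-I_t,\\ \lambda^\Omega_t:\;&0=\tfrac{\epsilon-1}{\epsilon}\widetilde P_t\tfrac{A_t}{\Delta_t}F(\xi_tK_{t-1},N_t)-\Omega_{1,t}+\tfrac{\beta\theta}{U^w_{C,t}}\mathbb E_t\Big[U^w_{C,t+1}\Pi_{t+1}^{\epsilon-1}\tfrac{\widetilde P_t}{\widetilde P_{t+1}}\Omega_{1,t+1}\Big]. \end{aligned}$$ In the flexible-price problem there is no $\lambda^\Omega$ constraint, the term $\Delta_t\{\cdot\}$ in the $\lambda^C$ constraint is replaced by $A_tF(\xi_tK_{t-1},N_t)$ and $A_t/\Delta_t$ in the $\lambda^Y$ constraint by $A_t$. Lagrange multipliers of a CEA are measurable processes making the Lagrangian $\mathbb E_0\sum_t\beta^t(\sum_i\omega_iU^i_t+\sum\lambda_t\cdot\text{constraint}_t)$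 stationary in every control at every history (for $D_t$: derivative $\le0$, and $=0$ if $D_t>0$), with $\lambda^b,\lambda^e\ge0$, $\lambda^L_{1,t}\ge0$ when $D_t>0$, and complementary slackness. Along a plan put $R^L_t=(C^b_t+L_t-D_t+R_{t-1}D_{t-1})/L_{t-1}$, $P^w_t=\frac{\Delta_t}{A_tF(\xi_tK_{t-1},N_t)}\{\Omega_{1,t}-\beta\theta\mathbb E_t[U^w_{C,t+1}\Pi_{t+1}^\epsilon\Omega_{1,t+1}]/U^w_{C,t}\}$, $X_t$ as above, $R^K_{t+1}=X_{t+1}/Q_t$, $\lambda^L_t=\lambda^L_{1,t}+\lambda^L_{2,t}[(1-\kappa_t)L_t-D_t]$; $\lambda^L_{-1}=\lambda^e_{-1}=0$. **Proposition.** (A) In the sticky-price economy the following hold. 1. *Wedges.* Let a CEA with Lagrange multipliers be given. If the random variables under the expectations below are integrable and the denominators in $\Psi^N_t$ and $P^w_t$ are nonzero, then at every history $$\begin{aligned} U^b_{C,t}&\le\beta_bR_t\mathbb E_tU^b_{C,t+1}+\tfrac{\lambda^b_t}{\omega_b}+\Psi^D_t\quad(\text{with equality if }D_t>0),\\ U^e_{C,t}&=\beta_e\mathbb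 E_t(U^e_{C,t+1}R^L_{t+1})+\tfrac{\lambda^e_t}{\omega_e}\mathbb E_tR^L_{t+1}+\Psi^L_t,\qquad W_t=P^w_tA_tF_{N,t}+\Psi^N_t,\\ U^e_{C,t}Q_t&=\beta_e\mathbb E_t(U^e_{C,t+1}X_{t+1})+\tfrac{\lambda^e_t}{\omega_e}m_t\mathbb E_t(Q_{t+1}\xi_{t+1})+\Psi^K_t, \end{aligned}$$ where $$\begin{aligned} \omega_b\Psi^D_t={}&(\beta-\beta_b)R_t\mathbb E_t(\omega_bU^b_{C,t+1})+\lambda^Y_t-\beta R_t\mathbb E_t\lambda^Y_{t+1}+\lambda^L_{2,t}[U^b_{C,t}-\beta_b\mathbb E_t(U^b_{C,t+1}R^L_{t+1})]L_t\\ &-\lambda^L_t[U^b_{CC,t}+\beta_bR_t\mathbb E_t(U^b_{CC,t+1}R^L_{t+1})]L_t+\beta R_t\mathbb E_t(\lambda^L_{t+1}U^b_{CC,t+1}L_{t+1})+\tfrac{\mathbf 1_{\mathbb N}(t)}{\beta}\lambda^L_{t-1}\beta_bU^b_{CC,t}R^L_tL_{t-1}; \end{aligned}$$ if $D_t>0$,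 $$\begin{aligned} \omega_e\Psi^L_t={}&(\beta-\beta_e)\mathbb E_t(\omega_eU^e_{C,t+1}R^L_{t+1})-\mathbb E_t[(\beta\omega_eU^e_{C,t+1}+\lambda^e_t)(R^L_{t+1}-R_t)]+\lambda^Y_t-\beta R_t\mathbb E_t\lambda^Y_{t+1}\\ &-\lambda^L_t\Big[\tfrac{U^b_{C,t}}{1-\kappa_t}-\beta_bR_t\mathbb E_tU^b_{C,t+1}\Big]+\tfrac{\mathbf 1_{\mathbb N}(t)}{\beta}\tfrac{\kappa_t}{1-\kappa_t}(\lambda^L_{t-1}\beta_bU^b_{C,t}+\lambda^e_{t-1}); \end{aligned}$$ if $D_t=0$, $$\begin{aligned} \omega_e\Psi^L_t={}&(\beta_b-\beta_e)\mathbb E_t(\omega_eU^e_{C,t+1}R^L_{t+1})+\lambda^L_t\Big\{U^b_{CC,t}L_t-U^b_{C,t}+\tfrac{\beta_b^2}{\beta}\mathbb E_t[(U^b_{CC,t+1}R^L_{t+1}L_t+U^b_{C,t+1})R^L_{t+1}]\Big\}\\ &-\beta_b\mathbb E_t(\lambda^L_{t+1}U^b_{CC,t+1}L_{t+1}R^L_{t+1})-\tfrac{\mathbf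 1_{\mathbb N}(t)}{\beta}\lambda^L_{t-1}\beta_bU^b_{CC,t}R^L_tL_{t-1}-\tfrac{\beta-\beta_b}{\beta}\lambda^e_t\mathbb E_tR^L_{t+1}; \end{aligned}$$ and $$\begin{aligned} \Psi^N_t={}&\frac{[(\omega_eU^e_{C,t}+\lambda^\Omega_t\frac{\epsilon-1}{\epsilon}\widetilde P_t-\lambda^C_t)(P^w_t\Delta_t)^{-1}-\omega_wU^w_{C,t}-\lambda^C_t]P^w_tA_tF_{N,t}-\lambda^C_tW_{N,t}N_t}{\omega_wU^w_{C,t}+\lambda^C_t}\\ &-\frac{U^w_{CN,t}}{U^w_{CC,t}}\cdot\frac{\omega_wU^w_{C,t}-\omega_eU^e_{C,t}+\lambda^C_t(1-W_{C,t}N_t)}{\omega_wU^w_{C,t}+\lambda^C_t},\\ \omega_e\Psi^K_t={}&(\beta-\beta_e)\mathbb E_t(\omega_eU^e_{C,t+1}R^K_{t+1})Q_t+\beta\mathbb E_t\Big\{\lambda^Y_{t+1}\Big[Q_{t+1}\Phi\big(\tfrac{I_{t+1}}{K_t}\big)-\tfrac{I_{t+1}}{K_t}\Big]\Big\}-\lambda^C_tQ_{2,t}[K_t-(1-\delta)\xi_tK_{t-1}]\\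 &-\beta\mathbb E_t\{\lambda^C_{t+1}Q_{1,t+1}[K_{t+1}-(1-\delta)\xi_{t+1}K_t]\}+\lambda^e_tm_t\mathbb E_t(Q_{1,t+1}\xi_{t+1})K_t+\tfrac{\mathbf 1_{\mathbb N}(t)}{\beta}\lambda^e_{t-1}m_{t-1}Q_{2,t}\xi_tK_{t-1}\\ &+\beta\mathbb E_t\Big\{\Big[\omega_eU^e_{C,t+1}(1-P^w_{t+1}\Delta_{t+1})+\lambda^\Omega_{t+1}\tfrac{\epsilon-1}{\epsilon}\widetilde P_{t+1}-\lambda^C_{t+1}\Big]\tfrac{A_{t+1}}{\Delta_{t+1}}F_{K,t+1}\xi_{t+1}\Big\}. \end{aligned}$$ The deposit and loan conditions hold with the very same functions $\Psi^D,\Psi^L$ of allocation and multipliers for the CEA of the flexible-price economy. 2. *Constrained inefficiency.* Every CE allocation with well-defined welfare is feasible for the planner. It is not a CEA if at some initial history $\hat\lambda^b_0>0$, $\kappa_0<1$ and $\omega_bU^b_{C,0}\ne\omega_eU^e_{C,0}$. If a CE allocation is a CEA (with multipliers, under the provisos of 1), then $\Psi^N_t=0$, $\Psi^D_t=\hat\lambda^b_t-\lambda^b_t/\omega_b$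 whenever $D_t>0$, $\Psi^L_t=(\hat\lambda^e_t-\lambda^e_t/\omega_e)\mathbb E_tR^L_{t+1}$ and $\Psi^K_t=(\hat\lambda^e_t-\lambda^e_t/\omega_e)m_t\mathbb E_t(Q_{t+1}\xi_{t+1})$ at every history. 3. *Risk sharing.* In a CEA with multipliers, $\omega_bU^b_{C,t}=\omega_eU^e_{C,t}$ at every history at which $\lambda^L_t=\lambda^L_{t-1}=\lambda^e_{t-1}=0$; in particular at every history $t$ such that the collateral constraint has been slack at all dates $s<t$ along it. 4. *Decentralization.* If $\kappa_t<1$ always, then, under the provisos of 1, a CEA is the allocation of a regulated CE with $$\tau^D_t=\frac1{U^b_{C,t}}\Big[\frac{\lambda^b_t}{\omega_b}-\frac{U^b_{C,t}-\beta_b\mathbb E_t(U^b_{C,t+1}R^L_{t+1})}{1-\kappa_t}+\Psi^D_t\Big],\quad\tau^N_t=\frac{-\Psi^N_t}{W_t},\quad\tau^L_t=\frac{\Psi^L_t}{U^e_{C,t}},\quad\tau^K_t=\frac{-\Psi^K_t}{U^e_{C,t}Q_t}$$ and the corresponding rebates $T^b,T^e$; and no regulated CE (with any linear taxes rebated lump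 sum) with well-defined welfare yields higher welfare at any initial history, i.e. the policy is Ramsey optimal. (B) *Steady states.* Let all exogenous variables and policies be constant and deterministic, $\kappa<1$. A steady state is a constant feasible plan with constant multipliers satisfying the optimality conditions of the planner at dates $t\ge1$ (initial conditions being those that the plan reproduces). Write $R=1/\beta$. 5. *Local indeterminacy.* No optimality condition pins down $D$: a constant plan with $D\ge0$ and constant multipliers form a steady state as soon as $L=\max\{\frac{D}{1-\kappa},\frac{\beta_b}{1-\beta_b}[C^b+(R-1)D]\}$, $\lambda^b=\lambda^L_2=0$, $\lambda^L_1\ge0$, $\lambda^e=\lambda^L_1(\beta-\beta_b)U^b_C$, the collateral constraint holds, either $\lambda^L_1=0$ or (the collateral constraint binds and $L=\frac{\beta_b}{1-\beta_b}[C^b+(R-1)D]$), and the first-order conditions for $C^b,C^e,C^w,K,N,\Omega_1$ and the $\lambda^C,\lambda^Y,\lambda^\Omega$ constraints hold. Moreover, given a nondegenerate steady state of this kind with $D=0$ (the collateral constraint is slack with $\lambda^L_1=0$, or it binds with $\lambda^L_1>0$; and the remaining square system of equations, with $L=\frac{\beta_b}{1-\beta_b}[C^b+(R-1)D]$, is strictly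 differentiable with an invertible Jacobian with respect to $(C^b,C^e,C^w,K,N,\Omega_1,\lambda^L_1,\lambda^C,\lambda^Y,\lambda^\Omega)$), there are $\bar D>0$ and a family of steady states indexed by their deposits $D\in[0,\bar D]$, starting at the given one, each of which has other steady states, with different deposits, in every neighborhood (so that it is not locally asymptotically stable). 6. *Optimal steady state.* Let a constant plan maximize $\sum_i\omega_iU^i$ among constant feasible plans (in the absence of uncertainty), and suppose that it admits multipliers $\lambda^C,\lambda^e,\lambda^Y,\lambda^\Omega$, with $\lambda^e\ge0$ and complementary slackness, for the problem in which $L$ is eliminated through $L=\max\{\frac{D}{1-\kappa},\frac{\beta_b}{1-\beta_b}[C^b+(R-1)D]\}$: no one-sided variation of a single control (respecting $D\ge0$) raises the Lagrangian to first order. If $\lambda^C>0$ whenever $D>0$, then $D=0$. -/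

import Mathlib

open Set Filter Topology MeasureTheory ProbabilityTheory

universe u

/-! ## Primitives -/

/-- Preferences and technology.  The felicity functions are twice continuously differentiable on the
(open) positive domain, and `F (k, n) = k ^ α * n ^ (1 - α)` is Cobb--Douglas. -/
structure Economy where
  (β βb βe δ α ε θ : ℝ)
  (ωb ωe ωw : ℝ)
  (Ub Ue : ℝ → ℝ)
  (Uw : ℝ → ℝ → ℝ)
  (Φ : ℝ → ℝ)
  β_mem : β ∈ Ioo (0 : ℝ) 1
  βb_mem : βb ∈ Ioc (0 : ℝ) β
  βe_mem : βe ∈ Ioc (0 : ℝ) β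
  δ_mem : δ ∈ Icc (0 : ℝ) 1
  α_mem : α ∈ Ioo (0 : ℝ) 1
  ε_gt : 1 < ε
  θ_mem : θ ∈ Icc (0 : ℝ) 1
  ωb_nonneg : 0 ≤ ωb
  ωe_nonneg : 0 ≤ ωe
  ωw_nonneg : 0 ≤ ωw
  Ub_smooth : ContDiffOn ℝ 2 Ub (Ioi 0)
  Ub_deriv_pos : ∀ c, 0 < c → 0 < deriv Ub c
  Ub_deriv2 : ∀ c, 0 < c → deriv (deriv Ub) c ≤ 0
  Ue_smooth : ContDiffOn ℝ 2 Ue (Ioi 0)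
  Ue_deriv_pos : ∀ c, 0 < c → 0 < deriv Ue c
  Ue_deriv2 : ∀ c, 0 < c → deriv (deriv Ue) c ≤ 0
  Uw_smooth : ContDiffOn ℝ 2 (fun p : ℝ × ℝ => Uw p.1 p.2) (Ioi 0 ×ˢ Ioi 0)
  Uw_concave : StrictConcaveOn ℝ (Ioi 0 ×ˢ Ioi 0) (fun p : ℝ × ℝ => Uw p.1 p.2)
  Uw_C_pos : ∀ c n, 0 < c → 0 < n → 0 < deriv (fun c' => Uw c' n) c
  Uw_N_neg : ∀ c n, 0 < c → 0 < n → deriv (fun n' => Uw c n') n < 0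
  Uw_inada : ∀ n, 0 < n → Tendsto (fun c => deriv (fun c' => Uw c' n) c) (𝓝[>] 0) atTop
  Φ_smooth : ContDiffOn ℝ 2 Φ (Ioi 0)
  Φ_deriv_pos : ∀ x, 0 < x → 0 < deriv Φ x
  Φ_deriv2 : ∀ x, 0 < x → deriv (deriv Φ) x ≤ 0
  Φ_zero : Tendsto (deriv Φ) (𝓝[>] 0) atTop
  Φ_top : Tendsto (deriv Φ) atTop (𝓝 0)

namespace Economy

variable (E : Economy)

/-- Marginal utilities and their derivatives. -/
noncomputable def UbC (c : ℝ) : ℝ := deriv E.Ub c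
noncomputable def UbCC (c : ℝ) : ℝ := deriv E.UbC c
noncomputable def UeC (c : ℝ) : ℝ := deriv E.Ue c
noncomputable def UwC (c n : ℝ) : ℝ := deriv (fun c' => E.Uw c' n) c
noncomputable def UwN (c n : ℝ) : ℝ := deriv (fun n' => E.Uw c n') n
noncomputable def UwCC (c n : ℝ) : ℝ := deriv (fun c' => E.UwC c' n) c
noncomputable def UwCN (c n : ℝ) : ℝ := deriv (fun n' => E.UwC c n') n

/-- Cobb--Douglas technology and its marginal products. -/
noncomputable def F (k n : ℝ) : ℝ := k ^ E.α * n ^ (1 - E.α)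
noncomputable def FK (k n : ℝ) : ℝ := deriv (fun k' => E.F k' n) k
noncomputable def FN (k n : ℝ) : ℝ := deriv (fun n' => E.F k n') n

/-- Inverse of the (strictly increasing) capital good technology on `(0, ∞)`. -/
noncomputable def Φinv (y : ℝ) : ℝ := Function.invFunOn E.Φ (Ioi 0) y

/-- Investment `I(K₋, K, ξ)` solving `K = (1 - δ) ξ K₋ + Φ(I / K₋) K₋`. -/
noncomputable def Inv (k k' ξ : ℝ) : ℝ := k * E.Φinv (k' / k - (1 - E.δ) * ξ)

/-- Price of capital `Q(K₋, K, ξ) = 1 / Φ'(I(K₋, K, ξ) / K₋)`. -/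
noncomputable def Q (k k' ξ : ℝ) : ℝ := (deriv E.Φ (E.Inv k k' ξ / k))⁻¹
noncomputable def Q1 (k k' ξ : ℝ) : ℝ := deriv (fun a => E.Q a k' ξ) k
noncomputable def Q2 (k k' ξ : ℝ) : ℝ := deriv (fun a => E.Q k a ξ) k'

/-- Wage on the worker's labor supply curve. -/
noncomputable def W (c n : ℝ) : ℝ := -E.UwN c n / E.UwC c n
noncomputable def WC (c n : ℝ) : ℝ := deriv (fun a => E.W a n) c
noncomputable def WN (c n : ℝ) : ℝ := deriv (fun a => E.W c a) n

/-- Deposit rate from the worker's Euler equation, as a function of today's marginal utility and of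
tomorrow's expected marginal utility. -/
noncomputable def Rate (u e : ℝ) : ℝ := u / (E.β * e)

end Economy

/-! ## Histories, processes, conditional expectations -/

/-- Histories of states of nature: `Z t` is the set of date-`t` histories, `prev` truncates a history,
and `ker t z` is the conditional distribution of the date-`t+1` history given the date-`t` history `z`. -/
structure Histories where
  Z : ℕ → Type u
  mZ : ∀ t, MeasurableSpace (Z t)
  singZ : ∀ t, MeasurableSingletonClass (Z t)
  prev : ∀ t, Z (t + 1) → Z t
  prev_meas : ∀ t, Measurable (prev t)
  ker : ∀ t, Kernel (Z t) (Z (t + 1))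
  markov : ∀ t, IsMarkovKernel (ker t)
  ker_prev : ∀ t z, ∀ᵐ z' ∂(ker t z), prev t z' = z

attribute [instance] Histories.mZ Histories.singZ Histories.markov

namespace Histories

variable (H : Histories.{u})

/-- A real process: a function of the history at each date. -/
abbrev Proc : Type u := ∀ t, H.Z t → ℝ

/-- `𝔼_t` of a date-`t+1` variable, as a function of the date-`t` history. -/
noncomputable def EX (t : ℕ) (f : H.Z (t + 1) → ℝ) (z : H.Z t) : ℝ := ∫ z', f z' ∂(H.ker t z)

/-- The variable under `𝔼_t` is integrable at every history. -/
def Int (t : ℕ) (f : H.Z (t + 1) → ℝ) : Prop := ∀ z, Integrable f (H.ker t z)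

/-- Distribution of the date-`t` history conditional on the initial history. -/
noncomputable def law : ∀ t, Kernel (H.Z 0) (H.Z t)
  | 0 => Kernel.id
  | t + 1 => (H.ker t) ∘ₖ (law t)

/-- The lagged process, with a given value before date `0`. -/
def lag (X : H.Proc) (x0 : ℝ) : H.Proc
  | 0, _ => x0
  | t + 1, z => X t (H.prev t z)

/-- `p` holds at all strict predecessors of the history `z`. -/
def PastAll (p : ∀ t, H.Z t → Prop) : ∀ t, H.Z t → Prop
  | 0, _ => True
  | t + 1, z => p t (H.prev t z) ∧ PastAll p t (H.prev t z)

/-- The degenerate event tree with no uncertainty. -/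
noncomputable def deterministic : Histories.{0} where
  Z := fun _ => Unit
  mZ := fun _ => inferInstance
  singZ := fun _ => inferInstance
  prev := fun _ z => z
  prev_meas := fun _ => measurable_id
  ker := fun _ => Kernel.id
  markov := fun _ => inferInstance
  ker_prev := fun _ _ => Filter.Eventually.of_forall fun _ => rfl

end Histories

/-! ## Exogenous processes and policies -/

/-- Realizations of productivity `A`, capital quality `ξ`, policies `κ`, `m`, `infl` (gross inflation),
price dispersion `Δ` and the retailers' optimal relative price `P`. -/
structure Node where
  (A ξ κ m infl Δ P : ℝ)

/-- Exogenous processes and policies taken as given, together with the relative price and the price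
dispersion that inflation generates through the retail pricing equations. -/
structure Env (E : Economy) (H : Histories.{u}) where
  node : ∀ t, H.Z t → Node
  Δinit : ℝ
  A_meas : ∀ t, Measurable fun z => (node t z).A
  ξ_meas : ∀ t, Measurable fun z => (node t z).ξ
  κ_meas : ∀ t, Measurable fun z => (node t z).κ
  m_meas : ∀ t, Measurable fun z => (node t z).m
  infl_meas : ∀ t, Measurable fun z => (node t z).infl
  Δ_meas : ∀ t, Measurable fun z => (node t z).Δ
  P_meas : ∀ t, Measurable fun z => (node t z).P
  A_pos : ∀ t z, 0 < (node t z).A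
  ξ_pos : ∀ t z, 0 < (node t z).ξ
  κ_mem : ∀ t z, (node t z).κ ∈ Icc (0 : ℝ) 1
  m_mem : ∀ t z, (node t z).m ∈ Icc (0 : ℝ) 1
  infl_pos : ∀ t z, 0 < (node t z).infl
  Δ_pos : ∀ t z, 0 < (node t z).Δ
  P_pos : ∀ t z, 0 < (node t z).P
  inflation : ∀ t z, (node t z).infl ^ (1 - E.ε)
    = E.θ + (1 - E.θ) * ((node t z).infl * (node t z).P) ^ (1 - E.ε)
  dispersion : ∀ t z, (node t z).Δ
    = E.θ * (node t z).infl ^ E.ε * H.lag (fun s y => (node s y).Δ) Δinit t z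
      + (1 - E.θ) * (node t z).P ^ (-E.ε)

/-- Time-invariant exogenous variables and policies: the data of a deterministic steady state. -/
structure SteadyEnv (E : Economy) extends Node where
  A_pos : 0 < A
  ξ_pos : 0 < ξ
  κ_mem : κ ∈ Icc (0 : ℝ) 1
  m_mem : m ∈ Icc (0 : ℝ) 1
  infl_pos : 0 < infl
  Δ_pos : 0 < Δ
  P_pos : 0 < P
  inflation : infl ^ (1 - E.ε) = E.θ + (1 - E.θ) * (infl * P) ^ (1 - E.ε)
  dispersion : Δ = E.θ * infl ^ E.ε * Δ + (1 - E.θ) * P ^ (-E.ε)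

/-- The corresponding constant environment without uncertainty. -/
noncomputable def SteadyEnv.env {E : Economy} (S : SteadyEnv E) : Env E Histories.deterministic where
  node := fun _ _ => S.toNode
  Δinit := S.Δ
  A_meas := fun _ => measurable_const
  ξ_meas := fun _ => measurable_const
  κ_meas := fun _ => measurable_const
  m_meas := fun _ => measurable_const
  infl_meas := fun _ => measurable_const
  Δ_meas := fun _ => measurable_const
  P_meas := fun _ => measurable_const
  A_pos := fun _ _ => S.A_pos
  ξ_pos := fun _ _ => S.ξ_pos
  κ_mem := fun _ _ => S.κ_mem
  m_mem := fun _ _ => S.m_mem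
  infl_pos := fun _ _ => S.infl_pos
  Δ_pos := fun _ _ => S.Δ_pos
  P_pos := fun _ _ => S.P_pos
  inflation := fun _ _ => S.inflation
  dispersion := fun t z => by
    cases t <;> exact S.dispersion

/-- Predetermined variables `K₋₁`, `D₋₁`, `R₋₁`, `L₋₁`. -/
structure Init where
  (K D R L : ℝ)

/-! ## The planner's problem

The problem is written in recursive form: the date-`t` constraints are functions of the lagged link
variables `(K_{t-1}, R_{t-1} D_{t-1})`, of the date-`t` controls, and of finitely many conditional
expectations ("slots") `𝔼_t f(x_t, x_{t+1})`.  The same form covers the flexible-price economy (where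
the control `Ω₁` is inert) and the sticky-price economy. -/

inductive Regime
  | flexible
  | sticky

/-- Controls. -/
inductive Ctl
  | Cb | Ce | Cw | D | K | L | N | Om
  deriving DecidableEq

instance : Fintype Ctl :=
  ⟨{.Cb, .Ce, .Cw, .D, .K, .L, .N, .Om}, by intro a; cases a <;> decide⟩

/-- Constraints, with multipliers `λᵇ, λᴸ₁, λᴸ₂, λᶜ, λᵉ, λʸ, λ^Ω`. -/
inductive Cnstr
  | lev | loan1 | loan2 | bud | col | res | om
  deriving DecidableEq

instance : Fintype Cnstr :=
  ⟨{.lev, .loan1, .loan2, .bud, .col, .res, .om}, by intro a; cases a <;> decide⟩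

/-- Conditional expectations entering the constraints. -/
inductive Slot
  | wMU | bPay | bMU | price | pay | mc | mb
  deriving DecidableEq

instance : Fintype Slot :=
  ⟨{.wMU, .bPay, .bMU, .price, .pay, .mc, .mb}, by intro a; cases a <;> decide⟩

/-- Link variables to the next date: `K_t` and `R_t D_t`. -/
inductive Link
  | K | RD
  deriving DecidableEq

instance : Fintype Link :=
  ⟨{.K, .RD}, by intro a; cases a <;> decide⟩

/-- Partial derivative of a function of finitely many real variables. -/
noncomputable def pd {ι : Type} [DecidableEq ι] (f : (ι → ℝ) → ℝ) (v : ι → ℝ) (i : ι) : ℝ :=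
  deriv (fun a => f (Function.update v i a)) (v i)

namespace Economy

variable (E : Economy)

/-- Pareto-weighted period utility. -/
noncomputable def felicity (x : Ctl → ℝ) : ℝ :=
  E.ωb * E.Ub (x .Cb) + E.ωe * E.Ue (x .Ce) + E.ωw * E.Uw (x .Cw) (x .N)

/-- The variables whose conditional expectations enter the constraints: `x` are today's controls,
`x'` and `ν'` tomorrow's controls and exogenous variables. -/
noncomputable def slotFn (ν' : Node) (x x' : Ctl → ℝ) : Slot → ℝ
  | .wMU => E.UwC (x' .Cw) (x' .N)
  | .bPay => E.UbC (x' .Cb) * (x' .Cb + x' .L - x' .D)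
  | .bMU => E.UbC (x' .Cb)
  | .price => E.Q (x .K) (x' .K) ν'.ξ * ν'.ξ
  | .pay => x' .Cb + x' .L - x' .D
  | .mc => E.UwC (x' .Cw) (x' .N) * ν'.infl ^ E.ε * x' .Om
  | .mb => E.UwC (x' .Cw) (x' .N) * ν'.infl ^ (E.ε - 1) / ν'.P * x' .Om

/-- The deposit rate `R_t`. -/
noncomputable def R (x : Ctl → ℝ) (e : Slot → ℝ) : ℝ :=
  E.Rate (E.UwC (x .Cw) (x .N)) (e .wMU)

noncomputable def link (x : Ctl → ℝ) (e : Slot → ℝ) : Link → ℝ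
  | .K => x .K
  | .RD => E.R x e * x .D

/-- `U^b_C(C^b_t) L_t - β_b 𝔼_t[U^b_C(C^b_{t+1}) (C^b_{t+1} + L_{t+1} - D_{t+1} + R_t D_t)]`. -/
noncomputable def loanGap (x : Ctl → ℝ) (e : Slot → ℝ) : ℝ :=
  E.UbC (x .Cb) * x .L - E.βb * (e .bPay + E.R x e * x .D * e .bMU)

/-- Entrepreneurial revenue `P^w_t A_t F(ξ_t K_{t-1}, N_t)` (with `P^w_t = 1` under flexible prices and
as implied by the retailers' demand for wholesale goods under sticky prices). -/
noncomputable def revenue (r : Regime) (ν : Node) (s : Link → ℝ) (x : Ctl → ℝ) (e : Slot → ℝ) : ℝ :=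
  match r with
  | .flexible => ν.A * E.F (ν.ξ * s .K) (x .N)
  | .sticky => ν.Δ * (x .Om - E.β * E.θ * e .mc / E.UwC (x .Cw) (x .N))

/-- Final good output. -/
noncomputable def output (r : Regime) (ν : Node) (s : Link → ℝ) (x : Ctl → ℝ) : ℝ :=
  match r with
  | .flexible => ν.A * E.F (ν.ξ * s .K) (x .N)
  | .sticky => ν.A / ν.Δ * E.F (ν.ξ * s .K) (x .N)

/-- The constraint functions of the planner's problem. -/
noncomputable def con (r : Regime) (ν : Node) (s : Link → ℝ) (x : Ctl → ℝ) (e : Slot → ℝ) : Cnstr → ℝ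
  | .lev => (1 - ν.κ) * x .L - x .D
  | .loan1 => E.loanGap x e
  | .loan2 => E.loanGap x e * ((1 - ν.κ) * x .L - x .D)
  | .bud => E.revenue r ν s x e - E.Q (s .K) (x .K) ν.ξ * (x .K - (1 - E.δ) * ν.ξ * s .K)
      - E.W (x .Cw) (x .N) * x .N + x .D - s .RD - x .Cb - x .Ce
  | .col => ν.m * e .price * x .K - (e .pay + E.R x e * x .D)
  | .res => E.output r ν s x - (x .Cb + x .Ce + x .Cw) - E.Inv (s .K) (x .K) ν.ξ
  | .om => match r with
      | .flexible => 0
      | .sticky => (E.ε - 1) / E.ε * ν.P * (ν.A / ν.Δ) * E.F (ν.ξ * s .K) (x .N) - x .Om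
          + E.β * E.θ * (ν.P * e .mb) / E.UwC (x .Cw) (x .N)

/-- Multiplier-weighted sum of the constraint functions. -/
noncomputable def conSum (r : Regime) (ν : Node) (s : Link → ℝ) (x : Ctl → ℝ) (e : Slot → ℝ)
    (m : Cnstr → ℝ) : ℝ := ∑ i, m i * E.con r ν s x e i

end Economy

/-- A plan: controls as functions of histories. -/
abbrev Plan (H : Histories.{u}) : Type u := ∀ t, H.Z t → Ctl → ℝ

/-- Lagrange multipliers as functions of histories. -/
abbrev Mult (H : Histories.{u}) : Type u := ∀ t, H.Z t → Cnstr → ℝ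

namespace Env

variable {E : Economy} {H : Histories.{u}} (V : Env E H) (i₀ : Init)

/-- The conditional expectations at date `t`. -/
noncomputable def exps (x : Plan H) (t : ℕ) (z : H.Z t) (j : Slot) : ℝ :=
  H.EX t (fun z' => E.slotFn (V.node (t + 1) z') (x t z) (x (t + 1) z') j) z

noncomputable def linkOut (x : Plan H) (t : ℕ) (z : H.Z t) : Link → ℝ :=
  E.link (x t z) (V.exps x t z)

/-- The lagged link variables. -/
noncomputable def linkIn (x : Plan H) : ∀ t, H.Z t → Link → ℝ
  | 0, _, .K => i₀.K
  | 0, _, .RD => i₀.R * i₀.D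
  | t + 1, z, k => V.linkOut x t (H.prev t z) k

noncomputable def conVal (r : Regime) (x : Plan H) (t : ℕ) (z : H.Z t) : Cnstr → ℝ :=
  E.con r (V.node t z) (V.linkIn i₀ x t z) (x t z) (V.exps x t z)

/-- Social welfare `𝔼_0 ∑ β^t ∑ ω_i U^i_t` at the initial history `z₀`. -/
noncomputable def _root_.welfare (E : Economy) {H : Histories.{u}} (x : Plan H) (z₀ : H.Z 0) : ℝ :=
  ∑' t, E.β ^ t * ∫ z, E.felicity (x t z) ∂(H.law t z₀)

/-- Social welfare is well defined. -/
def _root_.WelfareDefined (E : Economy) {H : Histories.{u}} (x : Plan H) : Prop :=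
  ∀ z₀, (∀ t, Integrable (fun z => E.felicity (x t z)) (H.law t z₀)) ∧
    Summable fun t => E.β ^ t * ∫ z, E.felicity (x t z) ∂(H.law t z₀)

/-- The constraint set of the planner: measurable plans in the economic domain (positive consumption,
capital, labor, loans, investment and discounted marginal costs; nonnegative deposits) satisfying the
implementability constraints. -/
structure Feasible (r : Regime) (x : Plan H) : Prop where
  meas : ∀ t a, Measurable fun z => x t z a
  pos : ∀ t z, ∀ a ∈ ({.Cb, .Ce, .Cw, .K, .L, .N, .Om} : Set Ctl), 0 < x t z a
  D_nonneg : ∀ t z, 0 ≤ x t z .D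
  inv : ∀ t z, x t z .K / V.linkIn i₀ x t z .K - (1 - E.δ) * (V.node t z).ξ ∈ E.Φ '' Ioi 0
  slot_int : ∀ t z j, Integrable
    (fun z' => E.slotFn (V.node (t + 1) z') (x t z) (x (t + 1) z') j) (H.ker t z)
  welfare_def : WelfareDefined E x
  lev : ∀ t z, 0 ≤ V.conVal i₀ r x t z .lev
  loan1 : ∀ t z, 0 ≤ V.conVal i₀ r x t z .loan1
  loan1_eq : ∀ t z, x t z .D = 0 → V.conVal i₀ r x t z .loan1 = 0
  loan2 : ∀ t z, V.conVal i₀ r x t z .loan2 = 0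
  bud : ∀ t z, V.conVal i₀ r x t z .bud = 0
  col : ∀ t z, 0 ≤ V.conVal i₀ r x t z .col
  res : ∀ t z, V.conVal i₀ r x t z .res = 0
  om : ∀ t z, V.conVal i₀ r x t z .om = 0

/-- Constrained efficient allocation: a solution of the planner's problem. -/
def IsCEA (r : Regime) (x : Plan H) : Prop :=
  V.Feasible i₀ r x ∧ ∀ y, V.Feasible i₀ r y → ∀ z₀, welfare E y z₀ ≤ welfare E x z₀

/-! ### First-order conditions

Stationarity of the Lagrangian `𝔼_0 ∑ β^t (∑ ω_i U^i_t + ∑ λ_t · con_t)` in each date-`t` control. -/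

/-- Expected marginal value at `t + 1` of the link variable `k`. -/
noncomputable def linkShadow (r : Regime) (x : Plan H) (l : Mult H) (t : ℕ) (z : H.Z t) (k : Link) : ℝ :=
  H.EX t (fun z' => pd (fun s => E.conSum r (V.node (t + 1) z') s (x (t + 1) z')
    (V.exps x (t + 1) z') (l (t + 1) z')) (V.linkOut x t z) k) z

/-- Marginal value at `t` of the conditional expectation `j`, both through the date-`t` constraints and
through the link variables. -/
noncomputable def slotShadow (r : Regime) (x : Plan H) (l : Mult H) (t : ℕ) (z : H.Z t) (j : Slot) : ℝ :=
  pd (fun e => E.conSum r (V.node t z) (V.linkIn i₀ x t z) (x t z) e (l t z)) (V.exps x t z) j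
    + E.β * ∑ k, V.linkShadow r x l t z k * pd (fun e => E.link (x t z) e k) (V.exps x t z) j

/-- Effect of the date-`t` control `a` through the conditional expectations formed at `t - 1`. -/
noncomputable def pastEffect (r : Regime) (x : Plan H) (l : Mult H) (a : Ctl) : H.Proc
  | 0, _ => 0
  | t + 1, z => E.β⁻¹ * ∑ j, V.slotShadow i₀ r x l t (H.prev t z) j *
      pd (fun x' => E.slotFn (V.node (t + 1) z) (x t (H.prev t z)) x' j) (x (t + 1) z) a

/-- Derivative of the Lagrangian with respect to the date-`t` control `a` at the history `z`
(per unit of discounted probability). -/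
noncomputable def foc (r : Regime) (x : Plan H) (l : Mult H) (a : Ctl) (t : ℕ) (z : H.Z t) : ℝ :=
  pd E.felicity (x t z) a
    + pd (fun x₀ => E.conSum r (V.node t z) (V.linkIn i₀ x t z) x₀ (V.exps x t z) (l t z)) (x t z) a
    + E.β * ∑ k, V.linkShadow r x l t z k * pd (fun x₀ => E.link x₀ (V.exps x t z) k) (x t z) a
    + ∑ j, V.slotShadow i₀ r x l t z j *
        H.EX t (fun z' => pd (fun x₀ => E.slotFn (V.node (t + 1) z') x₀ (x (t + 1) z') j) (x t z) a) z
    + V.pastEffect i₀ r x l a t z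

/-- Karush--Kuhn--Tucker conditions at a history. -/
structure KKTAt (r : Regime) (x : Plan H) (l : Mult H) (t : ℕ) (z : H.Z t) : Prop where
  stat : ∀ a, a ≠ .D → V.foc i₀ r x l a t z = 0
  stat_D : V.foc i₀ r x l .D t z ≤ 0
  stat_D_eq : 0 < x t z .D → V.foc i₀ r x l .D t z = 0
  lev_nonneg : 0 ≤ l t z .lev
  lev_slack : l t z .lev * V.conVal i₀ r x t z .lev = 0
  loan1_sign : 0 ≤ x t z .D * l t z .loan1
  loan1_slack : l t z .loan1 * V.conVal i₀ r x t z .loan1 = 0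
  col_nonneg : 0 ≤ l t z .col
  col_slack : l t z .col * V.conVal i₀ r x t z .col = 0

/-- `l` are Lagrange multipliers of the planner's problem at the plan `x`. -/
def IsMultiplier (r : Regime) (x : Plan H) (l : Mult H) : Prop :=
  (∀ t i, Measurable fun z => l t z i) ∧ ∀ t z, V.KKTAt i₀ r x l t z

/-! ### Prices and wedges along a plan -/

section Wedges

variable (x : Plan H) (l : Mult H)

/-- Deposit rate, lagged capital and loans, loan rate `R^L_t = (C^b_t + L_t - D_t + R_{t-1}D_{t-1}) / L_{t-1}`,
investment, price of capital and wage. -/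
noncomputable def Rp : H.Proc := fun t z => E.R (x t z) (V.exps x t z)
noncomputable def Klag : H.Proc := fun t z => V.linkIn i₀ x t z .K
noncomputable def Llag : H.Proc := H.lag (fun t z => x t z .L) i₀.L
noncomputable def RLp : H.Proc := fun t z =>
  (x t z .Cb + x t z .L - x t z .D + V.linkIn i₀ x t z .RD) / Llag i₀ x t z
noncomputable def Ip : H.Proc := fun t z => E.Inv (V.Klag i₀ x t z) (x t z .K) (V.node t z).ξ
noncomputable def Qp : H.Proc := fun t z => E.Q (V.Klag i₀ x t z) (x t z .K) (V.node t z).ξ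
noncomputable def Wp (E : Economy) (x : Plan H) : H.Proc := fun t z => E.W (x t z .Cw) (x t z .N)

/-- Wholesale output `A_t F(ξ_t K_{t-1}, N_t)`, marginal products, and the wholesale price `P^w_t` implied
by the retailers' demand curve. -/
noncomputable def AFp : H.Proc := fun t z =>
  (V.node t z).A * E.F ((V.node t z).ξ * V.Klag i₀ x t z) (x t z .N)
noncomputable def AFK : H.Proc := fun t z =>
  (V.node t z).A * E.FK ((V.node t z).ξ * V.Klag i₀ x t z) (x t z .N)
noncomputable def AFN : H.Proc := fun t z =>
  (V.node t z).A * E.FN ((V.node t z).ξ * V.Klag i₀ x t z) (x t z .N)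
noncomputable def Pwp : H.Proc := fun t z =>
  (V.node t z).Δ / V.AFp i₀ x t z * (x t z .Om - E.β * E.θ *
    H.EX t (fun z' => E.UwC (x (t + 1) z' .Cw) (x (t + 1) z' .N) * (V.node (t + 1) z').infl ^ E.ε
      * x (t + 1) z' .Om) z / E.UwC (x t z .Cw) (x t z .N))

/-- Payoff of a unit of capital, `(P^w_t A_t F_{K,t} + Q_t (1 - δ)) ξ_t`. -/
noncomputable def capPay : H.Proc := fun t z =>
  (V.Pwp i₀ x t z * V.AFK i₀ x t z + V.Qp i₀ x t z * (1 - E.δ)) * (V.node t z).ξ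

/-- Marginal utilities along the plan. -/
noncomputable def ub (E : Economy) (x : Plan H) : H.Proc := fun t z => E.UbC (x t z .Cb)
noncomputable def ubb (E : Economy) (x : Plan H) : H.Proc := fun t z => E.UbCC (x t z .Cb)
noncomputable def ue (E : Economy) (x : Plan H) : H.Proc := fun t z => E.UeC (x t z .Ce)
noncomputable def uw (E : Economy) (x : Plan H) : H.Proc := fun t z => E.UwC (x t z .Cw) (x t z .N)

/-- `λᴸ_t = λᴸ_{1,t} + λᴸ_{2,t} [(1 - κ_t) L_t - D_t]`. -/
noncomputable def lamL : H.Proc := fun t z =>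
  l t z .loan1 + l t z .loan2 * ((1 - (V.node t z).κ) * x t z .L - x t z .D)

/-- Deposit wedge. -/
noncomputable def ΨD : H.Proc := fun t z =>
  E.ωb⁻¹ * ((E.β - E.βb) * V.Rp x t z * H.EX t (fun z' => E.ωb * ub E x (t + 1) z') z
    + (l t z .res - E.β * V.Rp x t z * H.EX t (fun z' => l (t + 1) z' .res) z)
    + l t z .loan2 * (ub E x t z
        - E.βb * H.EX t (fun z' => ub E x (t + 1) z' * V.RLp i₀ x (t + 1) z') z) * x t z .L
    - V.lamL x l t z * (ubb E x t z + E.βb * V.Rp x t z *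
        H.EX t (fun z' => ubb E x (t + 1) z' * V.RLp i₀ x (t + 1) z') z) * x t z .L
    + E.β * V.Rp x t z * H.EX t (fun z' => V.lamL x l (t + 1) z' * ubb E x (t + 1) z'
        * x (t + 1) z' .L) z
    + E.β⁻¹ * H.lag (V.lamL x l) 0 t z * E.βb * ubb E x t z * V.RLp i₀ x t z * Llag i₀ x t z)

/-- Loan wedge at histories with positive deposits. -/
noncomputable def ΨLpos : H.Proc := fun t z =>
  E.ωe⁻¹ * ((E.β - E.βe) * H.EX t (fun z' => E.ωe * ue E x (t + 1) z' * V.RLp i₀ x (t + 1) z') z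
    - H.EX t (fun z' => (E.β * E.ωe * ue E x (t + 1) z' + l t z .col)
        * (V.RLp i₀ x (t + 1) z' - V.Rp x t z)) z
    + (l t z .res - E.β * V.Rp x t z * H.EX t (fun z' => l (t + 1) z' .res) z)
    - V.lamL x l t z * (ub E x t z / (1 - (V.node t z).κ)
        - E.βb * V.Rp x t z * H.EX t (fun z' => ub E x (t + 1) z') z)
    + E.β⁻¹ * ((V.node t z).κ / (1 - (V.node t z).κ)) *
        (H.lag (V.lamL x l) 0 t z * E.βb * ub E x t z + H.lag (fun s y => l s y .col) 0 t z))

/-- Loan wedge at histories without deposits. -/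
noncomputable def ΨLzero : H.Proc := fun t z =>
  E.ωe⁻¹ * ((E.βb - E.βe) * H.EX t (fun z' => E.ωe * ue E x (t + 1) z' * V.RLp i₀ x (t + 1) z') z
    + V.lamL x l t z * (ubb E x t z * x t z .L - ub E x t z + E.βb ^ 2 / E.β *
        H.EX t (fun z' => (ubb E x (t + 1) z' * V.RLp i₀ x (t + 1) z' * x t z .L
          + ub E x (t + 1) z') * V.RLp i₀ x (t + 1) z') z)
    - E.βb * H.EX t (fun z' => V.lamL x l (t + 1) z' * ubb E x (t + 1) z' * x (t + 1) z' .L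
        * V.RLp i₀ x (t + 1) z') z
    - E.β⁻¹ * H.lag (V.lamL x l) 0 t z * E.βb * ubb E x t z * V.RLp i₀ x t z * Llag i₀ x t z
    - (E.β - E.βb) / E.β * l t z .col * H.EX t (fun z' => V.RLp i₀ x (t + 1) z') z)

open Classical in
/-- Loan wedge. -/
noncomputable def ΨL : H.Proc := fun t z =>
  if 0 < x t z .D then V.ΨLpos i₀ x l t z else V.ΨLzero i₀ x l t z

/-- Labor wedge of the sticky-price economy. -/
noncomputable def ΨN : H.Proc := fun t z =>
  (((E.ωe * ue E x t z + l t z .om * ((E.ε - 1) / E.ε) * (V.node t z).P - l t z .bud)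
        * (V.Pwp i₀ x t z * (V.node t z).Δ)⁻¹ - E.ωw * uw E x t z - l t z .bud)
      * V.Pwp i₀ x t z * V.AFN i₀ x t z
    - l t z .bud * E.WN (x t z .Cw) (x t z .N) * x t z .N)
      / (E.ωw * uw E x t z + l t z .bud)
  - E.UwCN (x t z .Cw) (x t z .N) / E.UwCC (x t z .Cw) (x t z .N) *
      ((E.ωw * uw E x t z - E.ωe * ue E x t z
        + l t z .bud * (1 - E.WC (x t z .Cw) (x t z .N) * x t z .N))
      / (E.ωw * uw E x t z + l t z .bud))

/-- Marginal effects of the two capital stocks on the price of capital. -/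
noncomputable def Q1p : H.Proc := fun t z => E.Q1 (V.Klag i₀ x t z) (x t z .K) (V.node t z).ξ
noncomputable def Q2p : H.Proc := fun t z => E.Q2 (V.Klag i₀ x t z) (x t z .K) (V.node t z).ξ

/-- `K_t - (1 - δ) ξ_t K_{t-1}`. -/
noncomputable def newK : H.Proc := fun t z =>
  x t z .K - (1 - E.δ) * (V.node t z).ξ * V.Klag i₀ x t z

/-- `λʸ_t [Q_t Φ(I_t / K_{t-1}) - I_t / K_{t-1}]`. -/
noncomputable def profitTerm : H.Proc := fun t z =>
  l t z .res * (V.Qp i₀ x t z * E.Φ (V.Ip i₀ x t z / V.Klag i₀ x t z) - V.Ip i₀ x t z / V.Klag i₀ x t z)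

/-- The component of the capital wedge due to nominal rigidities and monopoly power. -/
noncomputable def stickyTerm : H.Proc := fun t z =>
  (E.ωe * ue E x t z * (1 - V.Pwp i₀ x t z * (V.node t z).Δ)
    + l t z .om * ((E.ε - 1) / E.ε) * (V.node t z).P - l t z .bud)
    / (V.node t z).Δ * V.AFK i₀ x t z * (V.node t z).ξ

/-- Capital wedge of the sticky-price economy, with `R^K_{t+1} = capPay_{t+1} / Q_t`. -/
noncomputable def ΨK : H.Proc := fun t z =>
  E.ωe⁻¹ * ((E.β - E.βe) * H.EX t (fun z' => E.ωe * ue E x (t + 1) z'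
        * (V.capPay i₀ x (t + 1) z' / V.Qp i₀ x t z)) z * V.Qp i₀ x t z
    + E.β * H.EX t (fun z' => V.profitTerm i₀ x l (t + 1) z') z
    - l t z .bud * V.Q2p i₀ x t z * V.newK i₀ x t z
    - E.β * H.EX t (fun z' => l (t + 1) z' .bud * V.Q1p i₀ x (t + 1) z' * V.newK i₀ x (t + 1) z') z
    + l t z .col * (V.node t z).m * H.EX t (fun z' => V.Q1p i₀ x (t + 1) z'
        * (V.node (t + 1) z').ξ) z * x t z .K
    + E.β⁻¹ * H.lag (fun s y => l s y .col * (V.node s y).m) 0 t z * V.Q2p i₀ x t z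
        * (V.node t z).ξ * V.Klag i₀ x t z
    + E.β * H.EX t (fun z' => V.stickyTerm i₀ x l (t + 1) z') z)

/-- The random variables under the expectations in the financial wedges are integrable. -/
structure FinancialIntegrable : Prop where
  res : ∀ t, H.Int t fun z' => l (t + 1) z' .res
  ubbRL : ∀ t, H.Int t fun z' => ubb E x (t + 1) z' * V.RLp i₀ x (t + 1) z'
  lamL : ∀ t, H.Int t fun z' => V.lamL x l (t + 1) z' * ubb E x (t + 1) z' * x (t + 1) z' .L
  lamLRL : ∀ t, H.Int t fun z' =>
    V.lamL x l (t + 1) z' * ubb E x (t + 1) z' * x (t + 1) z' .L * V.RLp i₀ x (t + 1) z'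
  ue : ∀ t, H.Int t fun z' => Env.ue E x (t + 1) z'
  ueRL : ∀ t, H.Int t fun z' => Env.ue E x (t + 1) z' * V.RLp i₀ x (t + 1) z'
  ubbRLRL : ∀ t, H.Int t fun z' =>
    ubb E x (t + 1) z' * V.RLp i₀ x (t + 1) z' * V.RLp i₀ x (t + 1) z'

/-- The random variables under the expectations in the capital wedge are integrable. -/
structure RealIntegrable : Prop where
  capPay : ∀ t, H.Int t fun z' => Env.ue E x (t + 1) z' * V.capPay i₀ x (t + 1) z'
  profit : ∀ t, H.Int t fun z' => V.profitTerm i₀ x l (t + 1) z'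
  bud : ∀ t, H.Int t fun z' => l (t + 1) z' .bud * V.Q1p i₀ x (t + 1) z' * V.newK i₀ x (t + 1) z'
  col : ∀ t, H.Int t fun z' => V.Q1p i₀ x (t + 1) z' * (V.node (t + 1) z').ξ
  sticky : ∀ t, H.Int t fun z' => V.stickyTerm i₀ x l (t + 1) z'

/-- The denominators in the labor wedge do not vanish. -/
def LaborWedgeDefined : Prop := ∀ t z, V.Pwp i₀ x t z ≠ 0 ∧
  E.UwCC (x t z .Cw) (x t z .N) ≠ 0 ∧ E.ωw * uw E x t z + l t z .bud ≠ 0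

/-! ### The planner's analogs of the market optimality conditions -/

/-- Deposit supply with wedge. -/
def DepositCondition (t : ℕ) (z : H.Z t) : Prop :=
  ub E x t z ≤ E.βb * V.Rp x t z * H.EX t (fun z' => ub E x (t + 1) z') z
      + l t z .lev / E.ωb + V.ΨD i₀ x l t z ∧
  (0 < x t z .D → ub E x t z = E.βb * V.Rp x t z * H.EX t (fun z' => ub E x (t + 1) z') z
      + l t z .lev / E.ωb + V.ΨD i₀ x l t z)

/-- Loan demand with wedge. -/
def LoanCondition (t : ℕ) (z : H.Z t) : Prop :=
  ue E x t z = E.βe * H.EX t (fun z' => ue E x (t + 1) z' * V.RLp i₀ x (t + 1) z') z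
    + l t z .col / E.ωe * H.EX t (fun z' => V.RLp i₀ x (t + 1) z') z + V.ΨL i₀ x l t z

/-- Labor demand with wedge. -/
def LaborCondition (t : ℕ) (z : H.Z t) : Prop :=
  Wp E x t z = V.Pwp i₀ x t z * V.AFN i₀ x t z + V.ΨN i₀ x l t z

/-- Capital demand with wedge. -/
def CapitalCondition (t : ℕ) (z : H.Z t) : Prop :=
  ue E x t z * V.Qp i₀ x t z
    = E.βe * H.EX t (fun z' => ue E x (t + 1) z' * V.capPay i₀ x (t + 1) z') z
    + l t z .col / E.ωe * (V.node t z).m *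
        H.EX t (fun z' => V.Qp i₀ x (t + 1) z' * (V.node (t + 1) z').ξ) z + V.ΨK i₀ x l t z

end Wedges

end Env

/-! ## Competitive and regulated competitive equilibrium -/

/-- Allocations, prices, private Lagrange multipliers and auxiliary variables. -/
structure Market (H : Histories.{u}) where
  (Cb Ce Cw D I K L N Y : H.Proc)
  (Pw Q R RL W : H.Proc)
  (lb le : H.Proc)
  (Om1 Om2 : H.Proc)

/-- Linear taxes and lump-sum rebates. -/
structure Taxes (H : Histories.{u}) where
  (τD τN τL τK Tb Te : H.Proc)

def Taxes.zero (H : Histories.{u}) : Taxes H :=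
  ⟨fun _ _ => 0, fun _ _ => 0, fun _ _ => 0, fun _ _ => 0, fun _ _ => 0, fun _ _ => 0⟩

/-- The part of a market outcome that the planner controls. -/
def Market.plan {H : Histories.{u}} (M : Market H) : Plan H := fun t z a =>
  match a with
  | .Cb => M.Cb t z
  | .Ce => M.Ce t z
  | .Cw => M.Cw t z
  | .D => M.D t z
  | .K => M.K t z
  | .L => M.L t z
  | .N => M.N t z
  | .Om => M.Om1 t z

namespace Env

variable {E : Economy} {H : Histories.{u}} (V : Env E H) (i₀ : Init)

/-- Regulated competitive equilibrium with linear taxes rebated lump sum, given the policies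
`κ`, `m`, `infl` in `V`. -/
structure IsRegulatedCE (M : Market H) (T : Taxes H) : Prop where
  /- measurability and domain -/
  meas : ∀ X ∈ ({M.Cb, M.Ce, M.Cw, M.D, M.I, M.K, M.L, M.N, M.Y, M.Pw, M.Q, M.R, M.RL, M.W, M.lb,
    M.le, M.Om1, M.Om2, T.τD, T.τN, T.τL, T.τK, T.Tb, T.Te} : Set H.Proc), ∀ t, Measurable (X t)
  pos : ∀ X ∈ ({M.Cb, M.Ce, M.Cw, M.I, M.K, M.L, M.N, M.Om1, M.Om2} : Set H.Proc), ∀ t z, 0 < X t z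
  D_nonneg : ∀ t z, 0 ≤ M.D t z
  int_wMU : ∀ t, H.Int t fun z' => E.UwC (M.Cw (t + 1) z') (M.N (t + 1) z')
  int_bMU : ∀ t, H.Int t fun z' => E.UbC (M.Cb (t + 1) z')
  int_bRL : ∀ t, H.Int t fun z' => E.UbC (M.Cb (t + 1) z') * M.RL (t + 1) z'
  int_RL : ∀ t, H.Int t fun z' => M.RL (t + 1) z'
  int_Q : ∀ t, H.Int t fun z' => M.Q (t + 1) z' * (V.node (t + 1) z').ξ
  int_eRL : ∀ t, H.Int t fun z' => E.UeC (M.Ce (t + 1) z') * M.RL (t + 1) z'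
  int_eK : ∀ t, H.Int t fun z' => E.UeC (M.Ce (t + 1) z') *
    (M.Pw (t + 1) z' * (V.node (t + 1) z').A *
      E.FK ((V.node (t + 1) z').ξ * H.lag M.K i₀.K (t + 1) z') (M.N (t + 1) z')
      + M.Q (t + 1) z' * (1 - E.δ)) * (V.node (t + 1) z').ξ
  int_mc : ∀ t, H.Int t fun z' => E.UwC (M.Cw (t + 1) z') (M.N (t + 1) z') *
    (V.node (t + 1) z').infl ^ E.ε * M.Om1 (t + 1) z'
  int_mb : ∀ t, H.Int t fun z' => E.UwC (M.Cw (t + 1) z') (M.N (t + 1) z') *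
    (V.node (t + 1) z').infl ^ (E.ε - 1) * M.Om2 (t + 1) z'
  /- workers -/
  labor_supply : ∀ t z, M.W t z = -E.UwN (M.Cw t z) (M.N t z) / E.UwC (M.Cw t z) (M.N t z)
  worker_euler : ∀ t z, 1 = H.EX t (fun z' => E.β * E.UwC (M.Cw (t + 1) z') (M.N (t + 1) z')
    / E.UwC (M.Cw t z) (M.N t z)) z * M.R t z
  /- bankers -/
  banker_budget : ∀ t z, M.Cb t z + M.L t z = M.RL t z * H.lag M.L i₀.L t z
    - H.lag M.R i₀.R t z * H.lag M.D i₀.D t z + (1 - T.τD t z) * M.D t z + T.Tb t z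
  banker_rebate : ∀ t z, T.Tb t z = T.τD t z * M.D t z
  leverage : ∀ t z, M.D t z ≤ (1 - (V.node t z).κ) * M.L t z
  deposits : ∀ t z, E.UbC (M.Cb t z) * (1 - T.τD t z)
    ≤ E.βb * M.R t z * H.EX t (fun z' => E.UbC (M.Cb (t + 1) z')) z + M.lb t z
  deposits_eq : ∀ t z, 0 < M.D t z → E.UbC (M.Cb t z) * (1 - T.τD t z)
    = E.βb * M.R t z * H.EX t (fun z' => E.UbC (M.Cb (t + 1) z')) z + M.lb t z
  loans : ∀ t z, E.UbC (M.Cb t z)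
    = E.βb * H.EX t (fun z' => E.UbC (M.Cb (t + 1) z') * M.RL (t + 1) z') z
      + M.lb t z * (1 - (V.node t z).κ)
  lb_nonneg : ∀ t z, 0 ≤ M.lb t z
  lb_slack : ∀ t z, M.lb t z * ((1 - (V.node t z).κ) * M.L t z - M.D t z) = 0
  /- entrepreneurs -/
  ent_budget : ∀ t z, M.Ce t z + (1 + T.τK t z) * M.Q t z * M.K t z
      + (1 + T.τN t z) * M.W t z * M.N t z + M.RL t z * H.lag M.L i₀.L t z
    = M.Pw t z * (V.node t z).A * E.F ((V.node t z).ξ * H.lag M.K i₀.K t z) (M.N t z)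
      + M.Q t z * (1 - E.δ) * (V.node t z).ξ * H.lag M.K i₀.K t z
      + (1 - T.τL t z) * M.L t z + T.Te t z
  ent_rebate : ∀ t z, T.Te t z = T.τK t z * M.Q t z * M.K t z + T.τN t z * M.W t z * M.N t z
    + T.τL t z * M.L t z
  collateral : ∀ t z, H.EX t (fun z' => M.RL (t + 1) z') z * M.L t z
    ≤ (V.node t z).m * H.EX t (fun z' => M.Q (t + 1) z' * (V.node (t + 1) z').ξ) z * M.K t z
  labor_demand : ∀ t z, (1 + T.τN t z) * M.W t z = M.Pw t z * (V.node t z).A *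
    E.FN ((V.node t z).ξ * H.lag M.K i₀.K t z) (M.N t z)
  loan_demand : ∀ t z, E.UeC (M.Ce t z) * (1 - T.τL t z)
    = E.βe * H.EX t (fun z' => E.UeC (M.Ce (t + 1) z') * M.RL (t + 1) z') z
      + M.le t z * H.EX t (fun z' => M.RL (t + 1) z') z
  capital_demand : ∀ t z, E.UeC (M.Ce t z) * (1 + T.τK t z) * M.Q t z
    = E.βe * H.EX t (fun z' => E.UeC (M.Ce (t + 1) z') *
        (M.Pw (t + 1) z' * (V.node (t + 1) z').A *
          E.FK ((V.node (t + 1) z').ξ * H.lag M.K i₀.K (t + 1) z') (M.N (t + 1) z')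
          + M.Q (t + 1) z' * (1 - E.δ)) * (V.node (t + 1) z').ξ) z
      + M.le t z * (V.node t z).m * H.EX t (fun z' => M.Q (t + 1) z' * (V.node (t + 1) z').ξ) z
  le_nonneg : ∀ t z, 0 ≤ M.le t z
  le_slack : ∀ t z, M.le t z *
    ((V.node t z).m * H.EX t (fun z' => M.Q (t + 1) z' * (V.node (t + 1) z').ξ) z * M.K t z
      - H.EX t (fun z' => M.RL (t + 1) z') z * M.L t z) = 0
  /- capital good producers and retailers -/
  capital_supply : ∀ t z, M.Q t z = (deriv E.Φ (M.I t z / H.lag M.K i₀.K t z))⁻¹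
  rel_price : ∀ t z, (V.node t z).P = E.ε / (E.ε - 1) * (M.Om1 t z / M.Om2 t z)
  marginal_cost : ∀ t z, M.Om1 t z = M.Pw t z * M.Y t z + E.θ * H.EX t (fun z' =>
    E.β * E.UwC (M.Cw (t + 1) z') (M.N (t + 1) z') / E.UwC (M.Cw t z) (M.N t z)
      * (V.node (t + 1) z').infl ^ E.ε * M.Om1 (t + 1) z') z
  marginal_benefit : ∀ t z, M.Om2 t z = M.Y t z + E.θ * H.EX t (fun z' =>
    E.β * E.UwC (M.Cw (t + 1) z') (M.N (t + 1) z') / E.UwC (M.Cw t z) (M.N t z)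
      * (V.node (t + 1) z').infl ^ (E.ε - 1) * M.Om2 (t + 1) z') z
  /- market clearing -/
  clear_K : ∀ t z, M.K t z = (1 - E.δ) * (V.node t z).ξ * H.lag M.K i₀.K t z
    + E.Φ (M.I t z / H.lag M.K i₀.K t z) * H.lag M.K i₀.K t z
  clear_wholesale : ∀ t z, (V.node t z).A * E.F ((V.node t z).ξ * H.lag M.K i₀.K t z) (M.N t z)
    = (V.node t z).Δ * M.Y t z
  clear_final : ∀ t z, M.Y t z = M.Cb t z + M.Ce t z + M.Cw t z + M.I t z

/-- Competitive equilibrium: no taxes, and the deposit Euler equation holds with equality. -/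
def IsCE (M : Market H) : Prop :=
  V.IsRegulatedCE i₀ M (Taxes.zero H) ∧
  ∀ t z, E.UbC (M.Cb t z)
    = E.βb * M.R t z * H.EX t (fun z' => E.UbC (M.Cb (t + 1) z')) z + M.lb t z

/-- The taxes expressed in terms of a constrained efficient allocation and its multipliers. -/
noncomputable def ceaTaxes (x : Plan H) (l : Mult H) : Taxes H :=
  let τD : H.Proc := fun t z => (ub E x t z)⁻¹ * (l t z .lev / E.ωb
    - (ub E x t z - E.βb * H.EX t (fun z' => ub E x (t + 1) z' * V.RLp i₀ x (t + 1) z') z)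
      / (1 - (V.node t z).κ) + V.ΨD i₀ x l t z)
  let τN : H.Proc := fun t z => -V.ΨN i₀ x l t z / Wp E x t z
  let τL : H.Proc := fun t z => V.ΨL i₀ x l t z / ue E x t z
  let τK : H.Proc := fun t z => -V.ΨK i₀ x l t z / (ue E x t z * V.Qp i₀ x t z)
  { τD := τD, τN := τN, τL := τL, τK := τK
    Tb := fun t z => τD t z * x t z .D
    Te := fun t z => τK t z * V.Qp i₀ x t z * x t z .K + τN t z * Wp E x t z * x t z .N
      + τL t z * x t z .L }

end Env

/-! ## Deterministic steady states of the sticky-price constrained efficient allocation -/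

namespace SteadyEnv

variable {E : Economy} (S : SteadyEnv E)

/-- Constant plans and constant multipliers. -/
def constPlan (x : Ctl → ℝ) : Plan Histories.deterministic := fun _ _ => x
def constMult (m : Cnstr → ℝ) : Mult Histories.deterministic := fun _ _ => m

/-- Initial conditions that the constant plan `x` reproduces (the deposit rate is `1 / β`). -/
noncomputable def steadyInit (E : Economy) (x : Ctl → ℝ) : Init := ⟨x .K, x .D, E.β⁻¹, x .L⟩

/-- The constant plan `x` satisfies the planner's constraints in the absence of uncertainty. -/
def SteadyFeasible (x : Ctl → ℝ) : Prop :=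
  S.env.Feasible (steadyInit E x) .sticky (constPlan x)

/-- Steady state: a constant feasible plan and constant multipliers that satisfy the time-invariant
(date `t ≥ 1`) optimality conditions of the planner. -/
def IsSteadyState (x : Ctl → ℝ) (m : Cnstr → ℝ) : Prop :=
  S.SteadyFeasible x ∧
  ∀ t z, S.env.KKTAt (steadyInit E x) .sticky (constPlan x) (constMult m) (t + 1) z

/-- Every neighborhood of the steady state contains another steady state.  In particular the steady state
is not locally asymptotically stable: nearby constant solutions never converge to it. -/
def LocallyIndeterminate (x : Ctl → ℝ) (m : Cnstr → ℝ) : Prop :=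
  S.IsSteadyState x m ∧ ∀ O ∈ 𝓝 (x, m), ∃ x' m', (x', m') ∈ O ∧ S.IsSteadyState x' m' ∧ x' .D ≠ x .D

/-- Time-invariant first-order condition and constraint values at constants. -/
noncomputable def foc (x : Ctl → ℝ) (m : Cnstr → ℝ) (a : Ctl) : ℝ :=
  S.env.foc (steadyInit E x) .sticky (constPlan x) (constMult m) a 1 ()
noncomputable def con (x : Ctl → ℝ) : Cnstr → ℝ :=
  S.env.conVal (steadyInit E x) .sticky (constPlan x) 1 ()

/-- The domain of constant plans: positive quantities, feasible replacement investment. -/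
def Domain (x : Ctl → ℝ) : Prop :=
  (∀ a ∈ ({.Cb, .Ce, .Cw, .K, .L, .N, .Om} : Set Ctl), 0 < x a) ∧ 0 ≤ x .D ∧
    1 - (1 - E.δ) * S.ξ ∈ E.Φ '' Ioi 0

/-- Steady-state loans implied by the leverage constraint, the banker's Euler equation for loans and
complementary slackness. -/
noncomputable def loans (Cb D : ℝ) : ℝ :=
  max (1 / (1 - S.κ) * D) (E.βb / (1 - E.βb) * (Cb + (1 / E.β - 1) * D))

/-- The steady-state system without any first-order condition for deposits or loans: given `D`, loans are
determined by the borrowing constraints, and either the collateral multiplier vanishes or the collateral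
constraint binds together with the banker's Euler equation for loans. -/
structure ReducedSystem (x : Ctl → ℝ) (m : Cnstr → ℝ) : Prop where
  dom : S.Domain x
  loans_eq : x .L = S.loans (x .Cb) (x .D)
  lev_zero : m .lev = 0
  loan2_zero : m .loan2 = 0
  loan1_nonneg : 0 ≤ m .loan1
  col_eq : m .col = m .loan1 * (E.β - E.βb) * E.UbC (x .Cb)
  collateral : 0 ≤ S.con x .col
  regime : m .loan1 = 0 ∨
    (S.con x .col = 0 ∧ x .L = E.βb / (1 - E.βb) * (x .Cb + (1 / E.β - 1) * x .D))
  focs : ∀ a ∈ ({.Cb, .Ce, .Cw, .K, .N, .Om} : Set Ctl), S.foc x m a = 0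
  bud : S.con x .bud = 0
  res : S.con x .res = 0
  om : S.con x .om = 0

/-- Unknowns of the reduced system other than deposits. -/
inductive Unk
  | Cb | Ce | Cw | K | N | Om | lL | lC | lY | lO
  deriving DecidableEq

instance : Fintype Unk :=
  ⟨{.Cb, .Ce, .Cw, .K, .N, .Om, .lL, .lC, .lY, .lO}, by intro a; cases a <;> decide⟩

noncomputable def unkPlan (E : Economy) (D : ℝ) (y : Unk → ℝ) : Ctl → ℝ
  | .Cb => y .Cb
  | .Ce => y .Ce
  | .Cw => y .Cw
  | .D => D
  | .K => y .K
  | .L => E.βb / (1 - E.βb) * (y .Cb + (1 / E.β - 1) * D)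
  | .N => y .N
  | .Om => y .Om

noncomputable def unkMult (E : Economy) (y : Unk → ℝ) : Cnstr → ℝ
  | .lev => 0
  | .loan1 => y .lL
  | .loan2 => 0
  | .bud => y .lC
  | .col => y .lL * (E.β - E.βb) * E.UbC (y .Cb)
  | .res => y .lY
  | .om => y .lO

/-- Square system in the unknowns `y` with deposits as a parameter; the last equation selects the case of
a binding or of a slack collateral constraint. -/
noncomputable def residual (binding : Bool) (D : ℝ) (y : Unk → ℝ) : Unk → ℝ
  | .Cb => S.foc (unkPlan E D y) (unkMult E y) .Cb
  | .Ce => S.foc (unkPlan E D y) (unkMult E y) .Ce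
  | .Cw => S.foc (unkPlan E D y) (unkMult E y) .Cw
  | .K => S.foc (unkPlan E D y) (unkMult E y) .K
  | .N => S.foc (unkPlan E D y) (unkMult E y) .N
  | .Om => S.foc (unkPlan E D y) (unkMult E y) .Om
  | .lL => match binding with
      | true => S.con (unkPlan E D y) .col
      | false => y .lL
  | .lC => S.con (unkPlan E D y) .bud
  | .lY => S.con (unkPlan E D y) .res
  | .lO => S.con (unkPlan E D y) .om

/-- A nondegenerate steady state with `D = 0`: either the collateral constraint is slack, or it binds with
a positive multiplier; and the Jacobian of the remaining equations with respect to the remaining unknowns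
is invertible. -/
structure IsRegularAtZero (binding : Bool) (y : Unk → ℝ) : Prop where
  dom : S.Domain (unkPlan E 0 y)
  zero : S.residual binding 0 y = 0
  strict : match binding with
    | true => 0 < y .lL
    | false => 0 < S.con (unkPlan E 0 y) .col
  regular : ∃ J : (ℝ × (Unk → ℝ)) →L[ℝ] (Unk → ℝ),
    HasStrictFDerivAt (fun p : ℝ × (Unk → ℝ) => S.residual binding p.1 p.2) J (0, y) ∧
    Function.Bijective fun w : Unk → ℝ => J (0, w)

/-- Optimal steady state: the best constant plan in the absence of uncertainty. -/
def IsOptimalSteady (x : Ctl → ℝ) : Prop :=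
  S.SteadyFeasible x ∧ ∀ y, S.SteadyFeasible y → E.felicity y ≤ E.felicity x

/-- Lagrangian of the problem of finding the best constant plan, loans being eliminated through the
borrowing constraints. -/
noncomputable def steadyLagrangian (lC le lY lO : ℝ) (x : Ctl → ℝ) : ℝ :=
  let x' := Function.update x .L (S.loans (x .Cb) (x .D))
  E.felicity x' + lC * S.con x' .bud + le * S.con x' .col + lY * S.con x' .res + lO * S.con x' .om

/-- Lagrange multipliers of that problem: no control (with deposits nonnegative) can be varied in either
direction so as to raise the Lagrangian to first order.  One-sided derivatives accommodate the kink of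
loans as a function of deposits. -/
structure IsSteadyMultiplier (x : Ctl → ℝ) (lC le lY lO : ℝ) : Prop where
  le_nonneg : 0 ≤ le
  le_slack : le * S.con x .col = 0
  right : ∀ a, a ≠ .L → ∀ d, HasDerivWithinAt
    (fun v => S.steadyLagrangian lC le lY lO (Function.update x a v)) d (Ici (x a)) (x a) → d ≤ 0
  left : ∀ a, a ≠ .L → (a = .D → 0 < x .D) → ∀ d, HasDerivWithinAt
    (fun v => S.steadyLagrangian lC le lY lO (Function.update x a v)) d (Iic (x a)) (x a) → 0 ≤ d

end SteadyEnv

/-! ## Calculus and measurability preliminaries -/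

/-! The constraints of date `t` see the past only through the links `K_{t-1}` and `R_{t-1} D_{t-1}`,
and the future only through seven conditional expectations. Each first-order condition is therefore
a finite sum of partial derivatives, with shadow values attached to links and expectations. Once
these are computed (`foc_Cb`, `foc_Ce`, `foc_D`, `foc_L`, `foc_K`, `foc_Cw`, `foc_N`), the wedges
come from eliminating multipliers.

The condition for `Ce` says `λᶜ + λʸ = ω_e U^e_C`; the one for `Cb` says that the same sum equals
`ω_b U^b_C` plus terms in `λᴸ` and in lagged multipliers. Substituting the latter at `t` and `t + 1`
into the condition for `D` gives `depositCondition`; substituting the former, together with the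
condition for `L`, gives `loanCondition` when deposits are positive. Without deposits, leverage
slackness turns the condition for `L` into a formula for `λᴸ`, and the banker's Euler equation holds
with equality. Capital demand comes from the condition for `K`. For labor, `Cw` and `N` act on the
worker's marginal utility through one common factor `totalMU`, which is solved from one condition
and inserted into the other.

Consolidating budgets and eliminating private multipliers and `Ω₂` shows that every regulated
equilibrium is feasible for the planner (`IsRegulatedCE.feasible`). Hence a constrained efficient
allocation beats all of them, and it is itself one of them, because taxes equal to the wedges turn
the planner's conditions into private ones (`isRegulatedCE_supportingMarket`). Inefficiency needs no
multipliers: at date 0 a small transfer between bankers and entrepreneurs changes only the loan gap.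
When that gap is strictly positive and leverage binds, transfers of both signs are feasible, so an
optimum must equalize weighted marginal utilities. Risk sharing is an induction along the history:
`λᴸ` vanishes as long as nothing is inherited from past multipliers.

In a steady state `β R = 1`. With `λᵇ = λᴸ₂ = 0` and `λᵉ = λᴸ₁ (β - β_b) U^b_C`, the conditions for
`D` and `L` become identities, so deposits are a free parameter (`ReducedSystem.isSteadyState`) and
the implicit function theorem gives a curve of steady states. The optimal steady state is different:
there deposits only cost `R - 1` per unit in the budget and tighten the collateral constraint, so
the left derivative of the Lagrangian in `D` is negative whenever `λᶜ > 0`. -/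

lemma ContDiffOn.hasDerivAt_Ioi {f : ℝ → ℝ} (hf : ContDiffOn ℝ 2 f (Ioi 0)) {c : ℝ} (hc : 0 < c) :
    HasDerivAt f (deriv f c) c :=
  ((hf.contDiffAt (Ioi_mem_nhds hc)).differentiableAt (by norm_num)).hasDerivAt

lemma ContDiffOn.contDiffOn_deriv_Ioi {f : ℝ → ℝ} (hf : ContDiffOn ℝ 2 f (Ioi 0)) :
    ContDiffOn ℝ 1 (deriv f) (Ioi 0) :=
  hf.deriv_of_isOpen isOpen_Ioi (by norm_num)

lemma ContDiffOn.hasDerivAt_deriv_Ioi {f : ℝ → ℝ} (hf : ContDiffOn ℝ 2 f (Ioi 0)) {c : ℝ}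
    (hc : 0 < c) : HasDerivAt (deriv f) (deriv (deriv f) c) c :=
  ((hf.contDiffOn_deriv_Ioi.contDiffAt (Ioi_mem_nhds hc)).differentiableAt (by norm_num)).hasDerivAt

section Partial

variable {f : ℝ → ℝ → ℝ} {s : Set (ℝ × ℝ)} {n m : WithTop ℕ∞}

lemma ContDiffOn.hasDerivAt_fst (hf : ContDiffOn ℝ n (fun p : ℝ × ℝ => f p.1 p.2) s) (hs : IsOpen s)
    (hn : n ≠ 0) {p : ℝ × ℝ} (hp : p ∈ s) :
    HasDerivAt (fun a => f a p.2) (fderiv ℝ (fun p : ℝ × ℝ => f p.1 p.2) p (1, 0)) p.1 := by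
  have h := ((hf.contDiffAt (hs.mem_nhds hp)).differentiableAt hn).hasFDerivAt
  have h2 : HasDerivAt (fun a : ℝ => (a, p.2)) (1, 0) p.1 :=
    (hasDerivAt_id _).prodMk (hasDerivAt_const _ _)
  exact HasFDerivAt.comp_hasDerivAt (f := fun a : ℝ => (a, p.2)) p.1 h h2

lemma ContDiffOn.hasDerivAt_snd (hf : ContDiffOn ℝ n (fun p : ℝ × ℝ => f p.1 p.2) s) (hs : IsOpen s)
    (hn : n ≠ 0) {p : ℝ × ℝ} (hp : p ∈ s) :
    HasDerivAt (fun a => f p.1 a) (fderiv ℝ (fun p : ℝ × ℝ => f p.1 p.2) p (0, 1)) p.2 := by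
  have h := ((hf.contDiffAt (hs.mem_nhds hp)).differentiableAt hn).hasFDerivAt
  have h2 : HasDerivAt (fun a : ℝ => (p.1, a)) (0, 1) p.2 :=
    (hasDerivAt_const _ _).prodMk (hasDerivAt_id _)
  exact HasFDerivAt.comp_hasDerivAt (f := fun a : ℝ => (p.1, a)) p.2 h h2

lemma ContDiffOn.deriv_fst (hf : ContDiffOn ℝ n (fun p : ℝ × ℝ => f p.1 p.2) s) (hs : IsOpen s)
    (hn : m + 1 ≤ n) : ContDiffOn ℝ m (fun p : ℝ × ℝ => deriv (fun a => f a p.2) p.1) s := by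
  have hn0 : n ≠ 0 := fun h => by simp [h] at hn
  refine ((hf.fderiv_of_isOpen hs hn).clm_apply (contDiffOn_const (c := ((1, 0) : ℝ × ℝ)))).congr
    fun p hp => ?_
  exact (hf.hasDerivAt_fst hs hn0 hp).deriv

lemma ContDiffOn.deriv_snd (hf : ContDiffOn ℝ n (fun p : ℝ × ℝ => f p.1 p.2) s) (hs : IsOpen s)
    (hn : m + 1 ≤ n) : ContDiffOn ℝ m (fun p : ℝ × ℝ => deriv (fun a => f p.1 a) p.2) s := by
  have hn0 : n ≠ 0 := fun h => by simp [h] at hn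
  refine ((hf.fderiv_of_isOpen hs hn).clm_apply (contDiffOn_const (c := ((0, 1) : ℝ × ℝ)))).congr
    fun p hp => ?_
  exact (hf.hasDerivAt_snd hs hn0 hp).deriv

end Partial

/-- Wages, marginal utilities and the inverse of `Φ` are well behaved only on the economic domain;
factoring `g` through the subtype `s` makes continuity there sufficient. -/
lemma ContinuousOn.measurable_comp' {X Y W : Type*} [TopologicalSpace X] [MeasurableSpace X]
    [OpensMeasurableSpace X] [TopologicalSpace Y] [MeasurableSpace Y] [BorelSpace Y]
    [MeasurableSpace W] {f : X → Y} {s : Set X} {g : W → X} (hf : ContinuousOn f s)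
    (hg : Measurable g) (hgs : ∀ w, g w ∈ s) : Measurable fun w => f (g w) :=
  (continuousOn_iff_continuous_domRestrict.1 hf).measurable.comp (hg.subtype_mk (h := hgs))

lemma pd_eq {ι : Type} [DecidableEq ι] {f : (ι → ℝ) → ℝ} {v : ι → ℝ} {i : ι} {d : ℝ}
    (h : HasDerivAt (fun a => f (Function.update v i a)) d (v i)) : pd f v i = d := h.deriv

namespace Economy

variable (E : Economy)

lemma β_pos : 0 < E.β := E.β_mem.1
lemma βb_pos : 0 < E.βb := E.βb_mem.1
lemma βb_lt_one : E.βb < 1 := E.βb_mem.2.trans_lt E.β_mem.2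

lemma hasDerivAt_Ub {c : ℝ} (hc : 0 < c) : HasDerivAt E.Ub (E.UbC c) c := E.Ub_smooth.hasDerivAt_Ioi hc
lemma hasDerivAt_UbC {c : ℝ} (hc : 0 < c) : HasDerivAt E.UbC (E.UbCC c) c :=
  E.Ub_smooth.hasDerivAt_deriv_Ioi hc
lemma hasDerivAt_Ue {c : ℝ} (hc : 0 < c) : HasDerivAt E.Ue (E.UeC c) c := E.Ue_smooth.hasDerivAt_Ioi hc
lemma UbC_pos {c : ℝ} (hc : 0 < c) : 0 < E.UbC c := E.Ub_deriv_pos c hc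
lemma UeC_pos {c : ℝ} (hc : 0 < c) : 0 < E.UeC c := E.Ue_deriv_pos c hc
lemma UwC_pos {c n : ℝ} (hc : 0 < c) (hn : 0 < n) : 0 < E.UwC c n := E.Uw_C_pos c n hc hn

/-! ### Workers -/

/-- Positive consumption and labor. -/
abbrev pos2 : Set (ℝ × ℝ) := Ioi 0 ×ˢ Ioi 0

lemma isOpen_pos2 : IsOpen pos2 := isOpen_Ioi.prod isOpen_Ioi

lemma contDiffOn_UwC : ContDiffOn ℝ 1 (fun p : ℝ × ℝ => E.UwC p.1 p.2) pos2 :=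
  E.Uw_smooth.deriv_fst isOpen_pos2 (by norm_num)

lemma contDiffOn_UwN : ContDiffOn ℝ 1 (fun p : ℝ × ℝ => E.UwN p.1 p.2) pos2 :=
  E.Uw_smooth.deriv_snd isOpen_pos2 (by norm_num)

lemma contDiffOn_W : ContDiffOn ℝ 1 (fun p : ℝ × ℝ => E.W p.1 p.2) pos2 :=
  E.contDiffOn_UwN.neg.div E.contDiffOn_UwC fun _ hp => (E.UwC_pos hp.1 hp.2).ne'

lemma continuousOn_UwCC : ContinuousOn (fun p : ℝ × ℝ => E.UwCC p.1 p.2) pos2 :=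
  (E.contDiffOn_UwC.deriv_fst (m := 0) isOpen_pos2 (by norm_num)).continuousOn
lemma continuousOn_UwCN : ContinuousOn (fun p : ℝ × ℝ => E.UwCN p.1 p.2) pos2 :=
  (E.contDiffOn_UwC.deriv_snd (m := 0) isOpen_pos2 (by norm_num)).continuousOn
lemma continuousOn_WC : ContinuousOn (fun p : ℝ × ℝ => E.WC p.1 p.2) pos2 :=
  (E.contDiffOn_W.deriv_fst (m := 0) isOpen_pos2 (by norm_num)).continuousOn
lemma continuousOn_WN : ContinuousOn (fun p : ℝ × ℝ => E.WN p.1 p.2) pos2 :=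
  (E.contDiffOn_W.deriv_snd (m := 0) isOpen_pos2 (by norm_num)).continuousOn

variable {c n : ℝ} (hc : 0 < c) (hn : 0 < n)
include hc hn

lemma hasDerivAt_Uw_fst : HasDerivAt (fun a => E.Uw a n) (E.UwC c n) c :=
  (E.Uw_smooth.hasDerivAt_fst isOpen_pos2 (by norm_num)
    (p := (c, n)) ⟨hc, hn⟩).differentiableAt.hasDerivAt
lemma hasDerivAt_Uw_snd : HasDerivAt (fun a => E.Uw c a) (E.UwN c n) n :=
  (E.Uw_smooth.hasDerivAt_snd isOpen_pos2 (by norm_num)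
    (p := (c, n)) ⟨hc, hn⟩).differentiableAt.hasDerivAt
lemma hasDerivAt_UwC_fst : HasDerivAt (fun a => E.UwC a n) (E.UwCC c n) c :=
  (E.contDiffOn_UwC.hasDerivAt_fst isOpen_pos2 (by norm_num)
    (p := (c, n)) ⟨hc, hn⟩).differentiableAt.hasDerivAt
lemma hasDerivAt_UwC_snd : HasDerivAt (fun a => E.UwC c a) (E.UwCN c n) n :=
  (E.contDiffOn_UwC.hasDerivAt_snd isOpen_pos2 (by norm_num)
    (p := (c, n)) ⟨hc, hn⟩).differentiableAt.hasDerivAt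
lemma hasDerivAt_W_fst : HasDerivAt (fun a => E.W a n) (E.WC c n) c :=
  (E.contDiffOn_W.hasDerivAt_fst isOpen_pos2 (by norm_num)
    (p := (c, n)) ⟨hc, hn⟩).differentiableAt.hasDerivAt
lemma hasDerivAt_W_snd : HasDerivAt (fun a => E.W c a) (E.WN c n) n :=
  (E.contDiffOn_W.hasDerivAt_snd isOpen_pos2 (by norm_num)
    (p := (c, n)) ⟨hc, hn⟩).differentiableAt.hasDerivAt

lemma W_pos : 0 < E.W c n :=
  div_pos (neg_pos.2 (E.Uw_N_neg c n hc hn)) (E.UwC_pos hc hn)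

omit hc hn

/-! ### Technology -/

lemma F_pos {k n : ℝ} (hk : 0 < k) (hn : 0 < n) : 0 < E.F k n := by
  unfold F; positivity

lemma hasDerivAt_F_fst {k : ℝ} (n : ℝ) (hk : 0 < k) :
    HasDerivAt (fun a => E.F a n) (E.FK k n) k := by
  have : DifferentiableAt ℝ (fun a => E.F a n) k :=
    ((Real.hasDerivAt_rpow_const (Or.inl hk.ne')).mul_const _).differentiableAt
  exact this.hasDerivAt

lemma hasDerivAt_F_snd (k : ℝ) {n : ℝ} (hn : 0 < n) :
    HasDerivAt (fun a => E.F k a) (E.FN k n) n := by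
  have : DifferentiableAt ℝ (fun a => E.F k a) n :=
    ((Real.hasDerivAt_rpow_const (Or.inl hn.ne')).const_mul _).differentiableAt
  exact this.hasDerivAt

lemma FK_eq {k : ℝ} (n : ℝ) (hk : 0 < k) : E.FK k n = E.α * k ^ (E.α - 1) * n ^ (1 - E.α) :=
  ((Real.hasDerivAt_rpow_const (Or.inl hk.ne')).mul_const _).deriv

lemma FN_eq (k : ℝ) {n : ℝ} (hn : 0 < n) :
    E.FN k n = k ^ E.α * ((1 - E.α) * n ^ (1 - E.α - 1)) :=
  ((Real.hasDerivAt_rpow_const (Or.inl hn.ne')).const_mul _).deriv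

/-! ### Capital goods -/

lemma Φ_strictMonoOn : StrictMonoOn E.Φ (Ioi 0) :=
  strictMonoOn_of_deriv_pos (convex_Ioi 0) E.Φ_smooth.continuousOn fun x hx =>
    E.Φ_deriv_pos x (by simpa using hx)

lemma Φinv_pos {y : ℝ} (hy : y ∈ E.Φ '' Ioi 0) : 0 < E.Φinv y := Function.invFunOn_mem hy

lemma Φ_Φinv {y : ℝ} (hy : y ∈ E.Φ '' Ioi 0) : E.Φ (E.Φinv y) = y := Function.invFunOn_eq hy

lemma Φinv_Φ {v : ℝ} (hv : 0 < v) : E.Φinv (E.Φ v) = v :=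
  E.Φ_strictMonoOn.injOn.leftInvOn_invFunOn hv

/-- A `C^1` function with nonzero derivative is a local homeomorphism. This yields both the openness
of the range of `Φ` and the continuity of its inverse. -/
lemma map_Φ_nhds {v : ℝ} (hv : 0 < v) : map E.Φ (𝓝 v) = 𝓝 (E.Φ v) :=
  ((E.Φ_smooth.contDiffAt (Ioi_mem_nhds hv)).hasStrictDerivAt (by norm_num)).map_nhds_eq
    (E.Φ_deriv_pos v hv).ne'

lemma Φ_image_mem_nhds {y : ℝ} (hy : y ∈ E.Φ '' Ioi 0) : E.Φ '' Ioi 0 ∈ 𝓝 y := by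
  obtain ⟨v, hv, rfl⟩ := hy
  rw [← E.map_Φ_nhds hv]
  exact image_mem_map (Ioi_mem_nhds hv)

lemma continuousAt_Φinv {y : ℝ} (hy : y ∈ E.Φ '' Ioi 0) : ContinuousAt E.Φinv y := by
  obtain ⟨v, hv, rfl⟩ := hy
  rw [ContinuousAt, E.Φinv_Φ hv, ← E.map_Φ_nhds hv, tendsto_map'_iff]
  refine tendsto_id.congr' ?_
  filter_upwards [Ioi_mem_nhds hv] with w hw
  exact (E.Φinv_Φ hw).symm

lemma hasDerivAt_Φinv {y : ℝ} (hy : y ∈ E.Φ '' Ioi 0) :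
    HasDerivAt E.Φinv (deriv E.Φ (E.Φinv y))⁻¹ y :=
  HasDerivAt.of_local_left_inverse (E.continuousAt_Φinv hy)
    (E.Φ_smooth.hasDerivAt_Ioi (E.Φinv_pos hy)) (E.Φ_deriv_pos _ (E.Φinv_pos hy)).ne'
    (by filter_upwards [E.Φ_image_mem_nhds hy] with w hw using E.Φ_Φinv hw)

/-- The price of capital as a function of the output of new capital per unit of old capital. -/
noncomputable def capPrice (y : ℝ) : ℝ := (deriv E.Φ (E.Φinv y))⁻¹

/-- Derivative of `capPrice`. -/
noncomputable def capPrice' (y : ℝ) : ℝ :=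
  -(deriv (deriv E.Φ) (E.Φinv y) * (deriv E.Φ (E.Φinv y))⁻¹) / deriv E.Φ (E.Φinv y) ^ 2

lemma capPrice_pos {y : ℝ} (hy : y ∈ E.Φ '' Ioi 0) : 0 < E.capPrice y :=
  inv_pos.2 (E.Φ_deriv_pos _ (E.Φinv_pos hy))

lemma hasDerivAt_capPrice {y : ℝ} (hy : y ∈ E.Φ '' Ioi 0) :
    HasDerivAt E.capPrice (E.capPrice' y) y :=
  HasDerivAt.fun_inv ((E.Φ_smooth.hasDerivAt_deriv_Ioi (E.Φinv_pos hy)).comp y (E.hasDerivAt_Φinv hy))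
    (E.Φ_deriv_pos _ (E.Φinv_pos hy)).ne'

lemma Inv_div {k : ℝ} (k' ξ : ℝ) (hk : 0 < k) :
    E.Inv k k' ξ / k = E.Φinv (k' / k - (1 - E.δ) * ξ) :=
  mul_div_cancel_left₀ _ hk.ne'

lemma Q_eq {k : ℝ} (k' ξ : ℝ) (hk : 0 < k) : E.Q k k' ξ = E.capPrice (k' / k - (1 - E.δ) * ξ) := by
  rw [Q, Inv_div _ _ _ hk, capPrice]

section

variable {k k' ξ : ℝ} (hk : 0 < k) (hy : k' / k - (1 - E.δ) * ξ ∈ E.Φ '' Ioi 0)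
include hk hy

lemma Q_pos : 0 < E.Q k k' ξ := by
  rw [Q_eq _ _ _ hk]; exact E.capPrice_pos hy

lemma Inv_pos : 0 < E.Inv k k' ξ := mul_pos hk (E.Φinv_pos hy)

lemma Φ_Inv_div : E.Φ (E.Inv k k' ξ / k) = k' / k - (1 - E.δ) * ξ := by
  rw [Inv_div _ _ _ hk, E.Φ_Φinv hy]

omit hy in
lemma hasDerivAt_netGrowth_fst :
    HasDerivAt (fun a => k' / a - (1 - E.δ) * ξ) (-k' / k ^ 2) k := by
  have := ((hasDerivAt_const k k').div (hasDerivAt_id k) hk.ne').sub_const ((1 - E.δ) * ξ)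
  simpa using this

omit hk hy in
lemma hasDerivAt_netGrowth_snd :
    HasDerivAt (fun a => a / k - (1 - E.δ) * ξ) (1 / k) k' :=
  ((hasDerivAt_id k').div_const k).sub_const _

lemma hasDerivAt_Q_fst' :
    HasDerivAt (fun a => E.Q a k' ξ) (E.capPrice' (k' / k - (1 - E.δ) * ξ) * (-k' / k ^ 2)) k := by
  have h := (E.hasDerivAt_capPrice hy).comp k (E.hasDerivAt_netGrowth_fst hk)
  refine h.congr_of_eventuallyEq ?_
  filter_upwards [Ioi_mem_nhds hk] with a ha using E.Q_eq _ _ ha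

lemma hasDerivAt_Q_snd' :
    HasDerivAt (fun a => E.Q k a ξ) (E.capPrice' (k' / k - (1 - E.δ) * ξ) * (1 / k)) k' := by
  have h := (E.hasDerivAt_capPrice hy).comp k' E.hasDerivAt_netGrowth_snd
  exact h.congr_of_eventuallyEq (Eventually.of_forall fun a => E.Q_eq _ _ hk)

lemma Q1_eq : E.Q1 k k' ξ = E.capPrice' (k' / k - (1 - E.δ) * ξ) * (-k' / k ^ 2) :=
  (E.hasDerivAt_Q_fst' hk hy).deriv

lemma Q2_eq : E.Q2 k k' ξ = E.capPrice' (k' / k - (1 - E.δ) * ξ) * (1 / k) :=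
  (E.hasDerivAt_Q_snd' hk hy).deriv

lemma hasDerivAt_Q_fst : HasDerivAt (fun a => E.Q a k' ξ) (E.Q1 k k' ξ) k :=
  (E.hasDerivAt_Q_fst' hk hy).differentiableAt.hasDerivAt

lemma hasDerivAt_Q_snd : HasDerivAt (fun a => E.Q k a ξ) (E.Q2 k k' ξ) k' :=
  (E.hasDerivAt_Q_snd' hk hy).differentiableAt.hasDerivAt

lemma hasDerivAt_Inv_snd : HasDerivAt (fun a => E.Inv k a ξ) (E.Q k k' ξ) k' := by
  have h := ((E.hasDerivAt_Φinv hy).comp k' E.hasDerivAt_netGrowth_snd).const_mul k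
  refine h.congr_deriv ?_
  rw [E.Q_eq _ _ hk, capPrice]
  field_simp

/-- The product rule for `k * Φinv (k' / k - (1 - δ) ξ)` gives `I / k - Q k' / k`. Writing `k' / k =
Φ (I / k) + (1 - δ) ξ` separates the profit of capital producers from the resale value of old
capital, the two pieces that reappear in the capital wedge. -/
lemma hasDerivAt_Inv_fst : HasDerivAt (fun a => E.Inv a k' ξ)
    (E.Inv k k' ξ / k - E.Q k k' ξ * E.Φ (E.Inv k k' ξ / k) - E.Q k k' ξ * ((1 - E.δ) * ξ)) k := by
  have h := (hasDerivAt_id k).mul ((E.hasDerivAt_Φinv hy).comp k (E.hasDerivAt_netGrowth_fst hk))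
  refine h.congr_deriv ?_
  rw [E.Φ_Inv_div hk hy, E.Q_eq _ _ hk, E.Inv_div _ _ hk, capPrice]
  simp only [Function.comp, id]
  field_simp
  ring

end

end Economy

/-! ## Conditional expectations -/

namespace Histories

variable {H : Histories.{u}} {t : ℕ} {z : H.Z t} {f g : H.Z (t + 1) → ℝ}

/-- By `ker_prev` the kernel charges only successors of `z`, so under `𝔼_t` every date-`t` variable
may be treated as a constant. -/
lemma EX_congr (h : ∀ z', H.prev t z' = z → f z' = g z') : H.EX t f z = H.EX t g z :=
  integral_congr_ae (by filter_upwards [H.ker_prev t z] with z' hz using h z' hz)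

lemma integrable_congr (hf : Integrable f (H.ker t z)) (h : ∀ z', H.prev t z' = z → f z' = g z') :
    Integrable g (H.ker t z) :=
  hf.congr (by filter_upwards [H.ker_prev t z] with z' hz using h z' hz)

lemma EX_const (c : ℝ) : H.EX t (fun _ => c) z = c := by simp [EX]

lemma EX_mul_left (c : ℝ) : H.EX t (fun z' => c * f z') z = c * H.EX t f z := integral_const_mul _ _

lemma EX_mul_right (c : ℝ) : H.EX t (fun z' => f z' * c) z = H.EX t f z * c := integral_mul_const _ _

lemma EX_neg : H.EX t (fun z' => -f z') z = -H.EX t f z := integral_neg _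

lemma EX_add (hf : Integrable f (H.ker t z)) (hg : Integrable g (H.ker t z)) :
    H.EX t (fun z' => f z' + g z') z = H.EX t f z + H.EX t g z := integral_add hf hg

lemma EX_sub (hf : Integrable f (H.ker t z)) (hg : Integrable g (H.ker t z)) :
    H.EX t (fun z' => f z' - g z') z = H.EX t f z - H.EX t g z := integral_sub hf hg

lemma EX_pos (hf : Integrable f (H.ker t z)) (h : ∀ z', 0 < f z') : 0 < H.EX t f z := by
  rw [EX, integral_pos_iff_support_of_nonneg (fun z' => (h z').le) hf]
  have : Function.support f = univ := eq_univ_of_forall fun z' => (h z').ne'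
  simp [this]

end Histories

/-! ## Derivatives of the constraints -/

lemma Cnstr.sum_eq (f : Cnstr → ℝ) :
    ∑ i, f i = f .lev + f .loan1 + f .loan2 + f .bud + f .col + f .res + f .om := by
  have : (Finset.univ : Finset Cnstr) = {.lev, .loan1, .loan2, .bud, .col, .res, .om} := rfl
  rw [this]; simp [Finset.sum_insert]; ring

lemma Slot.sum_eq (f : Slot → ℝ) :
    ∑ i, f i = f .wMU + f .bPay + f .bMU + f .price + f .pay + f .mc + f .mb := by
  have : (Finset.univ : Finset Slot) = {.wMU, .bPay, .bMU, .price, .pay, .mc, .mb} := rfl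
  rw [this]; simp [Finset.sum_insert]; ring

lemma Link.sum_eq (f : Link → ℝ) : ∑ i, f i = f .K + f .RD := by
  have : (Finset.univ : Finset Link) = {.K, .RD} := rfl
  rw [this]; simp [Finset.sum_insert]

/-- Most constraints are affine in most controls. Their derivatives can then be read off an
algebraic identity, without calculus. -/
lemma hasDerivAt_of_affine {f : ℝ → ℝ} {a₀ c : ℝ} (h : ∀ a, f a = f a₀ + c * (a - a₀)) :
    HasDerivAt f c a₀ := by
  have h1 : HasDerivAt (fun a => f a₀ + c * (a - a₀)) (c * 1) a₀ :=
    (((hasDerivAt_id a₀).sub_const a₀).const_mul c).const_add (f a₀)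
  rw [mul_one] at h1
  exact h1.congr_of_eventuallyEq (Eventually.of_forall h)

lemma pd_const {ι : Type} [DecidableEq ι] {f : (ι → ℝ) → ℝ} {v : ι → ℝ} {i : ι}
    (h : ∀ a, f (Function.update v i a) = f v) : pd f v i = 0 :=
  pd_eq (hasDerivAt_of_affine fun a => by simp [h])

namespace Economy

variable (E : Economy) (r : Regime) (ν ν' : Node)

lemma hasDerivAt_conSum {s : ℝ → Link → ℝ} {x : ℝ → Ctl → ℝ} {e : ℝ → Slot → ℝ} {a₀ : ℝ}
    (d : Cnstr → ℝ) (m : Cnstr → ℝ)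
    (h : ∀ i, HasDerivAt (fun a => E.con r ν (s a) (x a) (e a) i) (d i) a₀) :
    HasDerivAt (fun a => E.conSum r ν (s a) (x a) (e a) m) (∑ i, m i * d i) a₀ :=
  HasDerivAt.fun_sum fun i _ => (h i).const_mul (m i)

variable (s : Link → ℝ) (x x' : Ctl → ℝ) (e : Slot → ℝ) (m : Cnstr → ℝ)

/-- The total multiplier `λᴸ` of the banker's Euler condition for loans. -/
noncomputable def loanMult : ℝ := m .loan1 + m .loan2 * ((1 - ν.κ) * x .L - x .D)

lemma pd_conSum_D : pd (fun x => E.conSum r ν s x e m) x .D =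
    -m .lev - loanMult ν x m * E.βb * E.R x e * e .bMU - m .loan2 * E.loanGap x e
      + m .bud - m .col * E.R x e := by
  have hl : HasDerivAt (fun a => E.con r ν s (Function.update x .D a) e .lev) (-1) (x .D) :=
    hasDerivAt_of_affine fun a => by simp [con]
  have hG : HasDerivAt (fun a => E.con r ν s (Function.update x .D a) e .loan1)
      (-E.βb * E.R x e * e .bMU) (x .D) :=
    hasDerivAt_of_affine fun a => by simp [con, loanGap, R]; ring
  -- The table lists the derivative of each constraint. The `loan2` entry is the product rule for
  -- loan gap times leverage slack; together with the `loan1` entry it makes the multipliers combine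
  -- into `loanMult`.
  refine pd_eq ((E.hasDerivAt_conSum r ν (fun
    | .lev => -1
    | .loan1 => -E.βb * E.R x e * e .bMU
    | .loan2 => -E.βb * E.R x e * e .bMU * ((1 - ν.κ) * x .L - x .D) + E.loanGap x e * (-1)
    | .bud => 1
    | .col => -E.R x e
    | .res => 0
    | .om => 0) m ?_).congr_deriv ?_)
  · rintro (_ | _ | _ | _ | _ | _ | _)
    · exact hl
    · exact hG
    · simpa [con] using hG.fun_mul hl
    all_goals refine hasDerivAt_of_affine fun a => ?_
    all_goals cases r <;> simp [con, revenue, output, R] <;> ring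
  · simp only [Cnstr.sum_eq, loanMult]; ring

lemma pd_conSum_L : pd (fun x => E.conSum r ν s x e m) x .L =
    (1 - ν.κ) * (m .lev + m .loan2 * E.loanGap x e) + loanMult ν x m * E.UbC (x .Cb) := by
  have hl : HasDerivAt (fun a => E.con r ν s (Function.update x .L a) e .lev) (1 - ν.κ) (x .L) :=
    hasDerivAt_of_affine fun a => by simp [con]; ring
  have hG : HasDerivAt (fun a => E.con r ν s (Function.update x .L a) e .loan1)
      (E.UbC (x .Cb)) (x .L) :=
    hasDerivAt_of_affine fun a => by simp [con, loanGap, R]; ring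
  refine pd_eq ((E.hasDerivAt_conSum r ν (fun
    | .lev => 1 - ν.κ
    | .loan1 => E.UbC (x .Cb)
    | .loan2 => E.UbC (x .Cb) * ((1 - ν.κ) * x .L - x .D) + E.loanGap x e * (1 - ν.κ)
    | .bud => 0
    | .col => 0
    | .res => 0
    | .om => 0) m ?_).congr_deriv ?_)
  · rintro (_ | _ | _ | _ | _ | _ | _)
    · exact hl
    · exact hG
    · simpa [con] using hG.fun_mul hl
    all_goals refine hasDerivAt_of_affine fun a => ?_
    all_goals cases r <;> simp [con, revenue, output, R]
  · simp only [Cnstr.sum_eq, loanMult]; ring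

variable {x} in
lemma pd_conSum_Cb (hb : 0 < x .Cb) : pd (fun x => E.conSum r ν s x e m) x .Cb =
    loanMult ν x m * E.UbCC (x .Cb) * x .L - m .bud - m .res := by
  have hl : HasDerivAt (fun a => E.con r ν s (Function.update x .Cb a) e .lev) 0 (x .Cb) :=
    hasDerivAt_of_affine fun a => by simp [con]
  have hG : HasDerivAt (fun a => E.con r ν s (Function.update x .Cb a) e .loan1)
      (E.UbCC (x .Cb) * x .L) (x .Cb) := by
    simpa [con, loanGap, R] using ((E.hasDerivAt_UbC hb).mul_const (x .L)).sub_const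
      (E.βb * (e .bPay + E.R x e * x .D * e .bMU))
  refine pd_eq ((E.hasDerivAt_conSum r ν (fun
    | .lev => 0
    | .loan1 => E.UbCC (x .Cb) * x .L
    | .loan2 => E.UbCC (x .Cb) * x .L * ((1 - ν.κ) * x .L - x .D) + E.loanGap x e * 0
    | .bud => -1
    | .col => 0
    | .res => -1
    | .om => 0) m ?_).congr_deriv ?_)
  · rintro (_ | _ | _ | _ | _ | _ | _)
    · exact hl
    · exact hG
    · simpa [con] using hG.fun_mul hl
    all_goals refine hasDerivAt_of_affine fun a => ?_
    all_goals cases r <;> simp [con, revenue, output, R] <;> ring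
  · simp only [Cnstr.sum_eq, loanMult]; ring

lemma pd_conSum_Ce : pd (fun x => E.conSum r ν s x e m) x .Ce = -m .bud - m .res := by
  refine pd_eq ((E.hasDerivAt_conSum r ν (fun
    | .lev => 0
    | .loan1 => 0
    | .loan2 => 0
    | .bud => -1
    | .col => 0
    | .res => -1
    | .om => 0) m ?_).congr_deriv ?_)
  · rintro (_ | _ | _ | _ | _ | _ | _)
    all_goals refine hasDerivAt_of_affine fun a => ?_
    all_goals cases r <;> simp [con, revenue, output, R, loanGap] <;> ring
  · simp only [Cnstr.sum_eq]; ring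

section

variable {s x} (hs : 0 < s .K) (hy : x .K / s .K - (1 - E.δ) * ν.ξ ∈ E.Φ '' Ioi 0)
include hs hy

lemma pd_conSum_K : pd (fun x => E.conSum r ν s x e m) x .K =
    -m .bud * (E.Q2 (s .K) (x .K) ν.ξ * (x .K - (1 - E.δ) * ν.ξ * s .K) + E.Q (s .K) (x .K) ν.ξ)
      + m .col * (ν.m * e .price) - m .res * E.Q (s .K) (x .K) ν.ξ := by
  refine pd_eq ((E.hasDerivAt_conSum r ν (fun
    | .lev => 0
    | .loan1 => 0
    | .loan2 => 0
    | .bud => -(E.Q2 (s .K) (x .K) ν.ξ * (x .K - (1 - E.δ) * ν.ξ * s .K)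
        + E.Q (s .K) (x .K) ν.ξ * 1)
    | .col => ν.m * e .price
    | .res => -E.Q (s .K) (x .K) ν.ξ
    | .om => 0) m ?_).congr_deriv ?_)
  · rintro (_ | _ | _ | _ | _ | _ | _)
    iterate 3
      refine hasDerivAt_of_affine fun a => ?_
      simp [con, R, loanGap]
    · have h := ((E.hasDerivAt_Q_snd hs hy).fun_mul
        ((hasDerivAt_id (x .K)).sub_const ((1 - E.δ) * ν.ξ * s .K))).const_sub (E.revenue r ν s x e)
      have h2 := (((h.sub_const (E.W (x .Cw) (x .N) * x .N)).add_const (x .D)).sub_const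
        (s .RD)).sub_const (x .Cb) |>.sub_const (x .Ce)
      refine h2.congr_of_eventuallyEq (Eventually.of_forall fun a => ?_)
      cases r <;> simp [con, revenue]
    · refine hasDerivAt_of_affine fun a => ?_
      simp [con, R]; ring
    · have h := (E.hasDerivAt_Inv_snd hs hy).const_sub
        (E.output r ν s x - (x .Cb + x .Ce + x .Cw))
      refine h.congr_of_eventuallyEq (Eventually.of_forall fun a => ?_)
      cases r <;> simp [con, output]
    · refine hasDerivAt_of_affine fun a => ?_
      cases r <;> simp [con]
  · simp only [Cnstr.sum_eq]; ring

/-- The terms are grouped as the capital wedge needs them: effect on the price of capital, resale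
value, profit of capital producers, marginal product. -/
lemma pd_conSum_linkK (hξ : 0 < ν.ξ) :
    pd (fun s => E.conSum .sticky ν s x e m) s .K =
    -m .bud * (E.Q1 (s .K) (x .K) ν.ξ * (x .K - (1 - E.δ) * ν.ξ * s .K))
      + (m .bud + m .res) * (E.Q (s .K) (x .K) ν.ξ * ((1 - E.δ) * ν.ξ))
      + m .res * (E.Q (s .K) (x .K) ν.ξ * E.Φ (E.Inv (s .K) (x .K) ν.ξ / s .K)
        - E.Inv (s .K) (x .K) ν.ξ / s .K)
      + (m .res + m .om * ((E.ε - 1) / E.ε) * ν.P) / ν.Δ * (ν.A * E.FK (ν.ξ * s .K) (x .N)) * ν.ξ := by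
  have hF : HasDerivAt (fun a => E.F (ν.ξ * a) (x .N)) (E.FK (ν.ξ * s .K) (x .N) * (ν.ξ * 1)) (s .K) :=
    HasDerivAt.comp (h := fun a => ν.ξ * a) (h₂ := fun k => E.F k (x .N)) (s .K)
      (E.hasDerivAt_F_fst (x .N) (mul_pos hξ hs)) ((hasDerivAt_id (s .K)).const_mul ν.ξ)
  refine pd_eq ((E.hasDerivAt_conSum .sticky ν (fun
    | .lev => 0
    | .loan1 => 0
    | .loan2 => 0
    | .bud => -(E.Q1 (s .K) (x .K) ν.ξ * (x .K - (1 - E.δ) * ν.ξ * s .K)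
        + E.Q (s .K) (x .K) ν.ξ * (-((1 - E.δ) * ν.ξ * 1)))
    | .col => 0
    | .res => ν.A / ν.Δ * (E.FK (ν.ξ * s .K) (x .N) * (ν.ξ * 1)) -
        (E.Inv (s .K) (x .K) ν.ξ / s .K
          - E.Q (s .K) (x .K) ν.ξ * E.Φ (E.Inv (s .K) (x .K) ν.ξ / s .K)
          - E.Q (s .K) (x .K) ν.ξ * ((1 - E.δ) * ν.ξ))
    | .om => (E.ε - 1) / E.ε * ν.P * (ν.A / ν.Δ) * (E.FK (ν.ξ * s .K) (x .N) * (ν.ξ * 1))) m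
      ?_).congr_deriv ?_)
  · rintro (_ | _ | _ | _ | _ | _ | _)
    iterate 3
      refine hasDerivAt_of_affine fun a => ?_
      simp [con, R, loanGap]
    · have h := ((E.hasDerivAt_Q_fst hs hy).fun_mul
        (((hasDerivAt_id (s .K)).const_mul ((1 - E.δ) * ν.ξ)).const_sub (x .K))).const_sub
          (E.revenue .sticky ν s x e)
      have h2 := (((h.sub_const (E.W (x .Cw) (x .N) * x .N)).add_const (x .D)).sub_const
        (s .RD)).sub_const (x .Cb) |>.sub_const (x .Ce)
      refine h2.congr_of_eventuallyEq (Eventually.of_forall fun a => ?_)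
      simp [con, revenue]
    · refine hasDerivAt_of_affine fun a => ?_
      simp [con, R]
    · have h := ((hF.const_mul (ν.A / ν.Δ)).sub_const (x .Cb + x .Ce + x .Cw)).fun_sub
        (E.hasDerivAt_Inv_fst hs hy)
      refine h.congr_of_eventuallyEq (Eventually.of_forall fun a => ?_)
      simp [con, output]
    · have h := ((hF.const_mul ((E.ε - 1) / E.ε * ν.P * (ν.A / ν.Δ))).sub_const (x .Om)).add_const
        (E.β * E.θ * (ν.P * e .mb) / E.UwC (x .Cw) (x .N))
      refine h.congr_of_eventuallyEq (Eventually.of_forall fun a => ?_)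
      simp [con]
  · simp only [Cnstr.sum_eq]; ring

end

lemma pd_conSum_linkRD : pd (fun s => E.conSum r ν s x e m) s .RD = -m .bud := by
  refine pd_eq ((E.hasDerivAt_conSum r ν (fun
    | .lev => 0
    | .loan1 => 0
    | .loan2 => 0
    | .bud => -1
    | .col => 0
    | .res => 0
    | .om => 0) m ?_).congr_deriv ?_)
  · rintro (_ | _ | _ | _ | _ | _ | _)
    all_goals refine hasDerivAt_of_affine fun a => ?_
    all_goals cases r <;> simp [con, revenue, output, R, loanGap] <;> ring
  · simp only [Cnstr.sum_eq]; ring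

lemma pd_conSum_bPay : pd (fun e => E.conSum r ν s x e m) e .bPay = -E.βb * loanMult ν x m := by
  refine pd_eq ((E.hasDerivAt_conSum r ν (fun
    | .lev => 0
    | .loan1 => -E.βb
    | .loan2 => -E.βb * ((1 - ν.κ) * x .L - x .D)
    | .bud => 0
    | .col => 0
    | .res => 0
    | .om => 0) m ?_).congr_deriv ?_)
  · rintro (_ | _ | _ | _ | _ | _ | _)
    all_goals refine hasDerivAt_of_affine fun a => ?_
    all_goals cases r <;> simp [con, revenue, output, R, loanGap] <;> ring
  · simp only [Cnstr.sum_eq, loanMult]; ring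

lemma pd_conSum_bMU : pd (fun e => E.conSum r ν s x e m) e .bMU =
    -E.βb * loanMult ν x m * (E.R x e * x .D) := by
  refine pd_eq ((E.hasDerivAt_conSum r ν (fun
    | .lev => 0
    | .loan1 => -E.βb * (E.R x e * x .D)
    | .loan2 => -E.βb * (E.R x e * x .D) * ((1 - ν.κ) * x .L - x .D)
    | .bud => 0
    | .col => 0
    | .res => 0
    | .om => 0) m ?_).congr_deriv ?_)
  · rintro (_ | _ | _ | _ | _ | _ | _)
    all_goals refine hasDerivAt_of_affine fun a => ?_
    all_goals cases r <;> simp [con, revenue, output, R, loanGap] <;> ring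
  · simp only [Cnstr.sum_eq, loanMult]; ring

lemma pd_conSum_pay : pd (fun e => E.conSum r ν s x e m) e .pay = -m .col := by
  refine pd_eq ((E.hasDerivAt_conSum r ν (fun
    | .lev => 0
    | .loan1 => 0
    | .loan2 => 0
    | .bud => 0
    | .col => -1
    | .res => 0
    | .om => 0) m ?_).congr_deriv ?_)
  · rintro (_ | _ | _ | _ | _ | _ | _)
    all_goals refine hasDerivAt_of_affine fun a => ?_
    all_goals cases r <;> simp [con, revenue, output, R, loanGap] <;> ring
  · simp only [Cnstr.sum_eq]; ring

lemma pd_conSum_price : pd (fun e => E.conSum r ν s x e m) e .price = m .col * (ν.m * x .K) := by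
  refine pd_eq ((E.hasDerivAt_conSum r ν (fun
    | .lev => 0
    | .loan1 => 0
    | .loan2 => 0
    | .bud => 0
    | .col => ν.m * x .K
    | .res => 0
    | .om => 0) m ?_).congr_deriv ?_)
  · rintro (_ | _ | _ | _ | _ | _ | _)
    all_goals refine hasDerivAt_of_affine fun a => ?_
    all_goals cases r <;> simp [con, revenue, output, R, loanGap] <;> ring
  · simp only [Cnstr.sum_eq]; ring

end Economy

/-! ### Derivatives through the worker's marginal utility, and of felicity, links and expectations
-/

namespace Economy

variable (E : Economy) (r : Regime) (ν ν' : Node)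
variable (s : Link → ℝ) (x x' : Ctl → ℝ) (e : Slot → ℝ) (m : Cnstr → ℝ)

/-- Effect of the worker's marginal utility on the date-`t` constraints of the sticky-price economy. -/
noncomputable def conMU : Cnstr → ℝ
  | .lev => 0
  | .loan1 => -E.βb * (x .D * e .bMU / (E.β * e .wMU))
  | .loan2 => -E.βb * (x .D * e .bMU / (E.β * e .wMU)) * ((1 - ν.κ) * x .L - x .D)
  | .bud => ν.Δ * (E.β * E.θ * e .mc / E.UwC (x .Cw) (x .N) ^ 2)
  | .col => -(x .D / (E.β * e .wMU))
  | .res => 0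
  | .om => -(E.β * E.θ * (ν.P * e .mb) / E.UwC (x .Cw) (x .N) ^ 2)

section

variable {x} (hc : 0 < x .Cw) (hn : 0 < x .N)
include hc hn

/-- `Cw` acts through `U^w_C` (in the deposit rate and in the retailers' discount factor), through
the wage and through the demand for final goods. The first channel is factored as `UwCC` times a sum
that does not depend on the control, so that the same sum appears with `UwCN` for `N`; this is what
lets the labor wedge eliminate it. -/
lemma pd_conSum_Cw : pd (fun x => E.conSum .sticky ν s x e m) x .Cw =
    E.UwCC (x .Cw) (x .N) * (∑ i, m i * E.conMU ν x e i)
      - m .bud * (E.WC (x .Cw) (x .N) * x .N) - m .res := by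
  have hu := E.hasDerivAt_UwC_fst hc hn
  have hu0 := (E.UwC_pos hc hn).ne'
  set q := E.UwCC (x .Cw) (x .N)
  have hinv := hu.fun_inv hu0
  refine pd_eq ((E.hasDerivAt_conSum .sticky ν (fun
    | .lev => 0
    | .loan1 => q * E.conMU ν x e .loan1
    | .loan2 => q * E.conMU ν x e .loan2
    | .bud => q * E.conMU ν x e .bud - E.WC (x .Cw) (x .N) * x .N
    | .col => q * E.conMU ν x e .col
    | .res => -1
    | .om => q * E.conMU ν x e .om) m ?_).congr_deriv ?_)
  · rintro (_ | _ | _ | _ | _ | _ | _)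
    · refine hasDerivAt_of_affine fun a => ?_
      simp [con]
    · refine ((hu.mul_const (-E.βb * (x .D * e .bMU / (E.β * e .wMU)))).const_add
        (E.UbC (x .Cb) * x .L - E.βb * e .bPay)).congr_of_eventuallyEq (Eventually.of_forall fun a => ?_)
      simp [con, loanGap, R, Rate]; ring
    · refine ((hu.mul_const (-E.βb * (x .D * e .bMU / (E.β * e .wMU))
          * ((1 - ν.κ) * x .L - x .D))).const_add
        ((E.UbC (x .Cb) * x .L - E.βb * e .bPay) * ((1 - ν.κ) * x .L - x .D))).congr_of_eventuallyEq
        (Eventually.of_forall fun a => ?_)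
      simp [con, loanGap, R, Rate]; ring
    · have h := (((hinv.const_mul (-ν.Δ * (E.β * E.θ * e .mc))).const_add (ν.Δ * x .Om
        - E.Q (s .K) (x .K) ν.ξ * (x .K - (1 - E.δ) * ν.ξ * s .K))).fun_sub
          ((E.hasDerivAt_W_fst hc hn).mul_const (x .N))).add_const (x .D - s .RD - x .Cb - x .Ce)
      refine (h.congr_of_eventuallyEq (Eventually.of_forall fun a => ?_)).congr_deriv ?_
      · simp [con, revenue]; ring
      · simp [conMU]; ring
    · refine ((hu.mul_const (-(x .D / (E.β * e .wMU)))).const_add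
        (ν.m * e .price * x .K - e .pay)).congr_of_eventuallyEq (Eventually.of_forall fun a => ?_)
      simp [con, R, Rate]; ring
    · refine hasDerivAt_of_affine fun a => ?_
      simp [con, output]; ring
    · have h := (hinv.const_mul (E.β * E.θ * (ν.P * e .mb))).const_add ((E.ε - 1) / E.ε * ν.P
        * (ν.A / ν.Δ) * E.F (ν.ξ * s .K) (x .N) - x .Om)
      refine (h.congr_of_eventuallyEq (Eventually.of_forall fun a => ?_)).congr_deriv ?_
      · simp [con, div_eq_mul_inv]
      · simp [conMU]; ring
  · simp only [Cnstr.sum_eq, conMU]; ring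

lemma pd_conSum_N : pd (fun x => E.conSum .sticky ν s x e m) x .N =
    E.UwCN (x .Cw) (x .N) * (∑ i, m i * E.conMU ν x e i)
      - m .bud * (E.WN (x .Cw) (x .N) * x .N + E.W (x .Cw) (x .N))
      + (m .res + m .om * ((E.ε - 1) / E.ε) * ν.P) / ν.Δ * (ν.A * E.FN (ν.ξ * s .K) (x .N)) := by
  have hu := E.hasDerivAt_UwC_snd hc hn
  have hu0 := (E.UwC_pos hc hn).ne'
  have hF := E.hasDerivAt_F_snd (ν.ξ * s .K) hn
  set q := E.UwCN (x .Cw) (x .N)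
  have hinv := hu.fun_inv hu0
  refine pd_eq ((E.hasDerivAt_conSum .sticky ν (fun
    | .lev => 0
    | .loan1 => q * E.conMU ν x e .loan1
    | .loan2 => q * E.conMU ν x e .loan2
    | .bud => q * E.conMU ν x e .bud - (E.WN (x .Cw) (x .N) * x .N + E.W (x .Cw) (x .N) * 1)
    | .col => q * E.conMU ν x e .col
    | .res => ν.A / ν.Δ * E.FN (ν.ξ * s .K) (x .N)
    | .om => (E.ε - 1) / E.ε * ν.P * (ν.A / ν.Δ) * E.FN (ν.ξ * s .K) (x .N)
        + q * E.conMU ν x e .om) m ?_).congr_deriv ?_)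
  · rintro (_ | _ | _ | _ | _ | _ | _)
    · refine hasDerivAt_of_affine fun a => ?_
      simp [con]
    · refine ((hu.mul_const (-E.βb * (x .D * e .bMU / (E.β * e .wMU)))).const_add
        (E.UbC (x .Cb) * x .L - E.βb * e .bPay)).congr_of_eventuallyEq (Eventually.of_forall fun a => ?_)
      simp [con, loanGap, R, Rate]; ring
    · refine ((hu.mul_const (-E.βb * (x .D * e .bMU / (E.β * e .wMU))
          * ((1 - ν.κ) * x .L - x .D))).const_add
        ((E.UbC (x .Cb) * x .L - E.βb * e .bPay) * ((1 - ν.κ) * x .L - x .D))).congr_of_eventuallyEq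
        (Eventually.of_forall fun a => ?_)
      simp [con, loanGap, R, Rate]; ring
    · have h := (((hinv.const_mul (-ν.Δ * (E.β * E.θ * e .mc))).const_add (ν.Δ * x .Om
        - E.Q (s .K) (x .K) ν.ξ * (x .K - (1 - E.δ) * ν.ξ * s .K))).fun_sub
          ((E.hasDerivAt_W_snd hc hn).fun_mul (hasDerivAt_id' (x .N)))).add_const
            (x .D - s .RD - x .Cb - x .Ce)
      refine (h.congr_of_eventuallyEq (Eventually.of_forall fun a => ?_)).congr_deriv ?_
      · simp [con, revenue]; ring
      · simp [conMU]; ring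
    · refine ((hu.mul_const (-(x .D / (E.β * e .wMU)))).const_add
        (ν.m * e .price * x .K - e .pay)).congr_of_eventuallyEq (Eventually.of_forall fun a => ?_)
      simp [con, R, Rate]; ring
    · have h := ((hF.const_mul (ν.A / ν.Δ)).sub_const (x .Cb + x .Ce + x .Cw)).sub_const
        (E.Inv (s .K) (x .K) ν.ξ)
      refine h.congr_of_eventuallyEq (Eventually.of_forall fun a => ?_)
      simp [con, output]
    · have h := ((hF.const_mul ((E.ε - 1) / E.ε * ν.P * (ν.A / ν.Δ))).sub_const (x .Om)).fun_add
        (hinv.const_mul (E.β * E.θ * (ν.P * e .mb)))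
      refine (h.congr_of_eventuallyEq (Eventually.of_forall fun a => ?_)).congr_deriv ?_
      · simp [con, div_eq_mul_inv]
      · simp [conMU]; ring
  · simp only [Cnstr.sum_eq, conMU]; ring

lemma pd_felicity_Cw : pd E.felicity x .Cw = E.ωw * E.UwC (x .Cw) (x .N) := by
  refine pd_eq ((((E.hasDerivAt_Uw_fst hc hn).const_mul E.ωw).const_add
    (E.ωb * E.Ub (x .Cb) + E.ωe * E.Ue (x .Ce))).congr_of_eventuallyEq
    (Eventually.of_forall fun a => ?_))
  simp [felicity]

lemma pd_felicity_N : pd E.felicity x .N = E.ωw * E.UwN (x .Cw) (x .N) := by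
  refine pd_eq ((((E.hasDerivAt_Uw_snd hc hn).const_mul E.ωw).const_add
    (E.ωb * E.Ub (x .Cb) + E.ωe * E.Ue (x .Ce))).congr_of_eventuallyEq
    (Eventually.of_forall fun a => ?_))
  simp [felicity]

lemma pd_linkRD_Cw : pd (fun x => E.link x e .RD) x .Cw =
    E.UwCC (x .Cw) (x .N) * (x .D / (E.β * e .wMU)) := by
  refine pd_eq (((E.hasDerivAt_UwC_fst hc hn).mul_const _).congr_of_eventuallyEq
    (Eventually.of_forall fun a => ?_))
  simp [link, R, Rate]; ring

lemma pd_linkRD_N : pd (fun x => E.link x e .RD) x .N =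
    E.UwCN (x .Cw) (x .N) * (x .D / (E.β * e .wMU)) := by
  refine pd_eq (((E.hasDerivAt_UwC_snd hc hn).mul_const _).congr_of_eventuallyEq
    (Eventually.of_forall fun a => ?_))
  simp [link, R, Rate]; ring

end

lemma pd_felicity_Cb {x} (h : 0 < x .Cb) : pd E.felicity x .Cb = E.ωb * E.UbC (x .Cb) := by
  refine pd_eq ((((E.hasDerivAt_Ub h).const_mul E.ωb).add_const
    (E.ωe * E.Ue (x .Ce) + E.ωw * E.Uw (x .Cw) (x .N))).congr_of_eventuallyEq
    (Eventually.of_forall fun a => ?_))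
  simp [felicity, add_assoc]

lemma pd_felicity_Ce {x} (h : 0 < x .Ce) : pd E.felicity x .Ce = E.ωe * E.UeC (x .Ce) := by
  refine pd_eq (((((E.hasDerivAt_Ue h).const_mul E.ωe).const_add
    (E.ωb * E.Ub (x .Cb))).add_const (E.ωw * E.Uw (x .Cw) (x .N))).congr_of_eventuallyEq
    (Eventually.of_forall fun a => ?_))
  simp [felicity]

lemma pd_felicity_D : pd E.felicity x .D = 0 := pd_const fun a => by simp [felicity]
lemma pd_felicity_L : pd E.felicity x .L = 0 := pd_const fun a => by simp [felicity]
lemma pd_felicity_K : pd E.felicity x .K = 0 := pd_const fun a => by simp [felicity]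

lemma pd_linkRD_D : pd (fun x => E.link x e .RD) x .D = E.R x e :=
  pd_eq (hasDerivAt_of_affine fun a => by simp [link, R]; ring)

lemma pd_linkRD_of_ne {a : Ctl} (h : a = .Cb ∨ a = .Ce ∨ a = .K ∨ a = .L ∨ a = .Om) :
    pd (fun x => E.link x e .RD) x a = 0 :=
  pd_const fun b => by rcases h with rfl | rfl | rfl | rfl | rfl <;> simp [link, R]

lemma pd_linkK_of_ne {a : Ctl} (h : a ≠ .K) : pd (fun x => E.link x e .K) x a = 0 :=
  pd_const fun b => by simp [link, Function.update_of_ne h.symm]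

lemma pd_linkK_K : pd (fun x => E.link x e .K) x .K = 1 :=
  pd_eq (hasDerivAt_of_affine fun a => by simp [link])

lemma pd_link_slot_K (j : Slot) : pd (fun e => E.link x e .K) e j = 0 :=
  pd_const fun b => by simp [link]

lemma pd_link_slot_RD {j : Slot} (h : j ≠ .wMU) : pd (fun e => E.link x e .RD) e j = 0 :=
  pd_const fun b => by simp [link, R, Function.update_of_ne h.symm]

/-- Among today's controls only `K` enters a variable under expectation, through the price `Q(K_t,
K_{t+1}, ξ_{t+1})`. -/
lemma pd_slotFn_today_of_ne {a : Ctl} (h : a ≠ .K) (j : Slot) :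
    pd (fun x => E.slotFn ν' x x' j) x a = 0 :=
  pd_const fun b => by cases j <;> simp [slotFn, Function.update_of_ne h.symm]

lemma pd_slotFn_today_K_of_ne {j : Slot} (h : j ≠ .price) :
    pd (fun x => E.slotFn ν' x x' j) x .K = 0 :=
  pd_const fun b => by cases j <;> first | exact absurd rfl h | simp [slotFn]

section

variable {x x'} (hk : 0 < x .K) (hy : x' .K / x .K - (1 - E.δ) * ν'.ξ ∈ E.Φ '' Ioi 0)
include hk hy

lemma pd_slotFn_today_K :
    pd (fun x => E.slotFn ν' x x' .price) x .K = E.Q1 (x .K) (x' .K) ν'.ξ * ν'.ξ := by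
  refine pd_eq (((E.hasDerivAt_Q_fst hk hy).mul_const ν'.ξ).congr_of_eventuallyEq
    (Eventually.of_forall fun a => ?_))
  simp [slotFn]

lemma pd_slotFn_K (j : Slot) : pd (fun x' => E.slotFn ν' x x' j) x' .K =
    if j = .price then E.Q2 (x .K) (x' .K) ν'.ξ * ν'.ξ else 0 := by
  cases j
  case price =>
    refine pd_eq (((E.hasDerivAt_Q_snd hk hy).mul_const ν'.ξ).congr_of_eventuallyEq
      (Eventually.of_forall fun a => ?_))
    simp [slotFn]
  all_goals exact pd_const fun b => by simp [slotFn]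

end

lemma pd_slotFn_D (j : Slot) : pd (fun x' => E.slotFn ν' x x' j) x' .D =
    match j with
    | .bPay => -E.UbC (x' .Cb)
    | .pay => -1
    | _ => 0 := by
  cases j <;> exact pd_eq (hasDerivAt_of_affine fun b => by simp [slotFn] <;> ring)

lemma pd_slotFn_L (j : Slot) : pd (fun x' => E.slotFn ν' x x' j) x' .L =
    match j with
    | .bPay => E.UbC (x' .Cb)
    | .pay => 1
    | _ => 0 := by
  cases j <;> exact pd_eq (hasDerivAt_of_affine fun b => by simp [slotFn] <;> ring)

lemma pd_slotFn_Ce (j : Slot) : pd (fun x' => E.slotFn ν' x x' j) x' .Ce = 0 := by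
  cases j <;> exact pd_const fun b => by simp [slotFn]

lemma pd_slotFn_Cb {x'} (h : 0 < x' .Cb) (j : Slot) : pd (fun x' => E.slotFn ν' x x' j) x' .Cb =
    match j with
    | .bPay => E.UbCC (x' .Cb) * (x' .Cb + x' .L - x' .D) + E.UbC (x' .Cb)
    | .bMU => E.UbCC (x' .Cb)
    | .pay => 1
    | _ => 0 := by
  have hu := E.hasDerivAt_UbC h
  cases j
  case bPay =>
    refine pd_eq (((hu.fun_mul (((hasDerivAt_id' (x' .Cb)).add_const (x' .L)).sub_const (x' .D))
      ).congr_of_eventuallyEq (Eventually.of_forall fun a => ?_)).congr_deriv (by ring))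
    simp [slotFn]
  case bMU =>
    refine pd_eq (hu.congr_of_eventuallyEq (Eventually.of_forall fun a => ?_))
    simp [slotFn]
  all_goals exact pd_eq (hasDerivAt_of_affine fun b => by simp [slotFn] <;> ring)

/-- Effect of tomorrow's marginal utility of the worker on the variables under expectations. -/
noncomputable def slotMU : Slot → ℝ
  | .wMU => 1
  | .mc => ν'.infl ^ E.ε * x' .Om
  | .mb => ν'.infl ^ (E.ε - 1) / ν'.P * x' .Om
  | _ => 0

lemma pd_slotFn_Cw {x'} (hc : 0 < x' .Cw) (hn : 0 < x' .N) (j : Slot) :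
    pd (fun x' => E.slotFn ν' x x' j) x' .Cw = E.UwCC (x' .Cw) (x' .N) * E.slotMU ν' x' j := by
  have hu := (E.hasDerivAt_UwC_fst hc hn).mul_const (E.slotMU ν' x' j)
  refine pd_eq ?_
  cases j
  case wMU | mc | mb =>
    refine hu.congr_of_eventuallyEq (Eventually.of_forall fun a => ?_)
    simp [slotFn, slotMU]; try ring
  all_goals exact hasDerivAt_of_affine fun b => by simp [slotFn, slotMU]

lemma pd_slotFn_N {x'} (hc : 0 < x' .Cw) (hn : 0 < x' .N) (j : Slot) :
    pd (fun x' => E.slotFn ν' x x' j) x' .N = E.UwCN (x' .Cw) (x' .N) * E.slotMU ν' x' j := by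
  have hu := (E.hasDerivAt_UwC_snd hc hn).mul_const (E.slotMU ν' x' j)
  refine pd_eq ?_
  cases j
  case wMU | mc | mb =>
    refine hu.congr_of_eventuallyEq (Eventually.of_forall fun a => ?_)
    simp [slotFn, slotMU]; try ring
  all_goals exact hasDerivAt_of_affine fun b => by simp [slotFn, slotMU]

end Economy

/-! ### Linear calculus of conditional expectations, with integrability carried along -/

namespace Histories

variable {H : Histories.{u}} {t : ℕ} {z : H.Z t} {f g : H.Z (t + 1) → ℝ} {v w : ℝ}

/-- `f` is integrable given the history `z`, with conditional expectation `v`. -/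
structure HasEX (H : Histories.{u}) (t : ℕ) (z : H.Z t) (f : H.Z (t + 1) → ℝ) (v : ℝ) : Prop where
  int : Integrable f (H.ker t z)
  eq : H.EX t f z = v

lemma hasEX (hf : Integrable f (H.ker t z)) : H.HasEX t z f (H.EX t f z) := ⟨hf, rfl⟩

lemma HasEX.add (hf : H.HasEX t z f v) (hg : H.HasEX t z g w) :
    H.HasEX t z (fun z' => f z' + g z') (v + w) :=
  ⟨hf.int.add hg.int, by rw [EX_add hf.int hg.int, hf.eq, hg.eq]⟩

lemma HasEX.sub (hf : H.HasEX t z f v) (hg : H.HasEX t z g w) :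
    H.HasEX t z (fun z' => f z' - g z') (v - w) :=
  ⟨hf.int.sub hg.int, by rw [EX_sub hf.int hg.int, hf.eq, hg.eq]⟩

lemma HasEX.const_mul (c : ℝ) (hf : H.HasEX t z f v) : H.HasEX t z (fun z' => c * f z') (c * v) :=
  ⟨hf.int.const_mul c, by rw [EX_mul_left, hf.eq]⟩

lemma HasEX.const (c : ℝ) : H.HasEX t z (fun _ => c) c := ⟨integrable_const c, EX_const c⟩

lemma HasEX.congr (hf : H.HasEX t z f v) (h : ∀ z', H.prev t z' = z → g z' = f z') :
    H.HasEX t z g v :=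
  ⟨integrable_congr hf.int fun z' hz => (h z' hz).symm, by rw [EX_congr h, hf.eq]⟩

lemma HasEX.congr_val (hf : H.HasEX t z f v) (h : v = w) : H.HasEX t z f w := h ▸ hf

end Histories

/-! ## First-order conditions of the planner -/

namespace Env

open Economy Histories

variable {E : Economy} {H : Histories.{u}} (V : Env E H) (i₀ : Init) {r : Regime} {x : Plan H}
  (l : Mult H) {t : ℕ} {z : H.Z t}

lemma linkIn_K_pos (hK : 0 < i₀.K) (hf : ∀ t z, 0 < x t z .K) : ∀ t (z : H.Z t),
    0 < V.linkIn i₀ x t z .K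
  | 0, _ => hK
  | t + 1, z => hf t (H.prev t z)

lemma Llag_pos (hL : 0 < i₀.L) (hf : ∀ t z, 0 < x t z .L) : ∀ t (z : H.Z t), 0 < Llag i₀ x t z
  | 0, _ => hL
  | t + 1, z => hf t (H.prev t z)

lemma linkShadow_RD :
    V.linkShadow r x l t z .RD = -H.EX t (fun z' => l (t + 1) z' .bud) z := by
  simp only [linkShadow, pd_conSum_linkRD, EX_neg]

/-- Only the expected marginal utility of the worker, through the deposit rate, changes what is
handed over to the next date; the other expectations matter for the date-`t` constraints alone. -/
lemma slotShadow_of_ne {j : Slot} (h : j ≠ .wMU) : V.slotShadow i₀ r x l t z j =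
    pd (fun e => E.conSum r (V.node t z) (V.linkIn i₀ x t z) (x t z) e (l t z)) (V.exps x t z) j := by
  simp [slotShadow, Link.sum_eq, pd_link_slot_K, pd_link_slot_RD _ _ _ h]

lemma slotShadow_bPay : V.slotShadow i₀ r x l t z .bPay = -E.βb * V.lamL x l t z := by
  rw [slotShadow_of_ne _ _ _ (by decide), pd_conSum_bPay]; rfl

lemma slotShadow_bMU : V.slotShadow i₀ r x l t z .bMU =
    -E.βb * V.lamL x l t z * (V.Rp x t z * x t z .D) := by
  rw [slotShadow_of_ne _ _ _ (by decide), pd_conSum_bMU]; rfl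

lemma slotShadow_pay : V.slotShadow i₀ r x l t z .pay = -l t z .col := by
  rw [slotShadow_of_ne _ _ _ (by decide), pd_conSum_pay]

lemma slotShadow_price : V.slotShadow i₀ r x l t z .price =
    l t z .col * ((V.node t z).m * x t z .K) := by
  rw [slotShadow_of_ne _ _ _ (by decide), pd_conSum_price]

/-- A control other than `K` neither moves the capital link nor enters tomorrow's price of capital,
so two of the channels of the Lagrangian disappear. -/
lemma foc_of_ne_K {a : Ctl} (h : a ≠ .K) : V.foc i₀ r x l a t z = pd E.felicity (x t z) a
    + pd (fun x₀ => E.conSum r (V.node t z) (V.linkIn i₀ x t z) x₀ (V.exps x t z) (l t z)) (x t z) a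
    - E.β * H.EX t (fun z' => l (t + 1) z' .bud) z
      * pd (fun x₀ => E.link x₀ (V.exps x t z) .RD) (x t z) a
    + V.pastEffect i₀ r x l a t z := by
  simp [foc, Link.sum_eq, pd_linkK_of_ne _ _ _ h, pd_slotFn_today_of_ne _ _ _ _ h, linkShadow_RD,
    EX_const]
  ring

/-- Effect of the banker's net repayments through the expectations formed at `t - 1`. -/
noncomputable def pastPay : H.Proc := fun t z =>
  E.β⁻¹ * (H.lag (V.lamL x l) 0 t z * E.βb * ub E x t z + H.lag (fun s y => l s y .col) 0 t z)

/-- `D` and `L` enter the expectations formed at `t - 1` only through the net repayment `L - D`,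
hence with opposite effects. At date 0 the default value 0 of the lags plays the role of the
indicator `1_ℕ(t)`. -/
lemma pastEffect_D : V.pastEffect i₀ r x l .D t z = V.pastPay (x := x) l t z := by
  cases t with
  | zero => simp [pastEffect, pastPay, lag]
  | succ t =>
    simp only [pastEffect, pastPay, lag, Slot.sum_eq, pd_slotFn_D, slotShadow_bPay, slotShadow_pay, ub]
    ring

lemma pastEffect_L : V.pastEffect i₀ r x l .L t z = -V.pastPay (x := x) l t z := by
  cases t with
  | zero => simp [pastEffect, pastPay, lag]
  | succ t =>
    simp only [pastEffect, pastPay, lag, Slot.sum_eq, pd_slotFn_L, slotShadow_bPay, slotShadow_pay, ub]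
    ring

lemma pastEffect_Ce : V.pastEffect i₀ r x l .Ce t z = 0 := by
  cases t with
  | zero => rfl
  | succ t => simp [pastEffect, pd_slotFn_Ce]

lemma RLp_mul_Llag (hL : Llag i₀ x t z ≠ 0) : V.RLp i₀ x t z * Llag i₀ x t z =
    x t z .Cb + x t z .L - x t z .D + V.linkIn i₀ x t z .RD := by
  rw [RLp, div_mul_cancel₀ _ hL]

/-- The derivatives of `bPay` and `bMU` contribute `UbCC` times `Cb + L - D` and times the deposit
service; their sum is `R^L_t L_{t-1}`. The remaining terms are those of a change in repayment. -/
lemma pastEffect_Cb (hb : 0 < x t z .Cb) (hL : 0 < Llag i₀ x t z) :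
    V.pastEffect i₀ r x l .Cb t z =
    -(E.β⁻¹ * H.lag (V.lamL x l) 0 t z * E.βb * ubb E x t z * V.RLp i₀ x t z * Llag i₀ x t z)
      - V.pastPay (x := x) l t z := by
  rw [mul_assoc _ (V.RLp i₀ x t z), V.RLp_mul_Llag i₀ hL.ne']
  cases t with
  | zero => simp [pastEffect, pastPay, lag]
  | succ t =>
    simp only [pastEffect, pastPay, lag, Slot.sum_eq, pd_slotFn_Cb _ _ _ hb, slotShadow_bPay,
      slotShadow_bMU, slotShadow_pay, ub, ubb]
    have : V.linkIn i₀ x (t + 1) z .RD = V.Rp x t (H.prev t z) * x t (H.prev t z) .D := rfl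
    rw [this]
    ring

lemma foc_D : V.foc i₀ r x l .D t z =
    -l t z .lev - V.lamL x l t z * E.βb * V.Rp x t z * H.EX t (fun z' => ub E x (t + 1) z') z
      - l t z .loan2 * V.conVal i₀ r x t z .loan1 + l t z .bud - l t z .col * V.Rp x t z
      - E.β * V.Rp x t z * H.EX t (fun z' => l (t + 1) z' .bud) z + V.pastPay (x := x) l t z := by
  rw [foc_of_ne_K _ _ _ (by decide), pd_felicity_D, pd_conSum_D, pd_linkRD_D, pastEffect_D]
  change 0 + (-l t z .lev - V.lamL x l t z * E.βb * V.Rp x t z * H.EX t (fun z' => ub E x (t + 1) z') z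
      - l t z .loan2 * V.conVal i₀ r x t z .loan1 + l t z .bud - l t z .col * V.Rp x t z)
      - E.β * H.EX t (fun z' => l (t + 1) z' .bud) z * V.Rp x t z + _ = _
  ring

lemma foc_L : V.foc i₀ r x l .L t z =
    (1 - (V.node t z).κ) * (l t z .lev + l t z .loan2 * V.conVal i₀ r x t z .loan1)
      + V.lamL x l t z * ub E x t z - V.pastPay (x := x) l t z := by
  rw [foc_of_ne_K _ _ _ (by decide), pd_felicity_L, pd_conSum_L, pd_linkRD_of_ne _ _ _ (by decide),
    pastEffect_L]
  change 0 + ((1 - (V.node t z).κ) * (l t z .lev + l t z .loan2 * V.conVal i₀ r x t z .loan1)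
      + V.lamL x l t z * ub E x t z) - _ * 0 + _ = _
  ring

lemma foc_Ce (he : 0 < x t z .Ce) : V.foc i₀ r x l .Ce t z =
    E.ωe * ue E x t z - l t z .bud - l t z .res := by
  rw [foc_of_ne_K _ _ _ (by decide), pd_felicity_Ce _ he, pd_conSum_Ce,
    pd_linkRD_of_ne _ _ _ (by decide), pastEffect_Ce, ue]
  ring

lemma foc_Cb (hb : 0 < x t z .Cb) (hL : 0 < Llag i₀ x t z) : V.foc i₀ r x l .Cb t z =
    E.ωb * ub E x t z + V.lamL x l t z * ubb E x t z * x t z .L - l t z .bud - l t z .res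
    - E.β⁻¹ * H.lag (V.lamL x l) 0 t z * E.βb * ubb E x t z * V.RLp i₀ x t z * Llag i₀ x t z
    - V.pastPay (x := x) l t z := by
  rw [foc_of_ne_K _ _ _ (by decide), pd_felicity_Cb _ hb, pd_conSum_Cb _ _ _ _ _ _ hb,
    pd_linkRD_of_ne _ _ _ (by decide), pastEffect_Cb _ _ _ hb hL]
  change E.ωb * ub E x t z + (V.lamL x l t z * ubb E x t z * x t z .L - l t z .bud - l t z .res)
    - _ * 0 + _ = _
  ring

/-- Effect of the worker's marginal utility through the expectations formed at `t - 1`. -/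
noncomputable def pastMU : H.Proc
  | 0, _ => 0
  | t + 1, z => E.β⁻¹ * ∑ j, V.slotShadow i₀ .sticky x l t (H.prev t z) j *
      E.slotMU (V.node (t + 1) z) (x (t + 1) z) j

/-- Total effect of the worker's marginal utility. -/
noncomputable def totalMU : H.Proc := fun t z =>
  ∑ i, l t z i * E.conMU (V.node t z) (x t z) (V.exps x t z) i
  - E.β * H.EX t (fun z' => l (t + 1) z' .bud) z * (x t z .D / (E.β * V.exps x t z .wMU))
  + V.pastMU i₀ (x := x) l t z

section

variable (hc : 0 < x t z .Cw) (hn : 0 < x t z .N)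
include hc hn

lemma pastEffect_Cw : V.pastEffect i₀ .sticky x l .Cw t z =
    E.UwCC (x t z .Cw) (x t z .N) * V.pastMU i₀ (x := x) l t z := by
  cases t with
  | zero => simp [pastEffect, pastMU]
  | succ t =>
    simp only [pastEffect, pastMU, pd_slotFn_Cw _ _ _ hc hn, Slot.sum_eq]
    ring

lemma pastEffect_N : V.pastEffect i₀ .sticky x l .N t z =
    E.UwCN (x t z .Cw) (x t z .N) * V.pastMU i₀ (x := x) l t z := by
  cases t with
  | zero => simp [pastEffect, pastMU]
  | succ t =>
    simp only [pastEffect, pastMU, pd_slotFn_N _ _ _ hc hn, Slot.sum_eq]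
    ring

lemma foc_Cw : V.foc i₀ .sticky x l .Cw t z = E.ωw * uw E x t z
    + E.UwCC (x t z .Cw) (x t z .N) * V.totalMU i₀ (x := x) l t z
    - l t z .bud * (E.WC (x t z .Cw) (x t z .N) * x t z .N) - l t z .res := by
  rw [foc_of_ne_K _ _ _ (by decide), pd_felicity_Cw _ hc hn, pd_conSum_Cw _ _ _ _ _ hc hn,
    pd_linkRD_Cw _ _ hc hn, pastEffect_Cw _ _ _ hc hn, totalMU, uw]
  ring

lemma foc_N : V.foc i₀ .sticky x l .N t z = E.ωw * E.UwN (x t z .Cw) (x t z .N)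
    + E.UwCN (x t z .Cw) (x t z .N) * V.totalMU i₀ (x := x) l t z
    - l t z .bud * (E.WN (x t z .Cw) (x t z .N) * x t z .N + Wp E x t z)
    + (l t z .res + l t z .om * ((E.ε - 1) / E.ε) * (V.node t z).P) / (V.node t z).Δ
      * V.AFN i₀ x t z := by
  rw [foc_of_ne_K _ _ _ (by decide), pd_felicity_N _ hc hn, pd_conSum_N _ _ _ _ _ hc hn,
    pd_linkRD_N _ _ hc hn, pastEffect_N _ _ _ hc hn, totalMU, Wp, AFN, Klag]
  ring

end

section

variable {V i₀} (hK : 0 < i₀.K) (hf : V.Feasible i₀ r x)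
include hK hf

lemma Feasible.Klag_pos (t : ℕ) (z : H.Z t) : 0 < V.Klag i₀ x t z :=
  V.linkIn_K_pos i₀ hK (fun t z => hf.pos t z _ (by simp)) t z

lemma Feasible.Qp_pos (t : ℕ) (z : H.Z t) : 0 < V.Qp i₀ x t z :=
  E.Q_pos (hf.Klag_pos hK t z) (hf.inv t z)

lemma Feasible.AFp_pos (t : ℕ) (z : H.Z t) : 0 < V.AFp i₀ x t z :=
  mul_pos (V.A_pos t z) (E.F_pos (mul_pos (V.ξ_pos t z) (hf.Klag_pos hK t z))
    (hf.pos t z .N (by simp)))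

lemma pastEffect_K {r' : Regime} : V.pastEffect i₀ r' x l .K t z =
    E.β⁻¹ * H.lag (fun s y => l s y .col * (V.node s y).m) 0 t z * V.Q2p i₀ x t z
        * (V.node t z).ξ * V.Klag i₀ x t z := by
  cases t with
  | zero => simp [pastEffect, lag]
  | succ t =>
    have h1 := hf.Klag_pos hK (t + 1) z
    have h2 := hf.inv (t + 1) z
    simp only [pastEffect, lag, Slot.sum_eq, slotShadow_price,
      E.pd_slotFn_K _ (show 0 < x t (H.prev t z) .K from h1) h2]
    have h3 : V.Klag i₀ x (t + 1) z = x t (H.prev t z) .K := rfl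
    have h4 : V.Q2p i₀ x (t + 1) z = E.Q2 (x t (H.prev t z) .K) (x (t + 1) z .K) (V.node (t + 1) z).ξ :=
      rfl
    rw [h3, h4]
    simp
    ring

/-- Capital works in four places: the constraints of date `t`, those of date `t + 1` through the
link, the collateral value expected at `t` (through `Q1`) and the one expected at `t - 1` (through
`Q2`). -/
lemma foc_K : V.foc i₀ .sticky x l .K t z =
    -l t z .bud * (V.Q2p i₀ x t z * V.newK i₀ x t z + V.Qp i₀ x t z)
      + l t z .col * ((V.node t z).m * H.EX t (fun z' => V.Qp i₀ x (t + 1) z' * (V.node (t + 1) z').ξ) z)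
      - l t z .res * V.Qp i₀ x t z
    + E.β * H.EX t (fun z' =>
        -l (t + 1) z' .bud * (V.Q1p i₀ x (t + 1) z' * V.newK i₀ x (t + 1) z')
        + (l (t + 1) z' .bud + l (t + 1) z' .res)
          * (V.Qp i₀ x (t + 1) z' * ((1 - E.δ) * (V.node (t + 1) z').ξ))
        + V.profitTerm i₀ x l (t + 1) z'
        + (l (t + 1) z' .res + l (t + 1) z' .om * ((E.ε - 1) / E.ε) * (V.node (t + 1) z').P)
          / (V.node (t + 1) z').Δ * V.AFK i₀ x (t + 1) z' * (V.node (t + 1) z').ξ) z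
    + l t z .col * ((V.node t z).m * x t z .K) *
        H.EX t (fun z' => V.Q1p i₀ x (t + 1) z' * (V.node (t + 1) z').ξ) z
    + E.β⁻¹ * H.lag (fun s y => l s y .col * (V.node s y).m) 0 t z * V.Q2p i₀ x t z
        * (V.node t z).ξ * V.Klag i₀ x t z := by
  -- What leaves `z` is what enters each of its successors, so the link shadow value is an
  -- expectation of expressions in the date-`t+1` history only.
  have hlink (z') (hz : H.prev t z' = z) : V.linkOut x t z = V.linkIn i₀ x (t + 1) z' := by
    subst hz; rfl
  have e1 : V.linkShadow .sticky x l t z .K = H.EX t (fun z' =>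
        -l (t + 1) z' .bud * (V.Q1p i₀ x (t + 1) z' * V.newK i₀ x (t + 1) z')
        + (l (t + 1) z' .bud + l (t + 1) z' .res)
          * (V.Qp i₀ x (t + 1) z' * ((1 - E.δ) * (V.node (t + 1) z').ξ))
        + V.profitTerm i₀ x l (t + 1) z'
        + (l (t + 1) z' .res + l (t + 1) z' .om * ((E.ε - 1) / E.ε) * (V.node (t + 1) z').P)
          / (V.node (t + 1) z').Δ * V.AFK i₀ x (t + 1) z' * (V.node (t + 1) z').ξ) z := by
    refine EX_congr fun z' hz => ?_
    rw [hlink z' hz, E.pd_conSum_linkK _ _ _ (hf.Klag_pos hK (t + 1) z') (hf.inv (t + 1) z')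
      (V.ξ_pos _ _)]
    rfl
  have e2 : V.exps x t z .price =
      H.EX t (fun z' => V.Qp i₀ x (t + 1) z' * (V.node (t + 1) z').ξ) z := by
    refine EX_congr fun z' hz => ?_
    subst hz; rfl
  have e3 : H.EX t (fun z' => pd (fun x₀ => E.slotFn (V.node (t + 1) z') x₀ (x (t + 1) z') .price)
      (x t z) .K) z = H.EX t (fun z' => V.Q1p i₀ x (t + 1) z' * (V.node (t + 1) z').ξ) z := by
    refine EX_congr fun z' hz => ?_
    subst hz
    rw [E.pd_slotFn_today_K _ (hf.Klag_pos hK (t + 1) z') (hf.inv (t + 1) z')]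
    rfl
  have e4 (j : Slot) (hj : j ≠ .price) : H.EX t (fun z' =>
      pd (fun x₀ => E.slotFn (V.node (t + 1) z') x₀ (x (t + 1) z') j) (x t z) .K) z = 0 := by
    simp only [pd_slotFn_today_K_of_ne _ _ _ _ hj, EX_const]
  rw [foc, pd_felicity_K, E.pd_conSum_K _ _ _ _ (hf.Klag_pos hK t z) (hf.inv t z), Link.sum_eq,
    Slot.sum_eq, pd_linkK_K, pd_linkRD_of_ne _ _ _ (by decide), pastEffect_K l hK hf, e1, e2, e3,
    slotShadow_price, e4 .wMU (by decide), e4 .bPay (by decide), e4 .bMU (by decide),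
    e4 .pay (by decide), e4 .mc (by decide), e4 .mb (by decide)]
  simp only [Q2p, Qp, newK, Klag]
  ring

end

end Env

namespace Env

open Economy Histories

variable {E : Economy} {H : Histories.{u}} {V : Env E H} {i₀ : Init} {r : Regime} {x : Plan H}
  {l : Mult H} {t : ℕ} {z : H.Z t}

/-! ## Returns on loans -/

/-- Given `z`, the denominator and the deposit service are known. The return is therefore affine in
the net repayment, which reduces its moments to the expectations in the constraints. -/
lemma RLp_succ {z' : H.Z (t + 1)} (h : H.prev t z' = z) : V.RLp i₀ x (t + 1) z' =
    (x (t + 1) z' .Cb + x (t + 1) z' .L - x (t + 1) z' .D + V.Rp x t z * x t z .D) / x t z .L := by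
  subst h; rfl

namespace Feasible

variable (hf : V.Feasible i₀ r x)
include hf

lemma L_pos (t : ℕ) (z : H.Z t) : 0 < x t z .L := hf.pos t z _ (by simp)

lemma ub_pos (t : ℕ) (z : H.Z t) : 0 < ub E x t z := E.UbC_pos (hf.pos t z _ (by simp))

lemma hasEX_RL : H.HasEX t z (fun z' => V.RLp i₀ x (t + 1) z')
    ((V.exps x t z .pay + V.Rp x t z * x t z .D) / x t z .L) := by
  have h := ((hasEX (hf.slot_int t z .pay)).add (HasEX.const (V.Rp x t z * x t z .D))).const_mul
    (x t z .L)⁻¹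
  refine (h.congr fun z' hz => ?_).congr_val ?_
  · rw [RLp_succ hz, div_eq_inv_mul]; rfl
  · rw [div_eq_inv_mul]; rfl

lemma hasEX_ubRL : H.HasEX t z (fun z' => ub E x (t + 1) z' * V.RLp i₀ x (t + 1) z')
    ((V.exps x t z .bPay + V.Rp x t z * x t z .D * V.exps x t z .bMU) / x t z .L) := by
  have h := ((hasEX (hf.slot_int t z .bPay)).add
    ((hasEX (hf.slot_int t z .bMU)).const_mul (V.Rp x t z * x t z .D))).const_mul (x t z .L)⁻¹
  refine (h.congr fun z' hz => ?_).congr_val ?_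
  · rw [RLp_succ hz]; simp only [slotFn, ub]; ring
  · rw [div_eq_inv_mul]; rfl

lemma loan1_eq_mul : V.conVal i₀ r x t z .loan1 = (ub E x t z
    - E.βb * H.EX t (fun z' => ub E x (t + 1) z' * V.RLp i₀ x (t + 1) z') z) * x t z .L := by
  rw [hf.hasEX_ubRL.eq, sub_mul, mul_assoc E.βb, div_mul_cancel₀ _ (hf.L_pos t z).ne']
  rfl

lemma col_eq (hK : V.exps x t z .price =
      H.EX t (fun z' => V.Qp i₀ x (t + 1) z' * (V.node (t + 1) z').ξ) z) :
    V.conVal i₀ r x t z .col = (V.node t z).m *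
      H.EX t (fun z' => V.Qp i₀ x (t + 1) z' * (V.node (t + 1) z').ξ) z * x t z .K
      - H.EX t (fun z' => V.RLp i₀ x (t + 1) z') z * x t z .L := by
  rw [hf.hasEX_RL.eq, div_mul_cancel₀ _ (hf.L_pos t z).ne', ← hK]
  rfl

end Feasible

lemma exps_price : V.exps x t z .price =
    H.EX t (fun z' => V.Qp i₀ x (t + 1) z' * (V.node (t + 1) z').ξ) z := by
  refine EX_congr fun z' hz => ?_
  subst hz; rfl

/-! ## Wedges -/

section

variable (hL : 0 < i₀.L) (hf : V.Feasible i₀ r x) (hl : V.IsMultiplier i₀ r x l)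
include hf hl

lemma bud_add_res : l t z .bud + l t z .res = E.ωe * ue E x t z := by
  have := (hl.2 t z).stat .Ce (by decide)
  rw [foc_Ce _ _ _ (hf.pos t z _ (by simp))] at this
  linarith

omit hf in
lemma stat_L : (1 - (V.node t z).κ) * (l t z .lev + l t z .loan2 * V.conVal i₀ r x t z .loan1)
      + V.lamL x l t z * ub E x t z = V.pastPay (x := x) l t z := by
  have := (hl.2 t z).stat .L (by decide)
  rw [foc_L] at this
  linarith

include hL in
lemma stat_Cb : l t z .bud + l t z .res =
    E.ωb * ub E x t z + V.lamL x l t z * ubb E x t z * x t z .L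
    - E.β⁻¹ * H.lag (V.lamL x l) 0 t z * E.βb * ubb E x t z * V.RLp i₀ x t z * Llag i₀ x t z
    - V.pastPay (x := x) l t z := by
  have := (hl.2 t z).stat .Cb (by decide)
  rw [foc_Cb _ _ _ (hf.pos t z _ (by simp)) (Llag_pos i₀ hL hf.L_pos t z)] at this
  linarith

/-- Tomorrow's marginal utility of the banker in terms of that of the entrepreneur. -/
lemma ub_succ {z' : H.Z (t + 1)} (h : H.prev t z' = z) : E.ωb * ub E x (t + 1) z' =
    l (t + 1) z' .bud + l (t + 1) z' .res
    - V.lamL x l (t + 1) z' * ubb E x (t + 1) z' * x (t + 1) z' .L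
    + E.β⁻¹ * E.βb * V.lamL x l t z * x t z .L * (ubb E x (t + 1) z' * V.RLp i₀ x (t + 1) z')
    + E.β⁻¹ * E.βb * V.lamL x l t z * ub E x (t + 1) z' + E.β⁻¹ * l t z .col := by
  have := (hl.2 (t + 1) z').stat .Cb (by decide)
  rw [foc_Cb _ _ _ (hf.pos (t + 1) z' _ (by simp)) (hf.L_pos t (H.prev t z'))] at this
  subst h
  simp only [pastPay, lag, Llag] at this
  linear_combination this

/-- The condition for `D` contains `𝔼_t λᶜ_{t+1}`, whose existence is not assumed. Here it follows
from tomorrow's condition for `Ce`, the form used for loans. -/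
lemma hasEX_bud (hi : V.FinancialIntegrable i₀ x l) :
    H.HasEX t z (fun z' => l (t + 1) z' .bud)
      (E.ωe * H.EX t (fun z' => ue E x (t + 1) z') z - H.EX t (fun z' => l (t + 1) z' .res) z) := by
  refine (((hasEX (hi.ue t z)).const_mul E.ωe).sub (hasEX (hi.res t z))).congr fun z' _ => ?_
  rw [← bud_add_res hf hl]; ring

/-- The same expectation from tomorrow's condition for `Cb`, the form used for deposits. -/
lemma hasEX_bud' (hi : V.FinancialIntegrable i₀ x l) :
    H.HasEX t z (fun z' => l (t + 1) z' .bud)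
      ((E.ωb - E.β⁻¹ * E.βb * V.lamL x l t z) * H.EX t (fun z' => ub E x (t + 1) z') z
        + H.EX t (fun z' => V.lamL x l (t + 1) z' * ubb E x (t + 1) z' * x (t + 1) z' .L) z
        - H.EX t (fun z' => l (t + 1) z' .res) z
        - E.β⁻¹ * E.βb * V.lamL x l t z * x t z .L
          * H.EX t (fun z' => ubb E x (t + 1) z' * V.RLp i₀ x (t + 1) z') z
        - E.β⁻¹ * l t z .col) := by
  have h := (((((hasEX (hf.slot_int t z .bMU)).const_mul
      (E.ωb - E.β⁻¹ * E.βb * V.lamL x l t z)).add (hasEX (hi.lamL t z))).sub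
      (hasEX (hi.res t z))).sub ((hasEX (hi.ubbRL t z)).const_mul
        (E.β⁻¹ * E.βb * V.lamL x l t z * x t z .L))).sub (HasEX.const (E.β⁻¹ * l t z .col))
  refine h.congr fun z' hz => ?_
  have := ub_succ hf hl hz
  simp only [slotFn]
  change _ = (E.ωb - E.β⁻¹ * E.βb * V.lamL x l t z) * ub E x (t + 1) z' + _ - _ - _ - _
  linear_combination -this

include hL in
lemma depositCondition (hωb : 0 < E.ωb) (hi : V.FinancialIntegrable i₀ x l) :
    V.DepositCondition i₀ x l t z := by
  have hβ := E.β_pos.ne'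
  -- The gap in the deposit condition is the first-order condition for `D` with the sign reversed,
  -- so both the inequality and its equality case carry over. The lagged terms in `pastPay` cancel
  -- between the conditions for `D` and `Cb`.
  have key : E.ωb * (E.βb * V.Rp x t z * H.EX t (fun z' => ub E x (t + 1) z') z
      + l t z .lev / E.ωb + V.ΨD i₀ x l t z - ub E x t z) = -V.foc i₀ r x l .D t z := by
    rw [foc_D, (hasEX_bud' hf hl hi).eq, hf.loan1_eq_mul]
    have h1 := stat_Cb hL hf hl (t := t) (z := z)
    rw [ΨD, EX_mul_left]
    field_simp
    field_simp at h1
    linear_combination h1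
  constructor
  · have := (hl.2 t z).stat_D
    nlinarith
  · intro hD
    rw [(hl.2 t z).stat_D_eq hD, neg_zero] at key
    rcases mul_eq_zero.1 key with h | h
    · exact absurd h hωb.ne'
    · linarith

omit hl in
lemma κ_lt_one_of_D_pos (hD : 0 < x t z .D) : (V.node t z).κ < 1 := by
  have h1 : 0 ≤ (1 - (V.node t z).κ) * x t z .L - x t z .D := hf.lev t z
  have h2 := hf.L_pos t z
  by_contra h
  nlinarith

/-- Without deposits, leverage slackness reads `λᵇ (1 - κ) L = 0` and the loan gap is zero, so the
first term of the condition for `L` vanishes, even when `κ = 1`. -/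
lemma lamL_eq_of_D_zero (hD : x t z .D = 0) :
    V.lamL x l t z * ub E x t z = V.pastPay (x := x) l t z := by
  have h1 := stat_L hl (t := t) (z := z)
  have h2 := hf.loan1_eq t z hD
  have h3 : l t z .lev * ((1 - (V.node t z).κ) * x t z .L - x t z .D) = 0 := (hl.2 t z).lev_slack
  have h4 : l t z .lev * (1 - (V.node t z).κ) = 0 := by
    rw [hD, sub_zero, ← mul_assoc] at h3
    exact (mul_eq_zero.1 h3).resolve_right (hf.L_pos t z).ne'
  rw [h2] at h1
  linear_combination h1 - h4

include hL in
lemma loanCondition (hωe : 0 < E.ωe) (hi : V.FinancialIntegrable i₀ x l) :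
    V.LoanCondition i₀ x l t z := by
  have hβ := E.β_pos.ne'
  rw [LoanCondition, ΨL]
  refine mul_left_cancel₀ hωe.ne' ?_
  have eL := (hf.hasEX_RL (t := t) (z := z))
  have e0 : H.EX t (fun z' => E.ωe * ue E x (t + 1) z' * V.RLp i₀ x (t + 1) z') z =
      E.ωe * H.EX t (fun z' => ue E x (t + 1) z' * V.RLp i₀ x (t + 1) z') z := by
    rw [← EX_mul_left]; simp only [mul_assoc]
  have hmul (a b c d : ℝ) : E.ωe * (a + b / E.ωe * c + E.ωe⁻¹ * d) = E.ωe * a + b * c + d := by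
    field_simp
  split_ifs with hD
  · have hκ := κ_lt_one_of_D_pos hf hD
    have hκ' : 1 - (V.node t z).κ ≠ 0 := by linarith
    have h1 := (hl.2 t z).stat_D_eq hD
    rw [foc_D, (hasEX_bud hf hl hi).eq] at h1
    have h2 := stat_L hl (t := t) (z := z)
    have h3 := bud_add_res hf hl (t := t) (z := z)
    -- The second expectation in the wedge is expanded using that `λᵉ_t` and `R_t` are known at `t`.
    have e1 : H.EX t (fun z' => (E.β * E.ωe * ue E x (t + 1) z' + l t z .col)
        * (V.RLp i₀ x (t + 1) z' - V.Rp x t z)) z =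
        E.β * E.ωe * H.EX t (fun z' => ue E x (t + 1) z' * V.RLp i₀ x (t + 1) z') z
        + l t z .col * H.EX t (fun z' => V.RLp i₀ x (t + 1) z') z
        - E.β * E.ωe * V.Rp x t z * H.EX t (fun z' => ue E x (t + 1) z') z
        - l t z .col * V.Rp x t z := by
      have h := ((((hasEX (hi.ueRL t z)).const_mul (E.β * E.ωe)).add
        ((hasEX eL.int).const_mul (l t z .col))).sub
        ((hasEX (hi.ue t z)).const_mul (E.β * E.ωe * V.Rp x t z))).sub
        (HasEX.const (l t z .col * V.Rp x t z))
      exact (h.congr fun z' _ => by ring).eq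
    -- The leverage multiplier enters the conditions for `D` and `L` through this sum only; the
    -- condition for `L` determines it because positive deposits force `κ < 1`.
    have h4 : l t z .lev + l t z .loan2 * V.conVal i₀ r x t z .loan1 =
        (V.pastPay (x := x) l t z - V.lamL x l t z * ub E x t z) / (1 - (V.node t z).κ) := by
      rw [eq_div_iff hκ']; linear_combination h2
    rw [ΨLpos, hmul, e0, e1]
    have h5 : V.pastPay (x := x) l t z = E.β⁻¹ *
      (H.lag (V.lamL x l) 0 t z * E.βb * ub E x t z + H.lag (fun s y => l s y .col) 0 t z) := rfl
    -- `κ / (1 - κ) = 1 / (1 - κ) - 1`: the past effect through `L`, scaled by `1 / (1 - κ)`, net of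
    -- the past effect through `D`.
    have h6 : E.β⁻¹ * ((V.node t z).κ / (1 - (V.node t z).κ)) *
        (H.lag (V.lamL x l) 0 t z * E.βb * ub E x t z + H.lag (fun s y => l s y .col) 0 t z) =
        V.pastPay (x := x) l t z / (1 - (V.node t z).κ) - V.pastPay (x := x) l t z := by
      rw [h5]; field_simp; ring
    rw [h6]
    linear_combination -h3 + h1 + h4
  · have hD0 : x t z .D = 0 := le_antisymm (not_lt.1 hD) (hf.D_nonneg t z)
    have h1 := lamL_eq_of_D_zero hf hl hD0
    have h2 := stat_Cb hL hf hl (t := t) (z := z)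
    have h3 := bud_add_res hf hl (t := t) (z := z)
    have h4 := hf.loan1_eq_mul (t := t) (z := z)
    rw [hf.loan1_eq t z hD0] at h4
    -- The banker's Euler equation for loans holds with equality when there are no deposits. It
    -- replaces the condition for `D` as the link between `t` and `t + 1`.
    have h5 := (mul_eq_zero.1 h4.symm).resolve_right (hf.L_pos t z).ne'
    have eub := hf.hasEX_ubRL (t := t) (z := z)
    have e1 : H.EX t (fun z' => (ubb E x (t + 1) z' * V.RLp i₀ x (t + 1) z' * x t z .L
          + ub E x (t + 1) z') * V.RLp i₀ x (t + 1) z') z =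
        x t z .L * H.EX t (fun z' =>
          ubb E x (t + 1) z' * V.RLp i₀ x (t + 1) z' * V.RLp i₀ x (t + 1) z') z
        + H.EX t (fun z' => ub E x (t + 1) z' * V.RLp i₀ x (t + 1) z') z := by
      have h := ((hasEX (hi.ubbRLRL t z)).const_mul (x t z .L)).add (hasEX eub.int)
      exact (h.congr fun z' _ => by ring).eq
    -- Tomorrow's conditions for `Cb` and `Ce` are combined, weighted by the loan return and
    -- averaged; this translates the banker's Euler equation into the entrepreneur's marginal
    -- utilities.
    have e2 : E.ωb * H.EX t (fun z' => ub E x (t + 1) z' * V.RLp i₀ x (t + 1) z') z =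
        E.ωe * H.EX t (fun z' => ue E x (t + 1) z' * V.RLp i₀ x (t + 1) z') z
        - H.EX t (fun z' => V.lamL x l (t + 1) z' * ubb E x (t + 1) z' * x (t + 1) z' .L
          * V.RLp i₀ x (t + 1) z') z
        + E.β⁻¹ * E.βb * V.lamL x l t z * x t z .L * H.EX t (fun z' =>
          ubb E x (t + 1) z' * V.RLp i₀ x (t + 1) z' * V.RLp i₀ x (t + 1) z') z
        + E.β⁻¹ * E.βb * V.lamL x l t z
          * H.EX t (fun z' => ub E x (t + 1) z' * V.RLp i₀ x (t + 1) z') z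
        + E.β⁻¹ * l t z .col * H.EX t (fun z' => V.RLp i₀ x (t + 1) z') z := by
      have h := (((((hasEX (hi.ueRL t z)).const_mul E.ωe).sub (hasEX (hi.lamLRL t z))).add
        ((hasEX (hi.ubbRLRL t z)).const_mul (E.β⁻¹ * E.βb * V.lamL x l t z * x t z .L))).add
        ((hasEX eub.int).const_mul (E.β⁻¹ * E.βb * V.lamL x l t z))).add
        ((hasEX eL.int).const_mul (E.β⁻¹ * l t z .col))
      rw [← EX_mul_left]
      refine (h.congr fun z' hz => ?_).eq
      have h8 := ub_succ hf hl hz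
      rw [bud_add_res hf hl] at h8
      linear_combination V.RLp i₀ x (t + 1) z' * h8
    rw [ΨLzero, hmul, e0, e1]
    have hββ := mul_inv_cancel₀ hβ
    linear_combination h2 - h3 + h1 + E.ωb * h5 + E.βb * e2
      + l t z .col * H.EX t (fun z' => V.RLp i₀ x (t + 1) z') z * hββ

end

end Env

/-! ### Capital and labor wedges -/

namespace Env

open Economy Histories

variable {E : Economy} {H : Histories.{u}} {V : Env E H} {i₀ : Init} {r : Regime} {x : Plan H}
  {l : Mult H} {t : ℕ} {z : H.Z t}

section

variable (hK : 0 < i₀.K) (hf : V.Feasible i₀ .sticky x) (hl : V.IsMultiplier i₀ .sticky x l)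
include hf hl

include hK in
lemma capitalCondition (hωe : 0 < E.ωe) (hi : V.RealIntegrable i₀ x l) :
    V.CapitalCondition i₀ x l t z := by
  have hβ := E.β_pos.ne'
  have hQ := (hf.Qp_pos hK t z).ne'
  rw [CapitalCondition]
  refine mul_left_cancel₀ hωe.ne' ?_
  have hmul (a b c m d : ℝ) :
      E.ωe * (a + b / E.ωe * m * c + E.ωe⁻¹ * d) = E.ωe * a + b * m * c + d := by
    field_simp
  have e0 : H.EX t (fun z' => E.ωe * ue E x (t + 1) z' *
      (V.capPay i₀ x (t + 1) z' / V.Qp i₀ x t z)) z * V.Qp i₀ x t z =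
      E.ωe * H.EX t (fun z' => ue E x (t + 1) z' * V.capPay i₀ x (t + 1) z') z := by
    rw [← EX_mul_right, ← EX_mul_left]
    refine EX_congr fun z' _ => ?_
    field_simp
  have h1 := (hl.2 t z).stat .K (by decide)
  rw [foc_K l hK hf] at h1
  -- With `λᶜ + λʸ = ω_e U^e_C` tomorrow, resale value and the share `P^w` of the marginal product
  -- form the payoff of capital valued by the entrepreneur. The rest of the marginal product is
  -- `stickyTerm`, so only the integrability of these pieces is needed.
  have h2 := (((((hasEX (hi.capPay t z)).const_mul E.ωe).add (hasEX (hi.profit t z))).sub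
    (hasEX (hi.bud t z))).add (hasEX (hi.sticky t z))).congr
    (g := fun z' =>
        -l (t + 1) z' .bud * (V.Q1p i₀ x (t + 1) z' * V.newK i₀ x (t + 1) z')
        + (l (t + 1) z' .bud + l (t + 1) z' .res)
          * (V.Qp i₀ x (t + 1) z' * ((1 - E.δ) * (V.node (t + 1) z').ξ))
        + V.profitTerm i₀ x l (t + 1) z'
        + (l (t + 1) z' .res + l (t + 1) z' .om * ((E.ε - 1) / E.ε) * (V.node (t + 1) z').P)
          / (V.node (t + 1) z').Δ * V.AFK i₀ x (t + 1) z' * (V.node (t + 1) z').ξ) fun z' _ => by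
      have h3 := bud_add_res hf hl (t := t + 1) (z := z')
      have hΔ := (V.Δ_pos (t + 1) z').ne'
      rw [h3, ← sub_eq_iff_eq_add'.2 h3.symm, capPay, stickyTerm]
      field_simp
      ring
  rw [h2.eq] at h1
  have h3 := bud_add_res hf hl (t := t) (z := z)
  rw [ΨK, hmul]
  linear_combination -V.Qp i₀ x t z * h3 - h1 - (E.β - E.βe) * e0

/-- All intertemporal effects of `Cw` and `N` are contained in `totalMU`. The condition for `Cw`
determines it, and inserting it into the condition for `N` leaves a static equation with the ratio
`UwCN / UwCC`. -/
lemma laborCondition (hw : V.LaborWedgeDefined i₀ x l) : V.LaborCondition i₀ x l t z := by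
  obtain ⟨hP, hCC, hden⟩ := hw t z
  have hΔ := (V.Δ_pos t z).ne'
  have hc : 0 < x t z .Cw := hf.pos t z _ (by simp)
  have hn : 0 < x t z .N := hf.pos t z _ (by simp)
  have h1 := (hl.2 t z).stat .Cw (by decide)
  have h2 := (hl.2 t z).stat .N (by decide)
  rw [foc_Cw _ _ _ hc hn] at h1
  rw [foc_N _ _ _ hc hn] at h2
  have h3 := bud_add_res hf hl (t := t) (z := z)
  -- On the labor supply curve the disutility of labor is the wage times `U^w_C`.
  have hW : E.UwN (x t z .Cw) (x t z .N) = -Wp E x t z * uw E x t z := by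
    have := (E.UwC_pos hc hn).ne'
    rw [Wp, W, uw]; field_simp
  have hres := sub_eq_iff_eq_add'.2 h3.symm
  rw [hW] at h2
  rw [← hres] at h1 h2
  have hMU : V.totalMU i₀ (x := x) l t z = (E.UwCC (x t z .Cw) (x t z .N))⁻¹ *
      (l t z .bud * (E.WC (x t z .Cw) (x t z .N) * x t z .N) + (E.ωe * ue E x t z - l t z .bud)
        - E.ωw * uw E x t z) := by
    rw [eq_inv_mul_iff_mul_eq₀ hCC]; linear_combination h1
  rw [hMU] at h2
  have hPΔ : ∀ a, a * (V.Pwp i₀ x t z * (V.node t z).Δ)⁻¹ * V.Pwp i₀ x t z = a / (V.node t z).Δ := by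
    intro a; field_simp
  rw [LaborCondition, ΨN]
  have hcomb (a q b d : ℝ) : a / d - q * (b / d) = (a - q * b) / d := by ring
  rw [hcomb, ← sub_eq_iff_eq_add', eq_div_iff hden]
  rw [show ((E.ωe * ue E x t z + l t z .om * ((E.ε - 1) / E.ε) * (V.node t z).P - l t z .bud)
        * (V.Pwp i₀ x t z * (V.node t z).Δ)⁻¹ - E.ωw * uw E x t z - l t z .bud)
      * V.Pwp i₀ x t z = (E.ωe * ue E x t z + l t z .om * ((E.ε - 1) / E.ε) * (V.node t z).P
        - l t z .bud) / (V.node t z).Δ - (E.ωw * uw E x t z + l t z .bud) * V.Pwp i₀ x t z by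
    rw [← hPΔ]; ring]
  linear_combination -h2

end

/-! ## Risk sharing -/

section

variable (hL : 0 < i₀.L) (hf : V.Feasible i₀ r x) (hl : V.IsMultiplier i₀ r x l)
include hL hf hl

lemma risk_sharing (h0 : V.lamL x l t z = 0) (h1 : H.lag (V.lamL x l) 0 t z = 0)
    (h2 : H.lag (fun s y => l s y .col) 0 t z = 0) :
    E.ωb * E.UbC (x t z .Cb) = E.ωe * E.UeC (x t z .Ce) := by
  have h3 := stat_Cb hL hf hl (t := t) (z := z)
  rw [bud_add_res hf hl, pastPay, h0, h1, h2] at h3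
  simp only [ub, ue] at h3
  linear_combination -h3

omit hL in
-- With nothing inherited, the condition for `L` is `(1 - κ)(λᵇ + λᴸ₂ G) + λᴸ U^b_C = 0`. Here `λᴸ₂`
-- has no sign, but `G` times the leverage slack is zero: either `G = 0` removes it from the first
-- term, or a binding leverage constraint removes it from `λᴸ`. What remains is a vanishing sum of
-- nonnegative terms.
lemma lamL_eq_zero (h1 : H.lag (V.lamL x l) 0 t z = 0)
    (h2 : H.lag (fun s y => l s y .col) 0 t z = 0) : V.lamL x l t z = 0 := by
  have hp : V.pastPay (x := x) l t z = 0 := by simp [pastPay, h1, h2]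
  have hub := hf.ub_pos t z
  rcases (hf.D_nonneg t z).eq_or_lt with hD | hD
  · have := lamL_eq_of_D_zero hf hl hD.symm
    rw [hp] at this
    exact (mul_eq_zero.1 this).resolve_right hub.ne'
  have hκ := κ_lt_one_of_D_pos hf hD
  have hs := stat_L hl (t := t) (z := z)
  have hk := hl.2 t z
  have hG : 0 ≤ V.conVal i₀ r x t z .loan1 := hf.loan1 t z
  have hG2 : V.conVal i₀ r x t z .loan1 * ((1 - (V.node t z).κ) * x t z .L - x t z .D) = 0 :=
    hf.loan2 t z
  have hlev : l t z .lev * ((1 - (V.node t z).κ) * x t z .L - x t z .D) = 0 := hk.lev_slack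
  rw [hp] at hs
  rcases mul_eq_zero.1 hG2 with h | h
  · rw [h, mul_zero, add_zero] at hs
    rcases mul_eq_zero.1 hlev with h' | h'
    · rw [h', mul_zero, zero_add] at hs
      exact (mul_eq_zero.1 hs).resolve_right hub.ne'
    · have e : V.lamL x l t z = l t z .loan1 := by simp [lamL, h']
      have h3 : 0 ≤ l t z .loan1 := nonneg_of_mul_nonneg_right hk.loan1_sign hD
      have h4 := mul_nonneg (sub_nonneg.2 hκ.le) hk.lev_nonneg
      have h5 := mul_nonneg h3 hub.le
      rw [e] at hs ⊢
      have h6 : l t z .loan1 * ub E x t z = 0 := by linarith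
      exact (mul_eq_zero.1 h6).resolve_right hub.ne'
  · have e : V.lamL x l t z = l t z .loan1 := by simp [lamL, h]
    rcases mul_eq_zero.1 hk.loan1_slack with h' | h'
    · rw [e, h']
    · rw [h', mul_zero, add_zero] at hs
      have h3 : 0 ≤ l t z .loan1 := nonneg_of_mul_nonneg_right hk.loan1_sign hD
      have h4 := mul_nonneg (sub_nonneg.2 hκ.le) hk.lev_nonneg
      have h5 := mul_nonneg h3 hub.le
      rw [e] at hs ⊢
      have h6 : l t z .loan1 * ub E x t z = 0 := by linarith
      exact (mul_eq_zero.1 h6).resolve_right hub.ne'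

omit hL in
-- Induction along the history: slackness sets `λᵉ` to zero at every predecessor, and `λᴸ` cannot
-- become nonzero unless `λᵉ` or `λᴸ` was nonzero one date earlier.
lemma lamL_eq_zero_of_slack : ∀ t (z : H.Z t),
    H.PastAll (fun s y => 0 < V.conVal i₀ r x s y .col) t z →
    V.lamL x l t z = 0 ∧ H.lag (V.lamL x l) 0 t z = 0 ∧ H.lag (fun s y => l s y .col) 0 t z = 0
  | 0, z, _ => ⟨lamL_eq_zero hf hl rfl rfl, rfl, rfl⟩
  | t + 1, z, h => by
    have h1 := (lamL_eq_zero_of_slack t (H.prev t z) h.2).1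
    have h2 : l t (H.prev t z) .col = 0 :=
      (mul_eq_zero.1 (hl.2 t (H.prev t z)).col_slack).resolve_right h.1.ne'
    exact ⟨lamL_eq_zero hf hl h1 h2, h1, h2⟩

end

end Env

namespace Env

open Economy Histories

variable {E : Economy} {H : Histories.{u}} {V : Env E H} {i₀ : Init}

/-! ## Allocations of (regulated) competitive equilibria -/

namespace IsRegulatedCE

variable {M : Market H} {T : Taxes H} {t : ℕ} {z : H.Z t}

lemma lag_K (V : Env E H) (i₀ : Init) (M : Market H) :
    ∀ t (z : H.Z t), H.lag M.K i₀.K t z = V.Klag i₀ M.plan t z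
  | 0, _ => rfl
  | _ + 1, _ => rfl

lemma lag_L (i₀ : Init) (M : Market H) :
    ∀ t (z : H.Z t), H.lag M.L i₀.L t z = Llag i₀ M.plan t z
  | 0, _ => rfl
  | _ + 1, _ => rfl

variable (hK : 0 < i₀.K) (hL : 0 < i₀.L) (hM : V.IsRegulatedCE i₀ M T)
include hM

lemma plan_pos (t : ℕ) (z : H.Z t) {a : Ctl}
    (ha : a ∈ ({.Cb, .Ce, .Cw, .K, .L, .N, .Om} : Set Ctl)) : 0 < M.plan t z a := by
  cases a
  case D => simp at ha
  all_goals exact hM.pos _ (by simp) t z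

lemma Cw_pos (t : ℕ) (z : H.Z t) : 0 < M.Cw t z := hM.pos _ (by simp) t z
lemma N_pos (t : ℕ) (z : H.Z t) : 0 < M.N t z := hM.pos _ (by simp) t z
lemma uw_pos (t : ℕ) (z : H.Z t) : 0 < E.UwC (M.Cw t z) (M.N t z) :=
  E.UwC_pos (hM.Cw_pos t z) (hM.N_pos t z)

lemma Rp_eq (t : ℕ) (z : H.Z t) : V.Rp M.plan t z = M.R t z := by
  have h := hM.worker_euler t z
  have hu := (hM.uw_pos t z).ne'
  have e : H.EX t (fun z' => E.β * E.UwC (M.Cw (t + 1) z') (M.N (t + 1) z')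
      / E.UwC (M.Cw t z) (M.N t z)) z = E.β / E.UwC (M.Cw t z) (M.N t z) *
      H.EX t (fun z' => E.UwC (M.Cw (t + 1) z') (M.N (t + 1) z')) z := by
    rw [← EX_mul_left]; exact EX_congr fun z' _ => by ring
  rw [e] at h
  have h1 : V.Rp M.plan t z = E.UwC (M.Cw t z) (M.N t z) /
    (E.β * H.EX t (fun z' => E.UwC (M.Cw (t + 1) z') (M.N (t + 1) z')) z) := rfl
  -- If expected marginal utility were zero, the worker's Euler equation would read `1 = 0`; hence
  -- it can be solved for `R`.
  have hne : E.β * H.EX t (fun z' => E.UwC (M.Cw (t + 1) z') (M.N (t + 1) z')) z ≠ 0 := by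
    intro h0
    have : E.β / E.UwC (M.Cw t z) (M.N t z) *
      H.EX t (fun z' => E.UwC (M.Cw (t + 1) z') (M.N (t + 1) z')) z = 0 := by
      rw [div_mul_eq_mul_div, h0, zero_div]
    rw [this, zero_mul] at h
    exact one_ne_zero h
  rw [h1, div_eq_iff hne]
  field_simp at h
  linarith

lemma linkIn_RD : ∀ t (z : H.Z t),
    V.linkIn i₀ M.plan t z .RD = H.lag M.R i₀.R t z * H.lag M.D i₀.D t z
  | 0, _ => rfl
  | t + 1, z => congrArg (· * M.D t (H.prev t z)) (hM.Rp_eq t (H.prev t z))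

/-- The deposit tax and its rebate cancel in the banker's budget, so the payment on loans does not
depend on taxes. -/
lemma loan_payment (t : ℕ) (z : H.Z t) : M.Cb t z + M.L t z - M.D t z + V.linkIn i₀ M.plan t z .RD =
    M.RL t z * Llag i₀ M.plan t z := by
  have h := hM.banker_budget t z
  rw [hM.banker_rebate, lag_L] at h
  rw [hM.linkIn_RD]
  linarith

include hL in
lemma RLp_eq (t : ℕ) (z : H.Z t) : V.RLp i₀ M.plan t z = M.RL t z := by
  have hpos := Llag_pos i₀ hL (x := M.plan) (fun t z => hM.plan_pos t z (by simp)) t z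
  rw [RLp, div_eq_iff hpos.ne']
  exact hM.loan_payment t z

include hK

lemma lag_K_pos (t : ℕ) (z : H.Z t) : 0 < H.lag M.K i₀.K t z := by
  rw [lag_K V]
  exact V.linkIn_K_pos i₀ hK (x := M.plan) (fun t z => hM.plan_pos t z (by simp)) t z

lemma growth_eq (t : ℕ) (z : H.Z t) : M.K t z / H.lag M.K i₀.K t z - (1 - E.δ) * (V.node t z).ξ =
    E.Φ (M.I t z / H.lag M.K i₀.K t z) := by
  have hk := (hM.lag_K_pos hK t z).ne'
  have h := hM.clear_K t z
  rw [sub_eq_iff_eq_add, div_eq_iff hk]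
  linarith

lemma growth_mem (t : ℕ) (z : H.Z t) :
    M.K t z / H.lag M.K i₀.K t z - (1 - E.δ) * (V.node t z).ξ ∈ E.Φ '' Ioi 0 := by
  rw [hM.growth_eq hK]
  exact mem_image_of_mem _ (div_pos (hM.pos _ (by simp) t z) (hM.lag_K_pos hK t z))

lemma Inv_div_eq (t : ℕ) (z : H.Z t) : E.Inv (H.lag M.K i₀.K t z) (M.K t z) (V.node t z).ξ
    / H.lag M.K i₀.K t z = M.I t z / H.lag M.K i₀.K t z := by
  rw [E.Inv_div _ _ (hM.lag_K_pos hK t z), hM.growth_eq hK,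
    E.Φinv_Φ (div_pos (hM.pos _ (by simp) t z) (hM.lag_K_pos hK t z))]

lemma Inv_eq (t : ℕ) (z : H.Z t) :
    E.Inv (H.lag M.K i₀.K t z) (M.K t z) (V.node t z).ξ = M.I t z :=
  (div_left_inj' (hM.lag_K_pos hK t z).ne').1 (hM.Inv_div_eq hK t z)

lemma Q_eq (t : ℕ) (z : H.Z t) :
    E.Q (H.lag M.K i₀.K t z) (M.K t z) (V.node t z).ξ = M.Q t z := by
  rw [Economy.Q, hM.Inv_div_eq hK, hM.capital_supply]

lemma Qp_eq (t : ℕ) (z : H.Z t) : V.Qp i₀ M.plan t z = M.Q t z := by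
  rw [← hM.Q_eq hK, lag_K V]; rfl

omit hK in
-- The retailers' recursion for `Ω₁`, multiplied by `Δ`, gives revenue because wholesale output is
-- `Δ Y`.
lemma revenue_eq (t : ℕ) (z : H.Z t) :
    E.revenue .sticky (V.node t z) (V.linkIn i₀ M.plan t z) (M.plan t z) (V.exps M.plan t z) =
    M.Pw t z * ((V.node t z).A * E.F ((V.node t z).ξ * H.lag M.K i₀.K t z) (M.N t z)) := by
  have h := hM.marginal_cost t z
  have e : H.EX t (fun z' => E.β * E.UwC (M.Cw (t + 1) z') (M.N (t + 1) z')
      / E.UwC (M.Cw t z) (M.N t z) * (V.node (t + 1) z').infl ^ E.ε * M.Om1 (t + 1) z') z =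
      E.β / E.UwC (M.Cw t z) (M.N t z) * V.exps M.plan t z .mc := by
    rw [exps, ← EX_mul_left]
    exact EX_congr fun z' _ => by simp only [slotFn, Market.plan]; ring
  rw [e] at h
  have h2 := hM.clear_wholesale t z
  rw [h2]
  change (V.node t z).Δ * (M.Om1 t z - E.β * E.θ * V.exps M.plan t z .mc
    / E.UwC (M.Cw t z) (M.N t z)) = _
  linear_combination (V.node t z).Δ * h

lemma Pwp_eq (t : ℕ) (z : H.Z t) : V.Pwp i₀ M.plan t z = M.Pw t z := by
  have h := hM.revenue_eq t z
  have hF : 0 < V.AFp i₀ M.plan t z := mul_pos (V.A_pos t z) (E.F_pos (mul_pos (V.ξ_pos t z)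
    (by rw [← lag_K]; exact hM.lag_K_pos hK t z)) (hM.N_pos t z))
  rw [lag_K V] at h
  change _ = M.Pw t z * V.AFp i₀ M.plan t z at h
  rw [← div_eq_iff hF.ne'] at h
  rw [← h, Pwp, revenue, div_mul_eq_mul_div]
  rfl

/-- The allocation of every regulated equilibrium satisfies the planner's constraints. -/
theorem feasible (hW : WelfareDefined E M.plan) : V.Feasible i₀ .sticky M.plan := by
  have hLp (t : ℕ) (z : H.Z t) : 0 < M.L t z := hM.pos M.L (by simp) t z
  -- Given `z`, the loan return is the only random part of the net repayment, so its integrability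
  -- is that of `R^L` (and of `U^b_C R^L` and `U^b_C` when weighted by marginal utility).
  have hpay {t : ℕ} {z : H.Z t} {z' : H.Z (t + 1)} (hz : H.prev t z' = z) :
      M.Cb (t + 1) z' + M.L (t + 1) z' - M.D (t + 1) z' =
      M.RL (t + 1) z' * M.L t z - M.R t z * M.D t z := by
    have h := hM.loan_payment (t + 1) z'
    rw [hM.linkIn_RD] at h
    subst hz
    simp only [lag] at h
    change _ = M.RL (t + 1) z' * M.L t (H.prev t z') at h
    linarith
  have eprice {t : ℕ} {z : H.Z t} {z' : H.Z (t + 1)} (hz : H.prev t z' = z) :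
      E.Q (M.K t z) (M.K (t + 1) z') (V.node (t + 1) z').ξ = M.Q (t + 1) z' := by
    rw [← hM.Q_eq hK]; subst hz; rfl
  -- The optimal relative price eliminates `Ω₂`; the recursion for `Ω₂` then becomes the planner's
  -- constraint on `Ω₁` alone.
  have emb (t : ℕ) (z : H.Z t) : M.Om1 t z / (V.node t z).P = (E.ε - 1) / E.ε * M.Om2 t z := by
    have h1 : 0 < M.Om1 t z := hM.pos _ (by simp) t z
    have h2 : 0 < M.Om2 t z := hM.pos _ (by simp) t z
    have h3 := E.ε_gt
    have h4 : E.ε - 1 ≠ 0 := by linarith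
    have h5 : E.ε ≠ 0 := by linarith
    rw [hM.rel_price]
    field_simp
  have hPay (t : ℕ) (z : H.Z t) : H.HasEX t z
      (fun z' => M.Cb (t + 1) z' + M.L (t + 1) z' - M.D (t + 1) z')
      (M.L t z * H.EX t (fun z' => M.RL (t + 1) z') z - M.R t z * M.D t z) :=
    (((hasEX (hM.int_RL t z)).const_mul (M.L t z)).sub (HasEX.const _)).congr fun z' hz => by
      rw [hpay hz]; ring
  have hbPay (t : ℕ) (z : H.Z t) : H.HasEX t z
      (fun z' => E.UbC (M.Cb (t + 1) z') * (M.Cb (t + 1) z' + M.L (t + 1) z' - M.D (t + 1) z'))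
      (M.L t z * H.EX t (fun z' => E.UbC (M.Cb (t + 1) z') * M.RL (t + 1) z') z
        - M.R t z * M.D t z * H.EX t (fun z' => E.UbC (M.Cb (t + 1) z')) z) :=
    (((hasEX (hM.int_bRL t z)).const_mul (M.L t z)).sub
      ((hasEX (hM.int_bMU t z)).const_mul (M.R t z * M.D t z))).congr fun z' hz => by
      rw [hpay hz]; ring
  have hprice (t : ℕ) (z : H.Z t) : H.HasEX t z
      (fun z' => E.Q (M.K t z) (M.K (t + 1) z') (V.node (t + 1) z').ξ * (V.node (t + 1) z').ξ)
      (H.EX t (fun z' => M.Q (t + 1) z' * (V.node (t + 1) z').ξ) z) :=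
    (hasEX (hM.int_Q t z)).congr fun z' hz => by rw [eprice hz]
  have hmb (t : ℕ) (z : H.Z t) : H.HasEX t z
      (fun z' => E.UwC (M.Cw (t + 1) z') (M.N (t + 1) z') * (V.node (t + 1) z').infl ^ (E.ε - 1)
        / (V.node (t + 1) z').P * M.Om1 (t + 1) z')
      ((E.ε - 1) / E.ε * H.EX t (fun z' => E.UwC (M.Cw (t + 1) z') (M.N (t + 1) z') *
        (V.node (t + 1) z').infl ^ (E.ε - 1) * M.Om2 (t + 1) z') z) :=
    ((hasEX (hM.int_mb t z)).const_mul _).congr fun z' _ => by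
      rw [div_mul_eq_mul_div, mul_div_assoc, emb]; ring
  have hR (t : ℕ) (z : H.Z t) : E.R (M.plan t z) (V.exps M.plan t z) = M.R t z := hM.Rp_eq t z
  -- The private Euler equation identifies the loan gap with the leverage multiplier, so the
  -- constraints on `G` are the sign and slackness conditions of that multiplier.
  have hG (t : ℕ) (z : H.Z t) : V.conVal i₀ .sticky M.plan t z .loan1 =
      M.lb t z * (1 - (V.node t z).κ) * M.L t z := by
    change E.UbC (M.Cb t z) * M.L t z - E.βb * (V.exps M.plan t z .bPay
      + E.R (M.plan t z) (V.exps M.plan t z) * M.D t z * V.exps M.plan t z .bMU) = _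
    have h1 : V.exps M.plan t z .bPay = _ := (hbPay t z).eq
    have h2 : V.exps M.plan t z .bMU = H.EX t (fun z' => E.UbC (M.Cb (t + 1) z')) z := rfl
    rw [h1, h2, hR]
    linear_combination M.L t z * hM.loans t z
  have hlev (t : ℕ) (z : H.Z t) : V.conVal i₀ .sticky M.plan t z .lev =
    (1 - (V.node t z).κ) * M.L t z - M.D t z := rfl
  refine ⟨fun t a => ?_, fun t z a => hM.plan_pos t z, hM.D_nonneg, fun t z => ?_, fun t z j => ?_, hW,
    fun t z => ?_, fun t z => ?_, fun t z hD => ?_, fun t z => ?_, fun t z => ?_, fun t z => ?_,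
    fun t z => ?_, fun t z => ?_⟩
  · cases a <;> exact hM.meas _ (by simp) t
  · have h := hM.growth_mem hK t z
    rwa [lag_K V] at h
  · cases j
    · exact hM.int_wMU t z
    · exact (hbPay t z).int
    · exact hM.int_bMU t z
    · exact (hprice t z).int
    · exact (hPay t z).int
    · exact hM.int_mc t z
    · exact (hmb t z).int
  · rw [hlev]
    exact sub_nonneg.2 (hM.leverage t z)
  · rw [hG]
    exact mul_nonneg (mul_nonneg (hM.lb_nonneg t z) (sub_nonneg.2 (V.κ_mem t z).2)) (hLp t z).le
  · rw [hG]
    have h := hM.lb_slack t z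
    rw [show M.D t z = 0 from hD] at h
    linarith
  · change V.conVal i₀ .sticky M.plan t z .loan1 * V.conVal i₀ .sticky M.plan t z .lev = 0
    rw [hG, hlev]
    linear_combination (1 - (V.node t z).κ) * M.L t z * hM.lb_slack t z
  · change E.revenue .sticky (V.node t z) (V.linkIn i₀ M.plan t z) (M.plan t z) (V.exps M.plan t z)
      - E.Q (V.Klag i₀ M.plan t z) (M.K t z) (V.node t z).ξ
        * (M.K t z - (1 - E.δ) * (V.node t z).ξ * V.Klag i₀ M.plan t z)
      - E.W (M.Cw t z) (M.N t z) * M.N t z + M.D t z - V.linkIn i₀ M.plan t z .RD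
      - M.Cb t z - M.Ce t z = 0
    rw [hM.revenue_eq, ← lag_K, hM.Q_eq hK]
    -- The planner's budget constraint is the sum of the bankers' and the entrepreneurs' budgets, in
    -- which loan payments and rebated taxes cancel.
    have h1 := hM.loan_payment t z
    have h2 := hM.ent_budget t z
    rw [hM.ent_rebate, lag_L] at h2
    have h3 : E.W (M.Cw t z) (M.N t z) = M.W t z := (hM.labor_supply t z).symm
    rw [h3]
    linear_combination -h1 - h2
  · change 0 ≤ (V.node t z).m * V.exps M.plan t z .price * M.K t z - (V.exps M.plan t z .pay
      + E.R (M.plan t z) (V.exps M.plan t z) * M.D t z)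
    have h1 : V.exps M.plan t z .price = _ := (hprice t z).eq
    have h2 : V.exps M.plan t z .pay = _ := (hPay t z).eq
    rw [h1, h2, hR]
    linarith [hM.collateral t z]
  · change (V.node t z).A / (V.node t z).Δ * E.F ((V.node t z).ξ * V.Klag i₀ M.plan t z) (M.N t z)
      - (M.Cb t z + M.Ce t z + M.Cw t z) - E.Inv (V.Klag i₀ M.plan t z) (M.K t z) (V.node t z).ξ = 0
    have hΔ := (V.Δ_pos t z).ne'
    rw [← lag_K, hM.Inv_eq hK, div_mul_eq_mul_div, hM.clear_wholesale, mul_div_cancel_left₀ _ hΔ]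
    linarith [hM.clear_final t z]
  · change (E.ε - 1) / E.ε * (V.node t z).P * ((V.node t z).A / (V.node t z).Δ)
      * E.F ((V.node t z).ξ * V.Klag i₀ M.plan t z) (M.N t z) - M.Om1 t z
      + E.β * E.θ * ((V.node t z).P * V.exps M.plan t z .mb) / E.UwC (M.Cw t z) (M.N t z) = 0
    have hΔ := (V.Δ_pos t z).ne'
    have hP := (V.P_pos t z).ne'
    have hY : (V.node t z).A / (V.node t z).Δ * E.F ((V.node t z).ξ * V.Klag i₀ M.plan t z) (M.N t z)
        = M.Y t z := by
      rw [← lag_K, div_mul_eq_mul_div, hM.clear_wholesale, mul_div_cancel_left₀ _ hΔ]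
    have h1 : V.exps M.plan t z .mb = _ := (hmb t z).eq
    have h2 := (div_eq_iff hP).1 (emb t z)
    have h3 := hM.marginal_benefit t z
    have e : H.EX t (fun z' => E.β * E.UwC (M.Cw (t + 1) z') (M.N (t + 1) z')
      / E.UwC (M.Cw t z) (M.N t z) * (V.node (t + 1) z').infl ^ (E.ε - 1) * M.Om2 (t + 1) z') z =
      E.β / E.UwC (M.Cw t z) (M.N t z) * H.EX t (fun z' => E.UwC (M.Cw (t + 1) z') (M.N (t + 1) z') *
        (V.node (t + 1) z').infl ^ (E.ε - 1) * M.Om2 (t + 1) z') z := by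
      rw [← EX_mul_left]
      exact EX_congr fun z' _ => by ring
    rw [e] at h3
    rw [mul_assoc _ ((V.node t z).A / (V.node t z).Δ), hY, h1]
    linear_combination -h2 - (E.ε - 1) / E.ε * (V.node t z).P * h3

end IsRegulatedCE

end Env

namespace Env

open Economy Histories

variable {E : Economy} {H : Histories.{u}} {V : Env E H} {i₀ : Init}

/-! ## Redistribution between bankers and entrepreneurs at an initial history -/

/-- Controls after a transfer of `η` units of consumption from entrepreneurs to bankers. -/
def transfer (w : Ctl → ℝ) (η : ℝ) : Ctl → ℝ
  | .Cb => w .Cb + η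
  | .Ce => w .Ce - η
  | a => w a

open Classical in
/-- The plan with a transfer at the initial history `z₀` only. -/
noncomputable def transferPlan (x : Plan H) (z₀ : H.Z 0) (η : ℝ) : Plan H
  | 0, z => if z = z₀ then transfer (x 0 z) η else x 0 z
  | t + 1, z => x (t + 1) z

variable {x : Plan H} {z₀ : H.Z 0} {η : ℝ}

lemma transferPlan_apply_of_ne {a : Ctl} (hb : a ≠ .Cb) (he : a ≠ .Ce) (t : ℕ) (z : H.Z t) :
    transferPlan x z₀ η t z a = x t z a := by
  cases t with
  | zero =>
    simp only [transferPlan]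
    split_ifs
    · cases a <;> first | exact absurd rfl hb | exact absurd rfl he | rfl
    · rfl
  | succ t => rfl

/-- Expectations involve tomorrow's controls and, today, only `K`. A transfer of consumption at date
0 is invisible to them, and no expectation was formed before date 0. -/
lemma exps_transferPlan (t : ℕ) (z : H.Z t) :
    V.exps (transferPlan x z₀ η) t z = V.exps x t z := by
  funext j
  have h := transferPlan_apply_of_ne (x := x) (z₀ := z₀) (η := η) (a := .K) (by decide) (by decide) t z
  cases j <;> simp only [exps, slotFn, h] <;> rfl

lemma linkOut_transferPlan (t : ℕ) (z : H.Z t) :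
    V.linkOut (transferPlan x z₀ η) t z = V.linkOut x t z := by
  funext k
  rw [linkOut, linkOut, exps_transferPlan]
  cases k <;> simp [link, R, transferPlan_apply_of_ne]

lemma linkIn_transferPlan : ∀ t (z : H.Z t),
    V.linkIn i₀ (transferPlan x z₀ η) t z = V.linkIn i₀ x t z
  | 0, _ => by funext k; cases k <;> rfl
  | t + 1, z => by
    funext k
    exact congrFun (linkOut_transferPlan t (H.prev t z)) k

lemma transferPlan_of_ne {z : H.Z 0} (h : z ≠ z₀) : transferPlan x z₀ η 0 z = x 0 z := by
  simp [transferPlan, h]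

lemma transferPlan_self : transferPlan x z₀ η 0 z₀ = transfer (x 0 z₀) η := by
  simp [transferPlan]

lemma welfare_term_zero (E : Economy) (y : Plan H) (z : H.Z 0) :
    ∫ z', E.felicity (y 0 z') ∂(H.law 0 z) = E.felicity (y 0 z) := by
  simp [law, Kernel.id_apply]

lemma welfareDefined_transferPlan (hx : WelfareDefined E x) :
    WelfareDefined E (transferPlan x z₀ η) := by
  intro z
  obtain ⟨h1, h2⟩ := hx z
  refine ⟨fun t => ?_, ?_⟩
  · cases t with
    | zero =>
      simp only [law, Kernel.id_apply]
      exact integrable_dirac (by simp)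
    | succ t => exact h1 (t + 1)
  · rw [← summable_nat_add_iff 1] at h2 ⊢
    exact h2

/-- The date-0 law is a point mass and later dates are untouched, so only the first term of the
welfare sum moves. -/
lemma welfare_transferPlan (hx : WelfareDefined E x) :
    welfare E (transferPlan x z₀ η) z₀ =
    welfare E x z₀ + (E.felicity (transfer (x 0 z₀) η) - E.felicity (x 0 z₀)) := by
  rw [welfare, welfare, (hx z₀).2.tsum_eq_zero_add,
    (welfareDefined_transferPlan hx z₀).2.tsum_eq_zero_add, welfare_term_zero, welfare_term_zero,
    transferPlan_self]
  simp only [transferPlan]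
  ring

/-- Outside the banker's Euler condition, date-0 consumption of bankers and entrepreneurs enters
only through its sum. -/
lemma con_transfer (r : Regime) (ν : Node) (s : Link → ℝ) (w : Ctl → ℝ) (e : Slot → ℝ) {i : Cnstr}
    (h1 : i ≠ .loan1) (h2 : i ≠ .loan2) : E.con r ν s (transfer w η) e i = E.con r ν s w e i := by
  cases i <;> first
    | exact absurd rfl h1 | exact absurd rfl h2
    | (cases r <;> simp [con, transfer, revenue, output, R] <;> ring)

/-- Positive deposits remove the requirement `G = 0`, and a binding leverage constraint makes the
complementarity constraint hold for every `G`. What remains is `G ≥ 0` and positivity. -/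
lemma feasible_transferPlan {r : Regime} (hf : V.Feasible i₀ r x) (hD : 0 < x 0 z₀ .D)
    (hlev : V.conVal i₀ r x 0 z₀ .lev = 0) (hb : 0 < x 0 z₀ .Cb + η) (he : 0 < x 0 z₀ .Ce - η)
    (hG : 0 ≤ E.loanGap (transfer (x 0 z₀) η) (V.exps x 0 z₀)) :
    V.Feasible i₀ r (transferPlan x z₀ η) := by
  have hcon (t : ℕ) (z : H.Z t) (i : Cnstr) (h1 : i ≠ .loan1) (h2 : i ≠ .loan2) :
      V.conVal i₀ r (transferPlan x z₀ η) t z i = V.conVal i₀ r x t z i := by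
    rw [conVal, conVal, linkIn_transferPlan, exps_transferPlan]
    cases t with
    | zero =>
      by_cases hz : z = z₀
      · subst hz; rw [transferPlan_self, con_transfer r _ _ _ _ h1 h2]
      · rw [transferPlan_of_ne hz]
    | succ t => rfl
  have hsucc (t : ℕ) (z : H.Z (t + 1)) (i : Cnstr) :
      V.conVal i₀ r (transferPlan x z₀ η) (t + 1) z i = V.conVal i₀ r x (t + 1) z i := by
    rw [conVal, conVal, linkIn_transferPlan, exps_transferPlan]; rfl
  have hother (z : H.Z 0) (hz : z ≠ z₀) (i : Cnstr) :
      V.conVal i₀ r (transferPlan x z₀ η) 0 z i = V.conVal i₀ r x 0 z i := by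
    rw [conVal, conVal, linkIn_transferPlan, exps_transferPlan, transferPlan_of_ne hz]
  have hself : V.conVal i₀ r (transferPlan x z₀ η) 0 z₀ .loan1 =
      E.loanGap (transfer (x 0 z₀) η) (V.exps x 0 z₀) := by
    rw [conVal, linkIn_transferPlan, exps_transferPlan, transferPlan_self]; rfl
  refine ⟨fun t a => ?_, fun t z a ha => ?_, fun t z => ?_, fun t z => ?_, fun t z j => ?_,
    welfareDefined_transferPlan hf.welfare_def, fun t z => ?_, fun t z => ?_, fun t z h0 => ?_,
    fun t z => ?_, fun t z => ?_, fun t z => ?_, fun t z => ?_, fun t z => ?_⟩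
  · cases t with
    | zero =>
      classical
      -- Changing the plan at a single history preserves measurability because singletons are
      -- measurable.
      have h : Measurable fun z => if z = z₀ then transfer (x 0 z₀) η a else x 0 z a :=
        Measurable.ite (measurableSet_singleton z₀) measurable_const (hf.meas 0 a)
      convert h using 2 with z
      by_cases hz : z = z₀
      · subst hz; simp [transferPlan_self]
      · simp [transferPlan_of_ne hz, hz]
    | succ t => exact hf.meas (t + 1) a
  · cases t with
    | zero =>
      by_cases hz : z = z₀
      · subst hz
        rw [transferPlan_self]
        cases a
        case Cb => exact hb
        case Ce => exact he
        all_goals exact hf.pos 0 z _ ha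
      · rw [transferPlan_of_ne hz]; exact hf.pos 0 z a ha
    | succ t => exact hf.pos (t + 1) z a ha
  · rw [transferPlan_apply_of_ne (by decide) (by decide)]; exact hf.D_nonneg t z
  · rw [transferPlan_apply_of_ne (by decide) (by decide), linkIn_transferPlan]; exact hf.inv t z
  · have h := hf.slot_int t z j
    have hk := transferPlan_apply_of_ne (x := x) (z₀ := z₀) (η := η) (a := .K) (by decide) (by decide) t z
    cases j <;> simp only [slotFn, hk] <;> exact h
  · rw [hcon _ _ _ (by decide) (by decide)]; exact hf.lev t z
  · cases t with
    | zero =>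
      by_cases hz : z = z₀
      · subst hz; rw [hself]; exact hG
      · rw [hother z hz]; exact hf.loan1 0 z
    | succ t => rw [hsucc]; exact hf.loan1 _ z
  · rw [transferPlan_apply_of_ne (by decide) (by decide)] at h0
    cases t with
    | zero =>
      by_cases hz : z = z₀
      · subst hz; exact absurd h0 hD.ne'
      · rw [hother z hz]; exact hf.loan1_eq 0 z h0
    | succ t => rw [hsucc]; exact hf.loan1_eq _ z h0
  · cases t with
    | zero =>
      by_cases hz : z = z₀
      · subst hz
        change _ * V.conVal i₀ r (transferPlan x z η) 0 z .lev = 0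
        rw [hcon _ _ _ (by decide) (by decide), hlev, mul_zero]
      · rw [hother z hz]; exact hf.loan2 0 z
    | succ t => rw [hsucc]; exact hf.loan2 _ z
  · rw [hcon _ _ _ (by decide) (by decide)]; exact hf.bud t z
  · rw [hcon _ _ _ (by decide) (by decide)]; exact hf.col t z
  · rw [hcon _ _ _ (by decide) (by decide)]; exact hf.res t z
  · rw [hcon _ _ _ (by decide) (by decide)]; exact hf.om t z

/-- If the leverage constraint binds and the banker's Euler condition for loans is slack at an initial
history, then a constrained efficient allocation equalizes weighted marginal utilities there. -/
theorem IsCEA.marginal_utilities_eq {r : Regime} (hx : V.IsCEA i₀ r x) (hD : 0 < x 0 z₀ .D)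
    (hlev : V.conVal i₀ r x 0 z₀ .lev = 0) (hG : 0 < V.conVal i₀ r x 0 z₀ .loan1) :
    E.ωb * E.UbC (x 0 z₀ .Cb) = E.ωe * E.UeC (x 0 z₀ .Ce) := by
  obtain ⟨hf, hmax⟩ := hx
  have hb : 0 < x 0 z₀ .Cb := hf.pos 0 z₀ _ (by simp)
  have he : 0 < x 0 z₀ .Ce := hf.pos 0 z₀ _ (by simp)
  have hib : HasDerivAt (fun η : ℝ => x 0 z₀ .Cb + η) 1 0 := (hasDerivAt_id' 0).const_add _
  have hie : HasDerivAt (fun η : ℝ => x 0 z₀ .Ce - η) (-1) 0 := (hasDerivAt_id' 0).const_sub _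
  have hder : HasDerivAt (fun η => E.felicity (transfer (x 0 z₀) η))
      (E.ωb * (E.UbC (x 0 z₀ .Cb) * 1) + E.ωe * (E.UeC (x 0 z₀ .Ce) * -1)) 0 := by
    have h1 : HasDerivAt E.Ub (E.UbC (x 0 z₀ .Cb)) (x 0 z₀ .Cb + 0) := by
      rw [add_zero]; exact E.hasDerivAt_Ub hb
    have h2 : HasDerivAt E.Ue (E.UeC (x 0 z₀ .Ce)) (x 0 z₀ .Ce - 0) := by
      rw [sub_zero]; exact E.hasDerivAt_Ue he
    exact (((h1.comp (0 : ℝ) hib).const_mul E.ωb).add ((h2.comp (0 : ℝ) hie).const_mul E.ωe)).add_const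
      (E.ωw * E.Uw (x 0 z₀ .Cw) (x 0 z₀ .N))
  -- The strict inequalities `G > 0`, `Cb > 0` and `Ce > 0` survive small transfers of either sign,
  -- so optimality makes `η = 0` an interior maximum of date-0 felicity.
  have hloc : IsLocalMax (fun η => E.felicity (transfer (x 0 z₀) η)) 0 := by
    have hcG : ContinuousAt (fun η => E.loanGap (transfer (x 0 z₀) η) (V.exps x 0 z₀)) 0 := by
      have h1 : ContinuousAt E.UbC (x 0 z₀ .Cb + 0) := by
        rw [add_zero]; exact (E.hasDerivAt_UbC hb).continuousAt
      exact ((ContinuousAt.comp (f := fun η : ℝ => x 0 z₀ .Cb + η) (x := 0) h1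
        hib.continuousAt).mul continuousAt_const).sub continuousAt_const
    have ht0 : transfer (x 0 z₀) 0 = x 0 z₀ := by
      funext a; cases a <;> simp [transfer]
    have e1 := hib.continuousAt.eventually (lt_mem_nhds (show 0 < x 0 z₀ .Cb + 0 by simpa))
    have e2 := hie.continuousAt.eventually (lt_mem_nhds (show 0 < x 0 z₀ .Ce - 0 by simpa))
    have e3 := hcG.eventually (lt_mem_nhds (show 0 < E.loanGap (transfer (x 0 z₀) 0) (V.exps x 0 z₀) by
      rw [ht0]; exact hG))
    filter_upwards [e1, e2, e3] with η h1 h2 h3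
    have h4 := hmax _ (feasible_transferPlan hf hD hlev h1 h2 h3.le) z₀
    rw [welfare_transferPlan hf.welfare_def] at h4
    rw [ht0]
    linarith
  have := hloc.hasDerivAt_eq_zero hder
  linarith

namespace IsRegulatedCE

variable {M : Market H} {T : Taxes H}

/-- A positive private multiplier makes leverage bind, so `D = (1 - κ) L > 0`, and it makes the loan
gap `M.lb (1 - κ) L` strictly positive. These are the conditions under which transfers are feasible.
-/
theorem not_isCEA (hL : 0 < i₀.L) (hM : V.IsRegulatedCE i₀ M T) (hlb : 0 < M.lb 0 z₀)
    (hκ : (V.node 0 z₀).κ < 1)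
    (hne : E.ωb * E.UbC (M.Cb 0 z₀) ≠ E.ωe * E.UeC (M.Ce 0 z₀)) :
    ¬ V.IsCEA i₀ .sticky M.plan := by
  intro hx
  have hf := hx.1
  have hLpos : 0 < M.L 0 z₀ := hM.pos _ (by simp) 0 z₀
  have hlev : V.conVal i₀ .sticky M.plan 0 z₀ .lev = 0 :=
    (mul_eq_zero.1 (hM.lb_slack 0 z₀)).resolve_left hlb.ne'
  have hD : 0 < M.D 0 z₀ := by
    have h : (1 - (V.node 0 z₀).κ) * M.L 0 z₀ - M.D 0 z₀ = 0 := hlev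
    have h2 := mul_pos (sub_pos.2 hκ) hLpos
    linarith
  have hG : V.conVal i₀ .sticky M.plan 0 z₀ .loan1 =
      M.lb 0 z₀ * (1 - (V.node 0 z₀).κ) * M.L 0 z₀ := by
    rw [hf.loan1_eq_mul]
    simp only [hM.RLp_eq hL]
    change (E.UbC (M.Cb 0 z₀) - E.βb * H.EX 0 (fun z' => E.UbC (M.Cb 1 z') * M.RL 1 z') z₀)
      * M.L 0 z₀ = _
    linear_combination M.L 0 z₀ * hM.loans 0 z₀
  refine hne (hx.marginal_utilities_eq hD hlev ?_)
  rw [hG]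
  exact mul_pos (mul_pos hlb (sub_pos.2 hκ)) hLpos

end IsRegulatedCE

/-! ## Wedges along competitive equilibria -/

section

variable {M : Market H} {l : Mult H} {t : ℕ} {z : H.Z t}

/-- This and the next comparisons subtract the market optimality condition from the planner's
condition for the same margin. The labor margin carries no private multiplier, so nothing is left
over. -/
lemma IsCE.ΨN_eq_zero (hK : 0 < i₀.K) (hM : V.IsCE i₀ M) (h : V.LaborCondition i₀ M.plan l t z) :
    V.ΨN i₀ M.plan l t z = 0 := by
  have h1 := hM.1.labor_demand t z
  have h2 := hM.1.labor_supply t z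
  rw [LaborCondition, hM.1.Pwp_eq hK, AFN, ← IsRegulatedCE.lag_K] at h
  have h3 : Wp E M.plan t z = M.W t z := h2.symm
  have h4 : (1 + 0) * M.W t z = _ := h1
  rw [h3] at h
  change _ = M.Pw t z * ((V.node t z).A * E.FN ((V.node t z).ξ * H.lag M.K i₀.K t z) (M.N t z)) + _ at h
  linear_combination h4 - h

lemma IsCE.ΨD_eq (hM : V.IsCE i₀ M) (h : V.DepositCondition i₀ M.plan l t z) (hD : 0 < M.D t z) :
    V.ΨD i₀ M.plan l t z = M.lb t z - l t z .lev / E.ωb := by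
  have h1 := h.2 hD
  have h2 := hM.2 t z
  rw [hM.1.Rp_eq] at h1
  change E.UbC (M.Cb t z) = E.βb * M.R t z * H.EX t (fun z' => E.UbC (M.Cb (t + 1) z')) z + _ + _ at h1
  linear_combination h2 - h1

lemma IsCE.ΨL_eq (hL : 0 < i₀.L) (hM : V.IsCE i₀ M) (h : V.LoanCondition i₀ M.plan l t z) :
    V.ΨL i₀ M.plan l t z = (M.le t z - l t z .col / E.ωe) *
      H.EX t (fun z' => V.RLp i₀ M.plan (t + 1) z') z := by
  have h1 : E.UeC (M.Ce t z) * (1 - 0) = _ := hM.1.loan_demand t z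
  rw [LoanCondition] at h
  simp only [hM.1.RLp_eq hL] at h ⊢
  change E.UeC (M.Ce t z)
    = E.βe * H.EX t (fun z' => E.UeC (M.Ce (t + 1) z') * M.RL (t + 1) z') z + _ + _ at h
  linear_combination h1 - h

lemma IsRegulatedCE.capPay_eq {T : Taxes H} (hK : 0 < i₀.K) (hM : V.IsRegulatedCE i₀ M T) :
    V.capPay i₀ M.plan t z = (M.Pw t z * (V.node t z).A *
      E.FK ((V.node t z).ξ * H.lag M.K i₀.K t z) (M.N t z) + M.Q t z * (1 - E.δ)) * (V.node t z).ξ := by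
  rw [capPay, hM.Pwp_eq hK, hM.Qp_eq hK, AFK, ← IsRegulatedCE.lag_K, mul_assoc (M.Pw t z)]
  rfl

lemma IsCE.ΨK_eq (hK : 0 < i₀.K) (hM : V.IsCE i₀ M) (h : V.CapitalCondition i₀ M.plan l t z) :
    V.ΨK i₀ M.plan l t z = (M.le t z - l t z .col / E.ωe) * (V.node t z).m *
      H.EX t (fun z' => V.Qp i₀ M.plan (t + 1) z' * (V.node (t + 1) z').ξ) z := by
  have h1 : E.UeC (M.Ce t z) * (1 + 0) * M.Q t z = _ := hM.1.capital_demand t z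
  rw [CapitalCondition] at h
  simp only [hM.1.Qp_eq hK, hM.1.capPay_eq hK] at h ⊢
  have hue (t : ℕ) (z : H.Z t) : ue E M.plan t z = E.UeC (M.Ce t z) := rfl
  simp only [mul_assoc, hue] at h h1 ⊢
  linear_combination h1 - h

end

end Env

/-! ### Measurability of expectations, lags and primitives -/

lemma Histories.measurable_EX {H : Histories.{u}} {t : ℕ} {f : H.Z (t + 1) → ℝ} (hf : Measurable f) :
    Measurable (H.EX t f) :=
  (hf.stronglyMeasurable.integral_kernel (κ := H.ker t)).measurable

lemma Histories.measurable_lag {H : Histories.{u}} {X : H.Proc} (hX : ∀ t, Measurable (X t)) (c : ℝ) :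
    ∀ t, Measurable (H.lag X c t)
  | 0 => measurable_const
  | t + 1 => (hX t).comp (H.prev_meas t)

namespace Economy

variable (E : Economy) {Ω : Type*} [MeasurableSpace Ω]

lemma measurable_UbC : Measurable E.UbC := measurable_deriv E.Ub
lemma measurable_UbCC : Measurable E.UbCC := measurable_deriv E.UbC
lemma measurable_UeC : Measurable E.UeC := measurable_deriv E.Ue

lemma measurable_Φinv_comp {y : Ω → ℝ} (hy : Measurable y) (h : ∀ ω, y ω ∈ E.Φ '' Ioi 0) :
    Measurable fun ω => E.Φinv (y ω) :=
  ContinuousOn.measurable_comp' (fun _ hy => (E.continuousAt_Φinv hy).continuousWithinAt) hy h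

lemma measurable_capPrice_comp {y : Ω → ℝ} (hy : Measurable y) (h : ∀ ω, y ω ∈ E.Φ '' Ioi 0) :
    Measurable fun ω => E.capPrice (y ω) :=
  ((measurable_deriv E.Φ).comp (E.measurable_Φinv_comp hy h)).inv

lemma measurable_capPrice'_comp {y : Ω → ℝ} (hy : Measurable y) (h : ∀ ω, y ω ∈ E.Φ '' Ioi 0) :
    Measurable fun ω => E.capPrice' (y ω) := by
  have h1 := (measurable_deriv E.Φ).comp (E.measurable_Φinv_comp hy h)
  have h2 := (measurable_deriv (deriv E.Φ)).comp (E.measurable_Φinv_comp hy h)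
  exact (h2.mul h1.inv).neg.div (h1.pow_const 2)

lemma measurable_of_continuousOn_pos2 {f : ℝ → ℝ → ℝ} (hf : ContinuousOn (fun p : ℝ × ℝ => f p.1 p.2) pos2)
    {c n : Ω → ℝ} (hc : Measurable c) (hn : Measurable n) (hc0 : ∀ ω, 0 < c ω) (hn0 : ∀ ω, 0 < n ω) :
    Measurable fun ω => f (c ω) (n ω) :=
  ContinuousOn.measurable_comp' (g := fun ω => (c ω, n ω)) hf (hc.prodMk hn) fun ω => ⟨hc0 ω, hn0 ω⟩

end Economy

namespace Env

open Economy Histories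

variable {E : Economy} {H : Histories.{u}} {V : Env E H} {i₀ : Init} {r : Regime} {x : Plan H}
  {l : Mult H}

/-! ## Measurability of prices and wedges -/

namespace Feasible

variable (hK : 0 < i₀.K) (hf : V.Feasible i₀ r x) (t : ℕ)
include hf

lemma meas_Klag : Measurable (V.Klag i₀ x t) := by
  cases t with
  | zero => exact measurable_const
  | succ t => exact (hf.meas t .K).comp (H.prev_meas t)

lemma meas_Llag : Measurable (Llag i₀ x t) := measurable_lag (fun t => hf.meas t .L) _ t

lemma meas_ub : Measurable (ub E x t) := E.measurable_UbC.comp (hf.meas t .Cb)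
lemma meas_ubb : Measurable (ubb E x t) := E.measurable_UbCC.comp (hf.meas t .Cb)
lemma meas_ue : Measurable (ue E x t) := E.measurable_UeC.comp (hf.meas t .Ce)

lemma meas_comp_pos2 {f : ℝ → ℝ → ℝ} (h : ContinuousOn (fun p : ℝ × ℝ => f p.1 p.2) pos2) :
    Measurable fun z => f (x t z .Cw) (x t z .N) :=
  measurable_of_continuousOn_pos2 h (hf.meas t .Cw) (hf.meas t .N)
    (fun z => hf.pos t z _ (by simp)) (fun z => hf.pos t z _ (by simp))

lemma meas_uw : Measurable (uw E x t) := hf.meas_comp_pos2 t E.contDiffOn_UwC.continuousOn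

lemma meas_Wp : Measurable (Wp E x t) := hf.meas_comp_pos2 t E.contDiffOn_W.continuousOn

lemma meas_Rp : Measurable (V.Rp x t) :=
  (hf.meas_uw t).div ((measurable_EX (hf.meas_uw (t + 1))).const_mul E.β)

lemma meas_linkIn_RD : Measurable fun z => V.linkIn i₀ x t z .RD := by
  cases t with
  | zero => exact measurable_const
  | succ t => exact ((hf.meas_Rp t).mul (hf.meas t .D)).comp (H.prev_meas t)

lemma meas_RLp : Measurable (V.RLp i₀ x t) :=
  ((((hf.meas t .Cb).add (hf.meas t .L)).sub (hf.meas t .D)).add (hf.meas_linkIn_RD t)).div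
    (hf.meas_Llag t)

lemma meas_growth : Measurable fun z =>
    x t z .K / V.Klag i₀ x t z - (1 - E.δ) * (V.node t z).ξ :=
  ((hf.meas t .K).div (hf.meas_Klag t)).sub ((V.ξ_meas t).const_mul _)

lemma meas_Ip : Measurable (V.Ip i₀ x t) :=
  (hf.meas_Klag t).mul (E.measurable_Φinv_comp (hf.meas_growth t) (hf.inv t))

lemma meas_newK : Measurable (V.newK i₀ x t) :=
  (hf.meas t .K).sub (((V.ξ_meas t).const_mul _).mul (hf.meas_Klag t))

lemma meas_AFp : Measurable (V.AFp i₀ x t) :=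
  (V.A_meas t).mul ((((V.ξ_meas t).mul (hf.meas_Klag t)).pow_const E.α).mul
    ((hf.meas t .N).pow_const (1 - E.α)))

lemma meas_AFN : Measurable (V.AFN i₀ x t) := by
  -- The marginal product is a derivative whose parameters vary with the history; the closed
  -- Cobb--Douglas formula shows it as a composition of powers.
  have : V.AFN i₀ x t = fun z => (V.node t z).A * (((V.node t z).ξ * V.Klag i₀ x t z) ^ E.α *
      ((1 - E.α) * x t z .N ^ (1 - E.α - 1))) := by
    funext z
    rw [AFN, E.FN_eq _ (hf.pos t z .N (by simp))]
  rw [this]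
  exact (V.A_meas t).mul ((((V.ξ_meas t).mul (hf.meas_Klag t)).pow_const E.α).mul
    (((hf.meas t .N).pow_const (1 - E.α - 1)).const_mul _))

lemma meas_Pwp : Measurable (V.Pwp i₀ x t) := by
  have h1 : Measurable fun z' => E.UwC (x (t + 1) z' .Cw) (x (t + 1) z' .N)
      * (V.node (t + 1) z').infl ^ E.ε * x (t + 1) z' .Om :=
    ((hf.meas_uw (t + 1)).mul ((V.infl_meas (t + 1)).pow_const _)).mul (hf.meas (t + 1) .Om)
  exact ((V.Δ_meas t).div (hf.meas_AFp t)).mul ((hf.meas t .Om).sub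
    (((measurable_EX h1).const_mul _).div (hf.meas_uw t)))

include hK

lemma meas_Qp : Measurable (V.Qp i₀ x t) := by
  have : V.Qp i₀ x t = fun z => E.capPrice (x t z .K / V.Klag i₀ x t z - (1 - E.δ) * (V.node t z).ξ) := by
    funext z; exact E.Q_eq _ _ (hf.Klag_pos hK t z)
  rw [this]
  exact E.measurable_capPrice_comp (hf.meas_growth t) (hf.inv t)

lemma meas_Q1p : Measurable (V.Q1p i₀ x t) := by
  have : V.Q1p i₀ x t = fun z => E.capPrice' (x t z .K / V.Klag i₀ x t z - (1 - E.δ) * (V.node t z).ξ)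
      * (-x t z .K / V.Klag i₀ x t z ^ 2) := by
    funext z; exact E.Q1_eq (hf.Klag_pos hK t z) (hf.inv t z)
  rw [this]
  exact (E.measurable_capPrice'_comp (hf.meas_growth t) (hf.inv t)).mul
    ((hf.meas t .K).neg.div ((hf.meas_Klag t).pow_const 2))

lemma meas_Q2p : Measurable (V.Q2p i₀ x t) := by
  have : V.Q2p i₀ x t = fun z => E.capPrice' (x t z .K / V.Klag i₀ x t z - (1 - E.δ) * (V.node t z).ξ)
      * (1 / V.Klag i₀ x t z) := by
    funext z; exact E.Q2_eq (hf.Klag_pos hK t z) (hf.inv t z)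
  rw [this]
  exact (E.measurable_capPrice'_comp (hf.meas_growth t) (hf.inv t)).mul
    ((hf.meas_Klag t).const_div 1)

lemma meas_AFK : Measurable (V.AFK i₀ x t) := by
  have : V.AFK i₀ x t = fun z => (V.node t z).A * (E.α * ((V.node t z).ξ * V.Klag i₀ x t z) ^ (E.α - 1) *
      x t z .N ^ (1 - E.α)) := by
    funext z
    rw [AFK, E.FK_eq _ (mul_pos (V.ξ_pos t z) (hf.Klag_pos hK t z))]
  rw [this]
  exact (V.A_meas t).mul (((((V.ξ_meas t).mul (hf.meas_Klag t)).pow_const _).const_mul _).mul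
    ((hf.meas t .N).pow_const _))

lemma meas_capPay : Measurable (V.capPay i₀ x t) :=
  (((hf.meas_Pwp t).mul (hf.meas_AFK hK t)).add ((hf.meas_Qp hK t).mul_const _)).mul (V.ξ_meas t)

omit hK
variable (hl : ∀ t i, Measurable fun z => l t z i)
include hl

lemma meas_lamL : Measurable (V.lamL x l t) :=
  (hl t .loan1).add ((hl t .loan2).mul ((((V.κ_meas t).const_sub 1).mul (hf.meas t .L)).sub
    (hf.meas t .D)))

lemma meas_ΨD : Measurable (V.ΨD i₀ x l t) := by
  have a1 := hf.meas_Rp t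
  have a2 := measurable_EX ((hf.meas_ub (t + 1)).const_mul E.ωb)
  have a3 := measurable_EX (hl (t + 1) .res)
  have a4 := measurable_EX ((hf.meas_ub (t + 1)).mul (hf.meas_RLp (t + 1)))
  have a5 := measurable_EX ((hf.meas_ubb (t + 1)).mul (hf.meas_RLp (t + 1)))
  have a6 := measurable_EX (((hf.meas_lamL (t + 1) hl).mul (hf.meas_ubb (t + 1))).mul
    (hf.meas (t + 1) .L))
  have a7 := measurable_lag (fun t => hf.meas_lamL t hl) 0 t
  exact (((((((a1.const_mul _).mul a2).add ((hl t .res).sub ((a1.const_mul _).mul a3))).add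
    (((hl t .loan2).mul ((hf.meas_ub t).sub (a4.const_mul _))).mul (hf.meas t .L))).sub
    (((hf.meas_lamL t hl).mul ((hf.meas_ubb t).add ((a1.const_mul _).mul a5))).mul (hf.meas t .L))).add
    ((a1.const_mul _).mul a6)).add
    (((((a7.const_mul _).mul_const _).mul (hf.meas_ubb t)).mul (hf.meas_RLp t)).mul
      (hf.meas_Llag t))).const_mul _

lemma meas_ΨLpos : Measurable (V.ΨLpos i₀ x l t) := by
  have a1 := hf.meas_Rp t
  have a2 := measurable_EX (((hf.meas_ue (t + 1)).const_mul E.ωe).mul (hf.meas_RLp (t + 1)))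
  have a3 := measurable_EX (hl (t + 1) .res)
  have a4 := measurable_EX (hf.meas_ub (t + 1))
  have a6 := measurable_lag (fun t => hf.meas_lamL t hl) 0 t
  have a7 := measurable_lag (fun t => hl t .col) 0 t
  -- The integrand also depends on the date-`t` history. Replacing `z` by `H.prev t z'` leaves the
  -- expectation unchanged and gives a function of `z'` alone; the same device is used for the other
  -- wedges.
  have a5 : Measurable fun z => H.EX t (fun z' => (E.β * E.ωe * ue E x (t + 1) z' + l t z .col)
      * (V.RLp i₀ x (t + 1) z' - V.Rp x t z)) z := by
    have h : Measurable fun z' => (E.β * E.ωe * ue E x (t + 1) z' + l t (H.prev t z') .col)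
        * (V.RLp i₀ x (t + 1) z' - V.Rp x t (H.prev t z')) :=
      (((hf.meas_ue (t + 1)).const_mul _).add ((hl t .col).comp (H.prev_meas t))).mul
        ((hf.meas_RLp (t + 1)).sub (a1.comp (H.prev_meas t)))
    convert measurable_EX h using 2 with z
    exact EX_congr fun z' hz => by rw [hz]
  have aκ : Measurable fun z => 1 - (V.node t z).κ := (V.κ_meas t).const_sub 1
  exact (((((a2.const_mul _).sub a5).add ((hl t .res).sub ((a1.const_mul _).mul a3))).sub
    ((hf.meas_lamL t hl).mul (((hf.meas_ub t).div aκ).sub ((a1.const_mul _).mul a4)))).add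
    ((((V.κ_meas t).div aκ).const_mul _).mul (((a6.mul_const _).mul (hf.meas_ub t)).add a7))).const_mul _

lemma meas_ΨLzero : Measurable (V.ΨLzero i₀ x l t) := by
  have m1 := (hf.meas_ubb (t + 1)).mul (hf.meas_RLp (t + 1))
  have a2 := measurable_EX (((hf.meas_ue (t + 1)).const_mul E.ωe).mul (hf.meas_RLp (t + 1)))
  have a3 : Measurable fun z => H.EX t (fun z' => (ubb E x (t + 1) z' * V.RLp i₀ x (t + 1) z' * x t z .L
      + ub E x (t + 1) z') * V.RLp i₀ x (t + 1) z') z := by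
    have h : Measurable fun z' => (ubb E x (t + 1) z' * V.RLp i₀ x (t + 1) z' * x t (H.prev t z') .L
        + ub E x (t + 1) z') * V.RLp i₀ x (t + 1) z' :=
      ((m1.mul ((hf.meas t .L).comp (H.prev_meas t))).add (hf.meas_ub (t + 1))).mul
        (hf.meas_RLp (t + 1))
    convert measurable_EX h using 2 with z
    exact EX_congr fun z' hz => by rw [hz]
  have a4 := measurable_EX ((((hf.meas_lamL (t + 1) hl).mul (hf.meas_ubb (t + 1))).mul
    (hf.meas (t + 1) .L)).mul (hf.meas_RLp (t + 1)))
  have a5 := measurable_EX (hf.meas_RLp (t + 1))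
  have a6 := measurable_lag (fun t => hf.meas_lamL t hl) 0 t
  exact (((((a2.const_mul _).add ((hf.meas_lamL t hl).mul ((((hf.meas_ubb t).mul (hf.meas t .L)).sub
    (hf.meas_ub t)).add (a3.const_mul _)))).sub (a4.const_mul _)).sub
    (((((a6.const_mul _).mul_const _).mul (hf.meas_ubb t)).mul (hf.meas_RLp t)).mul
      (hf.meas_Llag t))).sub (((hl t .col).const_mul _).mul a5)).const_mul _

lemma meas_ΨL : Measurable (V.ΨL i₀ x l t) := by
  classical
  have h : Measurable fun z => if 0 < x t z .D then V.ΨLpos i₀ x l t z else V.ΨLzero i₀ x l t z :=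
    Measurable.ite (measurableSet_lt measurable_const (hf.meas t .D)) (hf.meas_ΨLpos t hl)
      (hf.meas_ΨLzero t hl)
  convert h using 2 with z
  rw [ΨL]

lemma meas_ΨN : Measurable (V.ΨN i₀ x l t) := by
  have hN := hf.meas t .N
  have mWN := hf.meas_comp_pos2 t E.continuousOn_WN
  have mWC := hf.meas_comp_pos2 t E.continuousOn_WC
  have mCN := hf.meas_comp_pos2 t E.continuousOn_UwCN
  have mCC := hf.meas_comp_pos2 t E.continuousOn_UwCC
  have mb := hl t .bud
  have mu := (hf.meas_uw t).const_mul E.ωw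
  have me := (hf.meas_ue t).const_mul E.ωe
  have mP := hf.meas_Pwp t
  exact ((((((((me.add (((hl t .om).mul_const _).mul (V.P_meas t))).sub mb).mul
    (mP.mul (V.Δ_meas t)).inv).sub mu).sub mb).mul mP).mul (hf.meas_AFN t)).sub
    ((mb.mul mWN).mul hN)).div (mu.add mb) |>.sub ((mCN.div mCC).mul
    (((mu.sub me).add (mb.mul ((mWC.mul hN).const_sub 1))).div (mu.add mb)))

include hK

lemma meas_profitTerm : Measurable (V.profitTerm i₀ x l t) := by
  have h : Measurable fun z => V.Qp i₀ x t z * E.Φ (V.Ip i₀ x t z / V.Klag i₀ x t z) := by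
    -- `Φ` is composed with its own inverse here, so the value is the net growth rate of capital,
    -- whose measurability is elementary.
    have : (fun z => E.Φ (V.Ip i₀ x t z / V.Klag i₀ x t z)) =
        fun z => x t z .K / V.Klag i₀ x t z - (1 - E.δ) * (V.node t z).ξ := by
      funext z; exact E.Φ_Inv_div (hf.Klag_pos hK t z) (hf.inv t z)
    exact (hf.meas_Qp hK t).mul (this ▸ hf.meas_growth t)
  exact (hl t .res).mul (h.sub ((hf.meas_Ip t).div (hf.meas_Klag t)))

lemma meas_stickyTerm : Measurable (V.stickyTerm i₀ x l t) :=
  (((((((hf.meas_ue t).const_mul E.ωe).mul (((hf.meas_Pwp t).mul (V.Δ_meas t)).const_sub 1)).add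
    (((hl t .om).mul_const _).mul (V.P_meas t))).sub (hl t .bud)).div (V.Δ_meas t)).mul
    (hf.meas_AFK hK t)).mul (V.ξ_meas t)

lemma meas_ΨK : Measurable (V.ΨK i₀ x l t) := by
  have a1 : Measurable fun z => H.EX t (fun z' => E.ωe * ue E x (t + 1) z'
      * (V.capPay i₀ x (t + 1) z' / V.Qp i₀ x t z)) z := by
    have h : Measurable fun z' => E.ωe * ue E x (t + 1) z'
        * (V.capPay i₀ x (t + 1) z' / V.Qp i₀ x t (H.prev t z')) :=
      ((hf.meas_ue (t + 1)).const_mul _).mul ((hf.meas_capPay hK (t + 1)).div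
        ((hf.meas_Qp hK t).comp (H.prev_meas t)))
    convert measurable_EX h using 2 with z
    exact EX_congr fun z' hz => by rw [hz]
  have a2 := measurable_EX (hf.meas_profitTerm hK (t + 1) hl)
  have a3 := measurable_EX (((hl (t + 1) .bud).mul (hf.meas_Q1p hK (t + 1))).mul (hf.meas_newK (t + 1)))
  have a4 := measurable_EX ((hf.meas_Q1p hK (t + 1)).mul (V.ξ_meas (t + 1)))
  have a5 := measurable_lag (X := fun s y => l s y .col * (V.node s y).m)
    (fun t => (hl t .col).mul (V.m_meas t)) 0 t
  have a6 := measurable_EX (hf.meas_stickyTerm hK (t + 1) hl)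
  exact ((((((((a1.const_mul _).mul (hf.meas_Qp hK t)).add (a2.const_mul _)).sub
    (((hl t .bud).mul (hf.meas_Q2p hK t)).mul (hf.meas_newK t))).sub (a3.const_mul _)).add
    ((((hl t .col).mul (V.m_meas t)).mul a4).mul (hf.meas t .K))).add
    ((((a5.const_mul _).mul (hf.meas_Q2p hK t)).mul (V.ξ_meas t)).mul (hf.meas_Klag t))).add
    (a6.const_mul _)).const_mul _

end Feasible

end Env

namespace Env

open Economy Histories

variable {E : Economy} {H : Histories.{u}} {V : Env E H} {i₀ : Init} {x : Plan H} {l : Mult H}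

/-! ## Decentralization of constrained efficient allocations -/

/-- Prices, private multipliers and auxiliary variables supporting the plan `x`. -/
noncomputable def supportingMarket (V : Env E H) (i₀ : Init) (x : Plan H) (l : Mult H) : Market H where
  Cb := fun t z => x t z .Cb
  Ce := fun t z => x t z .Ce
  Cw := fun t z => x t z .Cw
  D := fun t z => x t z .D
  I := V.Ip i₀ x
  K := fun t z => x t z .K
  L := fun t z => x t z .L
  N := fun t z => x t z .N
  Y := fun t z => V.AFp i₀ x t z / (V.node t z).Δ
  Pw := V.Pwp i₀ x
  Q := V.Qp i₀ x
  R := V.Rp x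
  RL := V.RLp i₀ x
  W := Wp E x
  -- The private multiplier is read off the banker's Euler equation for loans, which no tax
  -- distorts; this is where `κ < 1` is needed.
  lb := fun t z => (ub E x t z
    - E.βb * H.EX t (fun z' => ub E x (t + 1) z' * V.RLp i₀ x (t + 1) z') z) / (1 - (V.node t z).κ)
  le := fun t z => l t z .col / E.ωe
  Om1 := fun t z => x t z .Om
  Om2 := fun t z => E.ε / (E.ε - 1) * x t z .Om / (V.node t z).P

lemma plan_supportingMarket : (V.supportingMarket i₀ x l).plan = x := by
  funext t z a; cases a <;> rfl

lemma lag_K_supportingMarket (t : ℕ) (z : H.Z t) :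
    H.lag (V.supportingMarket i₀ x l).K i₀.K t z = V.Klag i₀ x t z := by
  cases t <;> rfl

lemma linkIn_RD_eq_lag (t : ℕ) (z : H.Z t) : V.linkIn i₀ x t z .RD =
    H.lag (V.Rp x) i₀.R t z * H.lag (fun t z => x t z .D) i₀.D t z := by
  cases t <;> rfl

/-- Each tax moves a wedge to the other side of the private condition for that margin, and rebates
leave the budgets unchanged. The banker's multiplier inherits sign and slackness from the
constraints on `G`; the entrepreneur's multiplier is `λᵉ / ω_e` and inherits them from the planner's
conditions. -/
theorem isRegulatedCE_supportingMarket (hK : 0 < i₀.K) (hL : 0 < i₀.L) (hωe : 0 < E.ωe)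
    (hf : V.Feasible i₀ .sticky x) (hl : V.IsMultiplier i₀ .sticky x l)
    (hκ : ∀ t z, (V.node t z).κ < 1)
    (hF : V.FinancialIntegrable i₀ x l) (hR : V.RealIntegrable i₀ x l)
    (hDep : ∀ t z, V.DepositCondition i₀ x l t z) (hLoan : ∀ t z, V.LoanCondition i₀ x l t z)
    (hLab : ∀ t z, V.LaborCondition i₀ x l t z) (hCap : ∀ t z, V.CapitalCondition i₀ x l t z) :
    V.IsRegulatedCE i₀ (V.supportingMarket i₀ x l) (V.ceaTaxes i₀ x l) := by
  have hc (t : ℕ) (z : H.Z t) : 0 < x t z .Cw := hf.pos t z _ (by simp)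
  have hn (t : ℕ) (z : H.Z t) : 0 < x t z .N := hf.pos t z _ (by simp)
  have huw (t : ℕ) (z : H.Z t) : 0 < uw E x t z := E.UwC_pos (hc t z) (hn t z)
  have hub := hf.ub_pos
  have hue (t : ℕ) (z : H.Z t) : 0 < ue E x t z := E.UeC_pos (hf.pos t z _ (by simp))
  have hW (t : ℕ) (z : H.Z t) : 0 < Wp E x t z := E.W_pos (hc t z) (hn t z)
  have hQ := hf.Qp_pos hK
  have hAF := hf.AFp_pos hK
  have hkpos := hf.Klag_pos hK
  have hLl := Llag_pos i₀ hL hf.L_pos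
  have hε := E.ε_gt
  have hε1 : 0 < E.ε - 1 := by linarith
  have hε0 : 0 < E.ε := by linarith
  have hκ' (t : ℕ) (z : H.Z t) : 1 - (V.node t z).κ ≠ 0 := (sub_pos.2 (hκ t z)).ne'
  have hm := hl.1
  have mEubRL (t : ℕ) := measurable_EX ((hf.meas_ub (t + 1)).mul (hf.meas_RLp (t + 1)))
  have mκ (t : ℕ) : Measurable fun z => 1 - (V.node t z).κ := (V.κ_meas t).const_sub 1
  have mτD (t : ℕ) : Measurable ((V.ceaTaxes i₀ x l).τD t) :=
    (hf.meas_ub t).inv.mul ((((hm t .lev).div_const _).sub (((hf.meas_ub t).sub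
      ((mEubRL t).const_mul _)).div (mκ t))).add (hf.meas_ΨD t hm))
  have mτN (t : ℕ) : Measurable ((V.ceaTaxes i₀ x l).τN t) := (hf.meas_ΨN t hm).neg.div (hf.meas_Wp t)
  have mτL (t : ℕ) : Measurable ((V.ceaTaxes i₀ x l).τL t) := (hf.meas_ΨL t hm).div (hf.meas_ue t)
  have mτK (t : ℕ) : Measurable ((V.ceaTaxes i₀ x l).τK t) :=
    (hf.meas_ΨK hK t hm).neg.div ((hf.meas_ue t).mul (hf.meas_Qp hK t))
  have eτD (t : ℕ) (z : H.Z t) : ub E x t z * (1 - (V.ceaTaxes i₀ x l).τD t z) = ub E x t z -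
      (l t z .lev / E.ωb - (V.supportingMarket i₀ x l).lb t z + V.ΨD i₀ x l t z) := by
    have h := (hub t z).ne'
    simp only [ceaTaxes, supportingMarket]
    rw [mul_sub, mul_one, mul_inv_cancel_left₀ h]
  have eint_mb (t : ℕ) (z : H.Z t) : H.HasEX t z (fun z' => uw E x (t + 1) z' *
      (V.node (t + 1) z').infl ^ (E.ε - 1) * (E.ε / (E.ε - 1) * x (t + 1) z' .Om / (V.node (t + 1) z').P))
      (E.ε / (E.ε - 1) * V.exps x t z .mb) :=
    ((hasEX (hf.slot_int t z .mb)).const_mul _).congr fun z' _ => by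
      simp only [slotFn, uw]; ring
  have eMU (t : ℕ) (z : H.Z t) (f : H.Z (t + 1) → ℝ) : H.EX t (fun z' => E.β * uw E x (t + 1) z'
      / uw E x t z * f z') z = E.β / uw E x t z * H.EX t (fun z' => uw E x (t + 1) z' * f z') z := by
    rw [← EX_mul_left]; exact EX_congr fun z' _ => by ring
  have hcapPay (t : ℕ) (z : H.Z t) : ((V.supportingMarket i₀ x l).Pw t z * (V.node t z).A *
      E.FK ((V.node t z).ξ * H.lag (V.supportingMarket i₀ x l).K i₀.K t z)
        ((V.supportingMarket i₀ x l).N t z)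
      + (V.supportingMarket i₀ x l).Q t z * (1 - E.δ)) * (V.node t z).ξ = V.capPay i₀ x t z := by
    rw [lag_K_supportingMarket, capPay, AFK, ← mul_assoc (V.Pwp i₀ x t z)]
    rfl
  have hG1 (t : ℕ) (z : H.Z t) : (V.supportingMarket i₀ x l).lb t z * (1 - (V.node t z).κ)
      * x t z .L = V.conVal i₀ .sticky x t z .loan1 := by
    rw [hf.loan1_eq_mul]
    simp only [supportingMarket]
    rw [div_mul_cancel₀ _ (hκ' t z)]
  have hcol (t : ℕ) (z : H.Z t) := hf.col_eq (t := t) (z := z) exps_price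
  exact {
    meas := by
      intro X hX t
      simp only [mem_insert_iff, mem_singleton_iff] at hX
      rcases hX with rfl | rfl | rfl | rfl | rfl | rfl | rfl | rfl | rfl | rfl | rfl | rfl | rfl | rfl |
        rfl | rfl | rfl | rfl | rfl | rfl | rfl | rfl | rfl | rfl
      · exact hf.meas t .Cb
      · exact hf.meas t .Ce
      · exact hf.meas t .Cw
      · exact hf.meas t .D
      · exact hf.meas_Ip t
      · exact hf.meas t .K
      · exact hf.meas t .L
      · exact hf.meas t .N
      · exact (hf.meas_AFp t).div (V.Δ_meas t)
      · exact hf.meas_Pwp t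
      · exact hf.meas_Qp hK t
      · exact hf.meas_Rp t
      · exact hf.meas_RLp t
      · exact hf.meas_Wp t
      · exact ((hf.meas_ub t).sub ((mEubRL t).const_mul _)).div (mκ t)
      · exact (hm t .col).div_const _
      · exact hf.meas t .Om
      · exact ((hf.meas t .Om).const_mul _).div (V.P_meas t)
      · exact mτD t
      · exact mτN t
      · exact mτL t
      · exact mτK t
      · exact (mτD t).mul (hf.meas t .D)
      · exact ((((mτK t).mul (hf.meas_Qp hK t)).mul (hf.meas t .K)).add
          (((mτN t).mul (hf.meas_Wp t)).mul (hf.meas t .N))).add ((mτL t).mul (hf.meas t .L))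
    pos := by
      intro X hX t z
      simp only [mem_insert_iff, mem_singleton_iff] at hX
      rcases hX with rfl | rfl | rfl | rfl | rfl | rfl | rfl | rfl | rfl
      · exact hf.pos t z _ (by simp)
      · exact hf.pos t z _ (by simp)
      · exact hf.pos t z _ (by simp)
      · exact E.Inv_pos (hkpos t z) (hf.inv t z)
      · exact hf.pos t z _ (by simp)
      · exact hf.pos t z _ (by simp)
      · exact hf.pos t z _ (by simp)
      · exact hf.pos t z _ (by simp)
      · exact div_pos (mul_pos (div_pos hε0 hε1) (hf.pos t z .Om (by simp))) (V.P_pos t z)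
    D_nonneg := hf.D_nonneg
    int_wMU := fun t z => hf.slot_int t z .wMU
    int_bMU := fun t z => hf.slot_int t z .bMU
    int_bRL := fun t z => hf.hasEX_ubRL.int
    int_RL := fun t z => hf.hasEX_RL.int
    int_Q := fun t z => integrable_congr (hf.slot_int t z .price) fun z' hz => by subst hz; rfl
    int_eRL := hF.ueRL
    int_eK := fun t z => integrable_congr (hR.capPay t z) fun z' _ => by
      rw [mul_assoc (E.UeC _), hcapPay]; rfl
    int_mc := fun t z => hf.slot_int t z .mc
    int_mb := fun t z => (eint_mb t z).int
    labor_supply := fun t z => rfl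
    worker_euler := by
      intro t z
      have h := EX_pos (hf.slot_int t z .wMU) fun z' => huw (t + 1) z'
      have e : H.EX t (fun z' => E.β * uw E x (t + 1) z' / uw E x t z) z =
          E.β / uw E x t z * H.EX t (fun z' => uw E x (t + 1) z') z := by
        simpa using eMU t z fun _ => 1
      change 1 = H.EX t (fun z' => E.β * uw E x (t + 1) z' / uw E x t z) z *
        (uw E x t z / (E.β * H.EX t (fun z' => uw E x (t + 1) z') z))
      rw [e]
      have h1 := (huw t z).ne'
      have h2 := E.β_pos.ne'
      have h3 : H.EX t (fun z' => uw E x (t + 1) z') z ≠ 0 := h.ne'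
      field_simp
    banker_budget := by
      intro t z
      have h := V.RLp_mul_Llag i₀ (hLl t z).ne'
      rw [linkIn_RD_eq_lag] at h
      change x t z .Cb + x t z .L = V.RLp i₀ x t z * Llag i₀ x t z
        - H.lag (V.Rp x) i₀.R t z * H.lag (fun t z => x t z .D) i₀.D t z
        + (1 - (V.ceaTaxes i₀ x l).τD t z) * x t z .D + (V.ceaTaxes i₀ x l).τD t z * x t z .D
      rw [h]; ring
    banker_rebate := fun t z => rfl
    leverage := fun t z => sub_nonneg.1 (hf.lev t z)
    deposits := by
      intro t z
      have h := (hDep t z).1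
      change ub E x t z * (1 - (V.ceaTaxes i₀ x l).τD t z) ≤
        E.βb * V.Rp x t z * H.EX t (fun z' => ub E x (t + 1) z') z + (V.supportingMarket i₀ x l).lb t z
      rw [eτD]; linarith
    deposits_eq := by
      intro t z hD
      have h := (hDep t z).2 hD
      change ub E x t z * (1 - (V.ceaTaxes i₀ x l).τD t z) =
        E.βb * V.Rp x t z * H.EX t (fun z' => ub E x (t + 1) z') z + (V.supportingMarket i₀ x l).lb t z
      rw [eτD]; linarith
    loans := by
      intro t z
      change ub E x t z = E.βb * H.EX t (fun z' => ub E x (t + 1) z' * V.RLp i₀ x (t + 1) z') z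
        + (ub E x t z - E.βb * H.EX t (fun z' => ub E x (t + 1) z' * V.RLp i₀ x (t + 1) z') z)
          / (1 - (V.node t z).κ) * (1 - (V.node t z).κ)
      rw [div_mul_cancel₀ _ (hκ' t z)]; ring
    lb_nonneg := by
      intro t z
      have h : 0 ≤ V.conVal i₀ .sticky x t z .loan1 := hf.loan1 t z
      rw [← hG1] at h
      exact nonneg_of_mul_nonneg_left (nonneg_of_mul_nonneg_left h (hf.L_pos t z))
        (sub_pos.2 (hκ t z))
    lb_slack := by
      intro t z
      -- Complementarity for the planner is complementarity for the private multiplier, as `G` is a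
      -- positive multiple of it.
      have h : V.conVal i₀ .sticky x t z .loan1 * ((1 - (V.node t z).κ) * x t z .L - x t z .D) = 0 :=
        hf.loan2 t z
      rw [← hG1] at h
      rcases mul_eq_zero.1 h with h | h
      · have h1 := (mul_eq_zero.1 h).resolve_right (hf.L_pos t z).ne'
        rw [(mul_eq_zero.1 h1).resolve_right (hκ' t z), zero_mul]
      · exact mul_eq_zero_of_right _ h
    ent_budget := by
      intro t z
      have h : V.conVal i₀ .sticky x t z .bud = 0 := hf.bud t z
      have h2 := V.RLp_mul_Llag i₀ (hLl t z).ne'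
      have h3 : V.Pwp i₀ x t z * V.AFp i₀ x t z = E.revenue .sticky (V.node t z) (V.linkIn i₀ x t z)
          (x t z) (V.exps x t z) := by
        rw [Pwp, div_mul_eq_mul_div, div_mul_cancel₀ _ (hAF t z).ne']; rfl
      change E.revenue .sticky (V.node t z) (V.linkIn i₀ x t z) (x t z) (V.exps x t z)
        - V.Qp i₀ x t z * (x t z .K - (1 - E.δ) * (V.node t z).ξ * V.Klag i₀ x t z)
        - Wp E x t z * x t z .N + x t z .D - V.linkIn i₀ x t z .RD - x t z .Cb - x t z .Ce = 0 at h
      change x t z .Ce + (1 + (V.ceaTaxes i₀ x l).τK t z) * V.Qp i₀ x t z * x t z .K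
          + (1 + (V.ceaTaxes i₀ x l).τN t z) * Wp E x t z * x t z .N
          + V.RLp i₀ x t z * Llag i₀ x t z
        = V.Pwp i₀ x t z * (V.node t z).A * E.F ((V.node t z).ξ *
            H.lag (V.supportingMarket i₀ x l).K i₀.K t z) (x t z .N)
          + V.Qp i₀ x t z * (1 - E.δ) * (V.node t z).ξ * H.lag (V.supportingMarket i₀ x l).K i₀.K t z
          + (1 - (V.ceaTaxes i₀ x l).τL t z) * x t z .L
          + ((V.ceaTaxes i₀ x l).τK t z * V.Qp i₀ x t z * x t z .K
            + (V.ceaTaxes i₀ x l).τN t z * Wp E x t z * x t z .N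
            + (V.ceaTaxes i₀ x l).τL t z * x t z .L)
      rw [lag_K_supportingMarket, mul_assoc (V.Pwp i₀ x t z) (V.node t z).A]
      rw [← h3] at h
      change V.Pwp i₀ x t z * ((V.node t z).A * E.F ((V.node t z).ξ * V.Klag i₀ x t z) (x t z .N))
        - _ - _ + _ - _ - _ - _ = 0 at h
      linear_combination h2 - h
    ent_rebate := fun t z => rfl
    collateral := by
      intro t z
      have h : 0 ≤ V.conVal i₀ .sticky x t z .col := hf.col t z
      rw [hcol] at h
      exact sub_nonneg.1 h
    labor_demand := by
      intro t z
      have h := hLab t z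
      have h1 := (hW t z).ne'
      rw [lag_K_supportingMarket, mul_assoc (Market.Pw _ t z)]
      change (1 + -V.ΨN i₀ x l t z / Wp E x t z) * Wp E x t z = V.Pwp i₀ x t z * V.AFN i₀ x t z
      rw [LaborCondition] at h
      field_simp
      linarith
    loan_demand := by
      intro t z
      have h := hLoan t z
      have h1 := (hue t z).ne'
      rw [LoanCondition] at h
      change ue E x t z * (1 - V.ΨL i₀ x l t z / ue E x t z) =
        E.βe * H.EX t (fun z' => ue E x (t + 1) z' * V.RLp i₀ x (t + 1) z') z
          + l t z .col / E.ωe * H.EX t (fun z' => V.RLp i₀ x (t + 1) z') z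
      rw [mul_sub, mul_one, mul_div_cancel₀ _ h1]
      linarith
    capital_demand := by
      intro t z
      have h := hCap t z
      have h1 := (hue t z).ne'
      have h2 := (hQ t z).ne'
      rw [CapitalCondition] at h
      simp only [mul_assoc (E.UeC _), hcapPay]
      change ue E x t z * ((1 + -V.ΨK i₀ x l t z / (ue E x t z * V.Qp i₀ x t z)) * V.Qp i₀ x t z) =
        E.βe * H.EX t (fun z' => ue E x (t + 1) z' * V.capPay i₀ x (t + 1) z') z
          + l t z .col / E.ωe * (V.node t z).m *
            H.EX t (fun z' => V.Qp i₀ x (t + 1) z' * (V.node (t + 1) z').ξ) z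
      have e : ue E x t z * ((1 + -V.ΨK i₀ x l t z / (ue E x t z * V.Qp i₀ x t z)) * V.Qp i₀ x t z) =
          ue E x t z * V.Qp i₀ x t z - V.ΨK i₀ x l t z := by
        field_simp
        ring
      rw [e]
      linarith
    le_nonneg := fun t z => div_nonneg (hl.2 t z).col_nonneg hωe.le
    le_slack := by
      intro t z
      have h := (hl.2 t z).col_slack
      rw [hcol] at h
      change l t z .col / E.ωe * _ = 0
      rw [div_mul_eq_mul_div, div_eq_zero_iff]
      exact Or.inl h
    capital_supply := by
      intro t z
      rw [lag_K_supportingMarket]; rfl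
    rel_price := by
      intro t z
      have h1 := (hf.pos t z .Om (by simp)).ne'
      have h2 := (V.P_pos t z).ne'
      change (V.node t z).P = E.ε / (E.ε - 1) *
        (x t z .Om / (E.ε / (E.ε - 1) * x t z .Om / (V.node t z).P))
      field_simp
    marginal_cost := by
      intro t z
      change x t z .Om = V.Pwp i₀ x t z * (V.AFp i₀ x t z / (V.node t z).Δ) + E.θ * H.EX t (fun z' =>
        E.β * uw E x (t + 1) z' / uw E x t z * (V.node (t + 1) z').infl ^ E.ε * x (t + 1) z' .Om) z
      simp only [mul_assoc (_ / _)]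
      rw [eMU, Pwp]
      simp only [← mul_assoc]
      change x t z .Om = (V.node t z).Δ / V.AFp i₀ x t z * (x t z .Om - E.β * E.θ * V.exps x t z .mc
        / uw E x t z) * (V.AFp i₀ x t z / (V.node t z).Δ) + E.θ * (E.β / uw E x t z)
          * V.exps x t z .mc
      have h1 := (hAF t z).ne'
      have h2 := (V.Δ_pos t z).ne'
      have h3 := (huw t z).ne'
      field_simp
      ring
    marginal_benefit := by
      intro t z
      change E.ε / (E.ε - 1) * x t z .Om / (V.node t z).P = V.AFp i₀ x t z / (V.node t z).Δ
        + E.θ * H.EX t (fun z' => E.β * uw E x (t + 1) z' / uw E x t z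
          * (V.node (t + 1) z').infl ^ (E.ε - 1)
          * (E.ε / (E.ε - 1) * x (t + 1) z' .Om / (V.node (t + 1) z').P)) z
      simp only [mul_assoc (E.β * _ / _)]
      rw [eMU]
      simp only [← mul_assoc]
      rw [(eint_mb t z).eq]
      -- The recursion for `Ω₂` is the planner's constraint on `Ω₁` multiplied by `ε / ((ε - 1) P)`.
      have h : (E.ε - 1) / E.ε * (V.node t z).P * ((V.node t z).A / (V.node t z).Δ)
          * E.F ((V.node t z).ξ * V.Klag i₀ x t z) (x t z .N) - x t z .Om
          + E.β * E.θ * ((V.node t z).P * V.exps x t z .mb) / uw E x t z = 0 := hf.om t z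
      rw [AFp]
      have h1 := (V.P_pos t z).ne'
      have h2 := (V.Δ_pos t z).ne'
      have h3 := (huw t z).ne'
      field_simp
      field_simp at h
      linear_combination -h
    clear_K := by
      intro t z
      rw [lag_K_supportingMarket]
      have h := E.Φ_Inv_div (hkpos t z) (hf.inv t z)
      have h1 := (hkpos t z).ne'
      change x t z .K = (1 - E.δ) * (V.node t z).ξ * V.Klag i₀ x t z
        + E.Φ (E.Inv (V.Klag i₀ x t z) (x t z .K) (V.node t z).ξ / V.Klag i₀ x t z) * V.Klag i₀ x t z
      rw [h]
      field_simp
      ring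
    clear_wholesale := by
      intro t z
      rw [lag_K_supportingMarket]
      exact (mul_div_cancel₀ _ (V.Δ_pos t z).ne').symm
    clear_final := by
      intro t z
      have h : V.conVal i₀ .sticky x t z .res = 0 := hf.res t z
      change (V.node t z).A / (V.node t z).Δ * E.F ((V.node t z).ξ * V.Klag i₀ x t z) (x t z .N)
        - (x t z .Cb + x t z .Ce + x t z .Cw) - V.Ip i₀ x t z = 0 at h
      change V.AFp i₀ x t z / (V.node t z).Δ = x t z .Cb + x t z .Ce + x t z .Cw + V.Ip i₀ x t z
      rw [AFp, ← div_mul_eq_mul_div]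
      linarith }

end Env

/-! ### The event tree without uncertainty -/

namespace Histories

lemma ker_deterministic (t : ℕ) (z : deterministic.Z t) :
    deterministic.ker t z = Measure.dirac (α := deterministic.Z (t + 1)) z :=
  Kernel.id_apply (α := deterministic.Z t) z

lemma EX_deterministic {t : ℕ} (f : deterministic.Z (t + 1) → ℝ) (z : deterministic.Z t) :
    deterministic.EX t f z = f z := by
  rw [EX, ker_deterministic]
  exact integral_dirac (α := deterministic.Z (t + 1)) f z

lemma integrable_ker_deterministic {t : ℕ} (f : deterministic.Z (t + 1) → ℝ) (z : deterministic.Z t) :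
    Integrable f (deterministic.ker t z) := by
  rw [ker_deterministic]
  exact integrable_dirac (by simp)

instance (H : Histories.{u}) (t : ℕ) : IsMarkovKernel (H.law t) := by
  induction t with
  | zero => exact inferInstanceAs (IsMarkovKernel Kernel.id)
  | succ t ih => exact inferInstanceAs (IsMarkovKernel ((H.ker t) ∘ₖ (H.law t)))

end Histories

namespace SteadyEnv

open Economy Histories Env

variable {E : Economy} (S : SteadyEnv E)

/-! ## Constant plans -/

/-- Link variables of a constant plan. -/
noncomputable def steadyLink (E : Economy) (x : Ctl → ℝ) : Link → ℝ
  | .K => x .K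
  | .RD => E.β⁻¹ * x .D

variable {x : Ctl → ℝ} (m : Cnstr → ℝ)

lemma exps_constPlan (t : ℕ) (z) :
    S.env.exps (constPlan x) t z = E.slotFn S.toNode x x := by
  funext j
  rw [exps, EX_deterministic]
  rfl

lemma welfareDefined_constPlan : WelfareDefined E (constPlan x) := by
  intro z
  have h (t : ℕ) : Integrable (fun _ => E.felicity x) (deterministic.law t z) := integrable_const _
  refine ⟨h, ?_⟩
  simp only [constPlan, integral_const, probReal_univ, one_smul]
  exact (summable_geometric_of_lt_one E.β_pos.le E.β_mem.2).mul_right _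

section

variable (hc : 0 < x .Cw) (hn : 0 < x .N)
include hc hn

lemma R_slotFn (ν : Node) : E.R x (E.slotFn ν x x) = E.β⁻¹ := by
  have h := (E.UwC_pos hc hn).ne'
  have h2 := E.β_pos.ne'
  simp only [Economy.R, Rate, slotFn]
  field_simp

lemma Rp_constPlan (t : ℕ) (z) : S.env.Rp (constPlan x) t z = E.β⁻¹ := by
  rw [Rp, exps_constPlan]
  exact R_slotFn hc hn _

lemma linkOut_constPlan (t : ℕ) (z) : S.env.linkOut (constPlan x) t z = steadyLink E x := by
  funext k
  rw [linkOut, exps_constPlan]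
  cases k
  · rfl
  · change E.R x _ * x .D = _
    rw [R_slotFn hc hn]; rfl

lemma linkIn_constPlan : ∀ (t : ℕ) (z),
    S.env.linkIn (steadyInit E x) (constPlan x) t z = steadyLink E x
  | 0, _ => by funext k; cases k <;> rfl
  | t + 1, z => by
    funext k
    exact congrFun (S.linkOut_constPlan hc hn t z) k

lemma conVal_constPlan (t : ℕ) (z) : S.env.conVal (steadyInit E x) .sticky (constPlan x) t z =
    E.con .sticky S.toNode (steadyLink E x) x (E.slotFn S.toNode x x) := by
  rw [conVal, S.linkIn_constPlan hc hn, exps_constPlan]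
  rfl

lemma con_eq : S.con x = E.con .sticky S.toNode (steadyLink E x) x (E.slotFn S.toNode x x) :=
  S.conVal_constPlan hc hn 1 ()

lemma conVal_eq_con (t : ℕ) (z) :
    S.env.conVal (steadyInit E x) .sticky (constPlan x) t z = S.con x := by
  rw [S.conVal_constPlan hc hn, S.con_eq hc hn]

/-- Without uncertainty expectations are evaluations, so along a constant plan dates differ only in
that date 0 has no past effect. Hence date 1 represents all dates `t ≥ 1`. -/
lemma foc_constPlan_congr (a : Ctl) (t t' : ℕ) (z) (z') :
    S.env.foc (steadyInit E x) .sticky (constPlan x) (constMult m) a (t + 1) z =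
    S.env.foc (steadyInit E x) .sticky (constPlan x) (constMult m) a (t' + 1) z' := by
  simp only [Env.foc, pastEffect, slotShadow, linkShadow, EX_deterministic,
    S.linkIn_constPlan hc hn, S.linkOut_constPlan hc hn, exps_constPlan]
  rfl

lemma foc_constPlan (a : Ctl) (t : ℕ) (z) :
    S.env.foc (steadyInit E x) .sticky (constPlan x) (constMult m) a (t + 1) z = S.foc x m a :=
  S.foc_constPlan_congr m hc hn a t 0 z ()

lemma con_loan1 : S.con x .loan1 = E.UbC (x .Cb) *
    ((1 - E.βb) * x .L - E.βb * (x .Cb + (1 / E.β - 1) * x .D)) := by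
  rw [S.con_eq hc hn]
  change E.UbC (x .Cb) * x .L - E.βb * (E.UbC (x .Cb) * (x .Cb + x .L - x .D)
    + E.R x (E.slotFn S.toNode x x) * x .D * E.UbC (x .Cb)) = _
  rw [R_slotFn hc hn]
  ring

lemma con_col (hK : 0 < x .K) : S.con x .col =
    S.m * (E.capPrice (1 - (1 - E.δ) * S.ξ) * S.ξ) * x .K
      - (x .Cb + x .L + (1 / E.β - 1) * x .D) := by
  rw [S.con_eq hc hn]
  change S.m * (E.Q (x .K) (x .K) S.ξ * S.ξ) * x .K - (x .Cb + x .L - x .D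
    + E.R x (E.slotFn S.toNode x x) * x .D) = _
  rw [R_slotFn hc hn, E.Q_eq _ _ hK, div_self hK.ne']
  ring

end

variable {S} {m}

lemma Domain.Cw_pos (h : S.Domain x) : 0 < x .Cw := h.1 _ (by simp)
lemma Domain.N_pos (h : S.Domain x) : 0 < x .N := h.1 _ (by simp)

lemma con_lev : S.con x .lev = (1 - S.κ) * x .L - x .D := rfl

lemma con_loan2 : S.con x .loan2 = S.con x .loan1 * S.con x .lev := rfl

lemma one_div_β_sub_one_pos (E : Economy) : 0 < 1 / E.β - 1 :=
  sub_pos.2 ((one_lt_div E.β_pos).2 E.β_mem.2)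

lemma loans_coef_pos (E : Economy) : 0 < E.βb / (1 - E.βb) :=
  div_pos E.βb_pos (sub_pos.2 E.βb_lt_one)

lemma con_loan1_eq_zero (hd : S.Domain x)
    (h : x .L = E.βb / (1 - E.βb) * (x .Cb + (1 / E.β - 1) * x .D)) : S.con x .loan1 = 0 := by
  have h1 : 1 - E.βb ≠ 0 := (sub_pos.2 E.βb_lt_one).ne'
  rw [S.con_loan1 hd.Cw_pos hd.N_pos, h, div_mul_eq_mul_div, mul_div_cancel₀ _ h1, sub_self, mul_zero]

/-- The conditions for `D` and `L` hold automatically. With `β R = 1` the budget multiplier drops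
out of the former, and the choice `λᵉ = λᴸ₁ (β - β_b) U^b_C` makes the past effect `β⁻¹ (λᴸ₁ β_b
U^b_C + λᵉ)` equal to `λᴸ₁ U^b_C`, which cancels the current effects in both. -/
theorem ReducedSystem.isSteadyState (hκ : S.κ < 1) (h : S.ReducedSystem x m) : S.IsSteadyState x m := by
  have hd := h.dom
  have hc := hd.Cw_pos
  have hn := hd.N_pos
  have hb : 0 < x .Cb := hd.1 _ (by simp)
  have hK : 0 < x .K := hd.1 _ (by simp)
  have hL : 0 < x .L := hd.1 _ (by simp)
  have hu := E.UbC_pos hb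
  have hκ' := sub_pos.2 hκ
  have hβb := sub_pos.2 E.βb_lt_one
  have hβ := E.β_pos
  have hR := one_div_β_sub_one_pos E
  have h1 : 1 / (1 - S.κ) * x .D ≤ x .L := h.loans_eq ▸ le_max_left _ _
  have h2 : E.βb / (1 - E.βb) * (x .Cb + (1 / E.β - 1) * x .D) ≤ x .L := h.loans_eq ▸ le_max_right _ _
  have hlev : 0 ≤ S.con x .lev := by
    rw [con_lev, sub_nonneg]
    rwa [one_div_mul_eq_div, div_le_iff₀' hκ'] at h1
  have hG : 0 ≤ S.con x .loan1 := by
    rw [S.con_loan1 hc hn]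
    refine mul_nonneg hu.le (sub_nonneg.2 ?_)
    rwa [div_mul_eq_mul_div, div_le_iff₀' hβb] at h2
  -- The maximum defining loans is attained by one of its arguments: either leverage binds or the
  -- banker's Euler equation holds. This is the complementarity constraint.
  have hor : S.con x .lev = 0 ∨ S.con x .loan1 = 0 := by
    rcases max_choice (1 / (1 - S.κ) * x .D) (E.βb / (1 - E.βb) * (x .Cb + (1 / E.β - 1) * x .D))
      with h3 | h3
    · left
      have h4 : x .L = 1 / (1 - S.κ) * x .D := h.loans_eq.trans h3
      rw [con_lev, h4]
      field_simp
      ring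
    · exact Or.inr (con_loan1_eq_zero hd (h.loans_eq.trans h3))
  refine ⟨⟨fun t a => measurable_const, fun t z a ha => hd.1 a ha, fun t z => hd.2.1, fun t z => ?_,
    fun t z j => integrable_ker_deterministic _ z, welfareDefined_constPlan, fun t z => ?_,
    fun t z => ?_, fun t z hD => ?_, fun t z => ?_, fun t z => ?_, fun t z => ?_, fun t z => ?_,
    fun t z => ?_⟩, fun t z => ⟨fun a ha => ?_, ?_, fun _ => ?_, ?_, ?_, ?_, ?_, ?_, ?_⟩⟩
  · rw [S.linkIn_constPlan hc hn]
    change x .K / x .K - (1 - E.δ) * S.ξ ∈ _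
    rw [div_self hK.ne']
    exact hd.2.2
  · rw [S.conVal_eq_con hc hn]; exact hlev
  · rw [S.conVal_eq_con hc hn]; exact hG
  · rw [S.conVal_eq_con hc hn]
    -- At `D = 0` the leverage argument of the maximum is zero, so loans are given by the Euler
    -- equation.
    refine con_loan1_eq_zero hd (h.loans_eq.trans (max_eq_right ?_))
    rw [show x .D = 0 from hD, mul_zero]
    exact mul_nonneg (loans_coef_pos E).le (by linarith)
  · rw [S.conVal_eq_con hc hn, con_loan2]
    rcases hor with h3 | h3 <;> simp [h3]
  · rw [S.conVal_eq_con hc hn]; exact h.bud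
  · rw [S.conVal_eq_con hc hn]; exact h.collateral
  · rw [S.conVal_eq_con hc hn]; exact h.res
  · rw [S.conVal_eq_con hc hn]; exact h.om
  · by_cases haL : a = .L
    · subst haL
      rw [foc_L]
      simp only [lamL, pastPay, lag, constMult, h.lev_zero, h.loan2_zero, h.col_eq]
      change (1 - S.κ) * (0 + 0 * _) + (m .loan1 + 0 * _) * E.UbC (x .Cb) - E.β⁻¹ * ((m .loan1 + 0 * _) *
        E.βb * E.UbC (x .Cb) + m .loan1 * (E.β - E.βb) * E.UbC (x .Cb)) = 0
      field_simp
      ring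
    · rw [S.foc_constPlan m hc hn]
      refine h.focs a ?_
      cases a <;> simp_all
  · refine le_of_eq ?_
    rw [foc_D, S.Rp_constPlan hc hn, EX_deterministic, EX_deterministic]
    simp only [lamL, pastPay, lag, constMult, h.lev_zero, h.loan2_zero, h.col_eq]
    change -0 - (m .loan1 + 0 * _) * E.βb * E.β⁻¹ * E.UbC (x .Cb) - 0 * _ + m .bud
      - m .loan1 * (E.β - E.βb) * E.UbC (x .Cb) * E.β⁻¹ - E.β * E.β⁻¹ * m .bud
      + E.β⁻¹ * ((m .loan1 + 0 * _) * E.βb * E.UbC (x .Cb)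
        + m .loan1 * (E.β - E.βb) * E.UbC (x .Cb)) = 0
    field_simp
    ring
  · rw [foc_D, S.Rp_constPlan hc hn, EX_deterministic, EX_deterministic]
    simp only [lamL, pastPay, lag, constMult, h.lev_zero, h.loan2_zero, h.col_eq]
    change -0 - (m .loan1 + 0 * _) * E.βb * E.β⁻¹ * E.UbC (x .Cb) - 0 * _ + m .bud
      - m .loan1 * (E.β - E.βb) * E.UbC (x .Cb) * E.β⁻¹ - E.β * E.β⁻¹ * m .bud
      + E.β⁻¹ * ((m .loan1 + 0 * _) * E.βb * E.UbC (x .Cb)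
        + m .loan1 * (E.β - E.βb) * E.UbC (x .Cb)) = 0
    field_simp
    ring
  · exact h.lev_zero.ge
  · simp only [constMult, h.lev_zero, zero_mul]
  · exact mul_nonneg hd.2.1 h.loan1_nonneg
  · rw [S.conVal_eq_con hc hn]
    rcases h.regime with h3 | ⟨_, h3⟩
    · simp only [constMult, h3, zero_mul]
    · rw [con_loan1_eq_zero hd h3, mul_zero]
  · simp only [constMult, h.col_eq]
    exact mul_nonneg (mul_nonneg h.loan1_nonneg (sub_nonneg.2 E.βb_mem.2)) hu.le
  · rw [S.conVal_eq_con hc hn]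
    rcases h.regime with h3 | ⟨h3, _⟩
    · simp only [constMult, h.col_eq, h3, zero_mul]
    · rw [h3, mul_zero]

end SteadyEnv

/-- The larger of two nondecreasing affine functions has nonnegative left derivatives. -/
lemma exists_hasDerivWithinAt_max_affine {a b c : ℝ} (ha : 0 ≤ a) (hc : 0 ≤ c) (v₀ : ℝ) :
    ∃ d, 0 ≤ d ∧ HasDerivWithinAt (fun v => max (a * v) (b + c * v)) d (Iic v₀) v₀ := by
  have h1 : HasDerivAt (fun v => a * v) a v₀ := by simpa using (hasDerivAt_id v₀).const_mul a
  have h2 : HasDerivAt (fun v => b + c * v) c v₀ := by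
    simpa using ((hasDerivAt_id v₀).const_mul c).const_add b
  rcases lt_trichotomy (a * v₀) (b + c * v₀) with h | h | h
  · refine ⟨c, hc, (h2.congr_of_eventuallyEq ?_).hasDerivWithinAt⟩
    filter_upwards [h1.continuousAt.eventually_lt h2.continuousAt h] with v hv using max_eq_right hv.le
  · rcases le_total a c with hac | hac
    · refine ⟨a, ha, h1.hasDerivWithinAt.congr_of_mem (fun v hv => max_eq_left ?_) self_mem_Iic⟩
      have := mul_le_mul_of_nonneg_left (sub_nonneg.2 (mem_Iic.1 hv)) (sub_nonneg.2 hac)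
      nlinarith [mem_Iic.1 hv]
    · refine ⟨c, hc, h2.hasDerivWithinAt.congr_of_mem (fun v hv => max_eq_right ?_) self_mem_Iic⟩
      nlinarith [mem_Iic.1 hv]
  · refine ⟨a, ha, (h1.congr_of_eventuallyEq ?_).hasDerivWithinAt⟩
    filter_upwards [h2.continuousAt.eventually_lt h1.continuousAt h] with v hv using max_eq_left hv.le

namespace SteadyEnv

open Economy Histories Env

variable {E : Economy} {S : SteadyEnv E}

/-! ## The optimal steady state -/

/-- Steady-state deposits provide no resources: they cost interest `R - 1` in the budget, and they
raise loan payments in the collateral constraint. With `λᶜ > 0`, a reduction of positive deposits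
raises the Lagrangian to first order. -/
theorem IsSteadyMultiplier.D_eq_zero (hκ : S.κ < 1) {x : Ctl → ℝ} {lC le lY lO : ℝ}
    (hf : S.SteadyFeasible x) (hm : S.IsSteadyMultiplier x lC le lY lO) (hC : 0 < x .D → 0 < lC) :
    x .D = 0 := by
  have hc : 0 < x .Cw := hf.pos 0 () .Cw (by simp)
  have hn : 0 < x .N := hf.pos 0 () .N (by simp)
  by_contra hD
  have hD' : 0 < x .D := lt_of_le_of_ne (hf.D_nonneg 0 ()) (Ne.symm hD)
  have hlC := hC hD'
  have hR := one_div_β_sub_one_pos E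
  have hc0 := loans_coef_pos E
  obtain ⟨d, hd, hder⟩ := exists_hasDerivWithinAt_max_affine (a := 1 / (1 - S.κ))
    (b := E.βb / (1 - E.βb) * x .Cb) (c := E.βb / (1 - E.βb) * (1 / E.β - 1))
    (one_div_nonneg.2 (sub_pos.2 hκ).le) (mul_pos hc0 hR).le (x .D)
  -- Deposits enter only through the budget and the collateral constraint, and loans only through
  -- the latter; the kink is confined to the term in `S.loans`.
  have hlag (v : ℝ) : S.steadyLagrangian lC le lY lO (Function.update x .D v) =
      S.steadyLagrangian lC le lY lO (Function.update x .D 0)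
      + le * S.loans (x .Cb) 0 - lC * ((1 / E.β - 1) * v)
      - le * (S.loans (x .Cb) v + (1 / E.β - 1) * v) := by
    have hcon (w : ℝ) (i : Cnstr) : S.con (Function.update (Function.update x .D w) .L
        (S.loans (x .Cb) w)) i = E.con .sticky S.toNode (steadyLink E (Function.update (Function.update
          x .D w) .L (S.loans (x .Cb) w))) (Function.update (Function.update x .D w) .L
            (S.loans (x .Cb) w)) (E.slotFn S.toNode (Function.update (Function.update x .D w) .L
              (S.loans (x .Cb) w)) (Function.update (Function.update x .D w) .L
                (S.loans (x .Cb) w))) i := by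
      rw [S.con_eq (by simpa using hc) (by simpa using hn)]
    have hRw (w : ℝ) := R_slotFn (E := E) (x := Function.update (Function.update x .D w) .L
      (S.loans (x .Cb) w)) (by simpa using hc) (by simpa using hn) S.toNode
    simp only [steadyLagrangian, ne_eq, reduceCtorEq, not_false_eq_true, Function.update_of_ne,
      Function.update_self, hcon]
    simp only [Economy.con, hRw]
    simp [felicity, revenue, output, steadyLink, slotFn]
    ring
  have hL : HasDerivWithinAt (fun v => S.steadyLagrangian lC le lY lO (Function.update x .D v))
      (-(lC * ((1 / E.β - 1) * 1)) - le * (d + (1 / E.β - 1) * 1)) (Iic (x .D)) (x .D) := by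
    have hl : HasDerivWithinAt (fun v => S.loans (x .Cb) v) d (Iic (x .D)) (x .D) := by
      refine hder.congr_of_mem (fun v _ => ?_) self_mem_Iic
      rw [loans]; congr 1; ring
    have hid := ((hasDerivAt_id' (x .D)).const_mul (1 / E.β - 1)).hasDerivWithinAt (s := Iic (x .D))
    have h := ((hid.const_mul lC).const_sub (S.steadyLagrangian lC le lY lO (Function.update x .D 0)
      + le * S.loans (x .Cb) 0)).sub ((hl.add hid).const_mul le)
    exact h.congr_of_mem (fun v _ => hlag v) self_mem_Iic
  have h1 := hm.left .D (by decide) (fun _ => hD') _ hL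
  have h2 := mul_pos hlC hR
  have h3 := mul_nonneg hm.le_nonneg (add_nonneg hd hR.le)
  linarith

/-! ## Local indeterminacy -/

/-- Slack in the collateral constraint of a constant plan. -/
noncomputable def steadyCol (S : SteadyEnv E) (D : ℝ) (y : Unk → ℝ) : ℝ :=
  S.m * (E.capPrice (1 - (1 - E.δ) * S.ξ) * S.ξ) * y .K
    - (y .Cb + E.βb / (1 - E.βb) * (y .Cb + (1 / E.β - 1) * D) + (1 / E.β - 1) * D)

/-- Quantities among the unknowns. -/
def quantities : Set Unk := {.Cb, .Ce, .Cw, .K, .N, .Om}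

lemma unkPlan_L_pos {D : ℝ} {y : Unk → ℝ} (hD : 0 ≤ D) (hb : 0 < y .Cb) :
    0 < unkPlan E D y .L :=
  mul_pos (loans_coef_pos E) (add_pos_of_pos_of_nonneg hb
    (mul_nonneg (one_div_β_sub_one_pos E).le hD))

/-- The square system imposes the Euler branch of the maximum for loans. It describes steady states
as long as that branch dominates the leverage branch, which is the role of `hlev`. -/
lemma reducedSystem_of_residual {binding : Bool} {D : ℝ} {y : Unk → ℝ} (hD : 0 ≤ D)
    (hpos : ∀ j ∈ quantities, 0 < y j) (himg : 1 - (1 - E.δ) * S.ξ ∈ E.Φ '' Ioi 0)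
    (hlev : 1 / (1 - S.κ) * D ≤ E.βb / (1 - E.βb) * (y .Cb + (1 / E.β - 1) * D))
    (hres : S.residual binding D y = 0)
    (hbind : binding = true → 0 < y .lL) (hslack : binding = false → 0 < S.steadyCol D y) :
    S.ReducedSystem (unkPlan E D y) (unkMult E y) := by
  have hdom : S.Domain (unkPlan E D y) := by
    refine ⟨fun a ha => ?_, hD, himg⟩
    cases a
    case D => simp at ha
    case L => exact unkPlan_L_pos hD (hpos .Cb (by simp [quantities]))
    all_goals exact hpos _ (by simp [quantities])
  have hcol : S.con (unkPlan E D y) .col = S.steadyCol D y :=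
    S.con_col hdom.Cw_pos hdom.N_pos (hdom.1 .K (by simp))
  have h0 (j : Unk) : S.residual binding D y j = 0 := congrFun hres j
  refine ⟨hdom, (max_eq_right hlev).symm, rfl, rfl, ?_, rfl, ?_, ?_, fun a ha => ?_, h0 .lC, h0 .lY,
    h0 .lO⟩
  · cases binding
    · exact (h0 .lL).ge
    · exact (hbind rfl).le
  · cases binding
    · rw [hcol]; exact (hslack rfl).le
    · exact (h0 .lL).ge
  · cases binding
    · exact Or.inl (h0 .lL)
    · exact Or.inr ⟨h0 .lL, rfl⟩
  · simp only [mem_insert_iff, mem_singleton_iff] at ha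
    rcases ha with rfl | rfl | rfl | rfl | rfl | rfl
    · exact h0 .Cb
    · exact h0 .Ce
    · exact h0 .Cw
    · exact h0 .K
    · exact h0 .N
    · exact h0 .Om

/-- Implicit function theorem for a parameter on the real line: a continuous branch of solutions. -/
lemma exists_continuous_branch {Y : Type*} [NormedAddCommGroup Y] [NormedSpace ℝ Y] [CompleteSpace Y]
    {f : ℝ × Y → Y} {y₀ : Y} {J : ℝ × Y →L[ℝ] Y} (hJ : HasStrictFDerivAt f J (0, y₀))
    (hbij : Function.Bijective fun w : Y => J (0, w)) :
    ∃ ψ : ℝ → Y, ψ 0 = y₀ ∧ (∀ᶠ D in 𝓝 (0 : ℝ), f (D, ψ D) = f (0, y₀)) ∧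
      ∀ᶠ D in 𝓝 (0 : ℝ), ContinuousAt ψ D := by
  have hinv : (J ∘L .inr ℝ ℝ Y).IsInvertible := by
    have hb : Function.Bijective (J ∘L .inr ℝ ℝ Y) := hbij
    exact ⟨ContinuousLinearEquiv.ofBijective _ (LinearMap.ker_eq_bot.2 hb.1)
      (LinearMap.range_eq_top.2 hb.2), ContinuousLinearEquiv.coe_ofBijective _ _ _⟩
  refine ⟨hJ.implicitFunctionOfProdDomain hinv,
    (hJ.eventually_apply_eq_iff_implicitFunctionOfProdDomain hinv).self_of_nhds.1 rfl,
    hJ.eventually_apply_implicitFunctionOfProdDomain hinv, ?_⟩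
  -- Strict differentiability gives a Lipschitz bound on a whole neighborhood, hence continuity also
  -- at nearby parameters. Indeterminacy at every member of the family, not only at `D = 0`, depends
  -- on this.
  obtain ⟨K, s, hs, hK⟩ :=
    (hJ.hasStrictFDerivAt_implicitFunctionOfProdDomain hinv).exists_lipschitzOnWith
  filter_upwards [eventually_mem_nhds_iff.2 hs] with D hD using hK.continuousOn.continuousAt hD

lemma continuousAt_unk {ψ : ℝ → Unk → ℝ} {D : ℝ} (h : ContinuousAt ψ D) (hb : 0 < ψ D .Cb) :
    ContinuousAt (fun D => (unkPlan E D (ψ D), unkMult E (ψ D))) D := by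
  have hj (j : Unk) : ContinuousAt (fun D => ψ D j) D := (continuousAt_pi.1 h) j
  refine ContinuousAt.prodMk (continuousAt_pi.2 fun a => ?_) (continuousAt_pi.2 fun i => ?_)
  · cases a
    case D => exact continuousAt_id
    case L => exact ((hj .Cb).add (continuousAt_id.const_mul _)).const_mul _
    all_goals exact hj _
  · cases i
    case lev | loan2 => exact continuousAt_const
    case col =>
      exact ((hj .lL).mul_const _).mul (ContinuousAt.comp (f := fun D => ψ D .Cb)
        (E.hasDerivAt_UbC hb).continuousAt (hj .Cb))
    all_goals exact hj _

/-- The implicit function theorem solves the square system with deposits as parameter. The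
inequalities that turn its solutions into steady states are strict at `D = 0`, so they persist for
small `D`, and continuity of the branch puts other steady states in every neighborhood. -/
theorem IsRegularAtZero.exists_family (hκ : S.κ < 1) {binding : Bool} {y₀ : Unk → ℝ}
    (h : S.IsRegularAtZero binding y₀) :
    ∃ Dbar : ℝ, 0 < Dbar ∧ ∃ y : ℝ → Unk → ℝ, y 0 = y₀ ∧ ∀ D ∈ Icc 0 Dbar,
      S.IsSteadyState (unkPlan E D (y D)) (unkMult E (y D)) ∧
      S.LocallyIndeterminate (unkPlan E D (y D)) (unkMult E (y D)) := by
  obtain ⟨J, hJ, hbij⟩ := h.regular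
  obtain ⟨ψ, hψ0, hsol, hcont⟩ := exists_continuous_branch hJ hbij
  have hψ : ContinuousAt ψ 0 := hcont.self_of_nhds
  have hj (j : Unk) : ContinuousAt (fun D => ψ D j) 0 := (continuousAt_pi.1 hψ) j
  have hdom := h.dom
  have hpos0 : ∀ j ∈ quantities, 0 < y₀ j := by
    intro j hj
    simp only [quantities, mem_insert_iff, mem_singleton_iff] at hj
    rcases hj with rfl | rfl | rfl | rfl | rfl | rfl
    · exact hdom.1 .Cb (by simp)
    · exact hdom.1 .Ce (by simp)
    · exact hdom.1 .Cw (by simp)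
    · exact hdom.1 .K (by simp)
    · exact hdom.1 .N (by simp)
    · exact hdom.1 .Om (by simp)
  have hb0 : 0 < y₀ .Cb := hpos0 _ (by simp [quantities])
  have epos : ∀ᶠ D in 𝓝 (0 : ℝ), ∀ j ∈ quantities, 0 < ψ D j := by
    refine (eventually_all_finite (Set.toFinite _)).2 fun j hjm => ?_
    refine (hj j).eventually (lt_mem_nhds ?_)
    change 0 < ψ 0 j
    rw [hψ0]; exact hpos0 j hjm
  -- At `D = 0` the Euler branch is positive and the leverage branch zero, so the kink of the loan
  -- formula is away from the starting point.
  have elev : ∀ᶠ D in 𝓝 (0 : ℝ), 1 / (1 - S.κ) * D <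
      E.βb / (1 - E.βb) * (ψ D .Cb + (1 / E.β - 1) * D) := by
    refine ContinuousAt.eventually_lt (continuousAt_id.const_mul _)
      (((hj .Cb).add (continuousAt_id.const_mul _)).const_mul _) ?_
    simp only [mul_zero, add_zero, hψ0]
    exact mul_pos (loans_coef_pos E) hb0
  have estrict : ∀ᶠ D in 𝓝 (0 : ℝ), (binding = true → 0 < ψ D .lL) ∧
      (binding = false → 0 < S.steadyCol D (ψ D)) := by
    have hs := h.strict
    cases binding
    · simp only [Bool.false_eq_true, false_imp_iff, true_imp_iff, true_and]
      have hc : ContinuousAt (fun D => S.steadyCol D (ψ D)) 0 :=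
        ((hj .K).const_mul _).sub (((hj .Cb).add (((hj .Cb).add
          (continuousAt_id.const_mul _)).const_mul _)).add (continuousAt_id.const_mul _))
      refine hc.eventually (lt_mem_nhds ?_)
      change 0 < S.steadyCol 0 (ψ 0)
      rw [hψ0]
      have h1 : S.con (unkPlan E 0 y₀) .col = S.steadyCol 0 y₀ :=
        S.con_col hdom.Cw_pos hdom.N_pos (hdom.1 .K (by simp))
      rw [← h1]
      exact hs
    · simp only [Bool.true_eq_false, false_imp_iff, true_imp_iff, and_true]
      refine (hj .lL).eventually (lt_mem_nhds ?_)
      change 0 < ψ 0 .lL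
      rw [hψ0]; exact hs
  obtain ⟨ε, hε, hball⟩ := Metric.eventually_nhds_iff.1
    (hsol.and (hcont.and (epos.and (elev.and estrict))))
  have hsteady {D : ℝ} (hD : D ∈ Ico 0 ε) : S.IsSteadyState (unkPlan E D (ψ D)) (unkMult E (ψ D)) := by
    obtain ⟨h1, -, h3, h4, h5⟩ := hball (y := D) (by
      rw [Real.dist_eq, sub_zero, abs_of_nonneg hD.1]; exact hD.2)
    exact (reducedSystem_of_residual hD.1 h3 hdom.2.2 h4.le (h1.trans h.zero) h5.1 h5.2).isSteadyState hκ
  -- Stopping at `ε / 2` leaves room to the right, so the last member of the family also has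
  -- neighbors with larger deposits.
  refine ⟨ε / 2, half_pos hε, ψ, hψ0, fun D hD => ?_⟩
  have hDε : D < ε := by linarith [hD.2]
  refine ⟨hsteady ⟨hD.1, hDε⟩, hsteady ⟨hD.1, hDε⟩, fun O hO => ?_⟩
  obtain ⟨-, h2, h3, -⟩ := hball (y := D) (by
      rw [Real.dist_eq, sub_zero, abs_of_nonneg hD.1]; exact hDε)
  have hΓ := continuousAt_unk (E := E) h2 (h3 .Cb (by simp [quantities]))
  have h6 : ∀ᶠ D' in 𝓝[>] D, (unkPlan E D' (ψ D'), unkMult E (ψ D')) ∈ O :=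
    (hΓ.eventually hO).filter_mono nhdsWithin_le_nhds
  obtain ⟨D', hD'O, hD'⟩ := (h6.and (Ioo_mem_nhdsGT hDε)).exists
  exact ⟨_, _, hD'O, hsteady ⟨hD.1.trans hD'.1.le, hD'.2⟩, hD'.1.ne'⟩

end SteadyEnv

theorem mainTheorem3 (E : Economy) (hωb : 0 < E.ωb) (hωe : 0 < E.ωe) :
    -- properties of the sticky-price constrained efficient allocation on arbitrary histories
    (∀ (H : Histories.{u}) (V : Env E H) (i₀ : Init), 0 < i₀.K → 0 < i₀.L →
      -- every competitive equilibrium allocation is feasible for the planner, but it is not constrained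
      -- efficient if the bank leverage constraint has a positive private multiplier at date 0 and the
      -- weighted marginal utilities of bankers and entrepreneurs differ there
      (∀ M : Market H, V.IsCE i₀ M → WelfareDefined E M.plan →
        V.Feasible i₀ .sticky M.plan ∧
        ∀ z₀ : H.Z 0, 0 < M.lb 0 z₀ → (V.node 0 z₀).κ < 1 →
          E.ωb * E.UbC (M.Cb 0 z₀) ≠ E.ωe * E.UeC (M.Ce 0 z₀) → ¬ V.IsCEA i₀ .sticky M.plan) ∧
      -- wedges, risk sharing, decentralization
      (∀ (x : Plan H) (l : Mult H), V.IsCEA i₀ .sticky x → V.IsMultiplier i₀ .sticky x l →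
        (V.FinancialIntegrable i₀ x l → ∀ t z,
          V.DepositCondition i₀ x l t z ∧ V.LoanCondition i₀ x l t z) ∧
        (V.RealIntegrable i₀ x l → ∀ t z, V.CapitalCondition i₀ x l t z) ∧
        (V.LaborWedgeDefined i₀ x l → ∀ t z, V.LaborCondition i₀ x l t z) ∧
        -- a competitive equilibrium can have this allocation only if the wedges vanish, up to differences
        -- between private and normalized social multipliers
        (∀ M : Market H, V.IsCE i₀ M → M.plan = x →
          (V.LaborWedgeDefined i₀ x l → ∀ t z, V.ΨN i₀ x l t z = 0) ∧
          (V.FinancialIntegrable i₀ x l → ∀ t z,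
            (0 < x t z .D → V.ΨD i₀ x l t z = M.lb t z - l t z .lev / E.ωb) ∧
            V.ΨL i₀ x l t z = (M.le t z - l t z .col / E.ωe) *
              H.EX t (fun z' => V.RLp i₀ x (t + 1) z') z) ∧
          (V.RealIntegrable i₀ x l → ∀ t z,
            V.ΨK i₀ x l t z = (M.le t z - l t z .col / E.ωe) * (V.node t z).m *
              H.EX t (fun z' => V.Qp i₀ x (t + 1) z' * (V.node (t + 1) z').ξ) z)) ∧
        -- perfect insurance between bankers and entrepreneurs
        (∀ t z, V.lamL x l t z = 0 → H.lag (V.lamL x l) 0 t z = 0 →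
          H.lag (fun s y => l s y .col) 0 t z = 0 →
          E.ωb * E.UbC (x t z .Cb) = E.ωe * E.UeC (x t z .Ce)) ∧
        (∀ t z, H.PastAll (fun s y => 0 < V.conVal i₀ .sticky x s y .col) t z →
          E.ωb * E.UbC (x t z .Cb) = E.ωe * E.UeC (x t z .Ce)) ∧
        -- decentralization and Ramsey optimality
        ((∀ t z, (V.node t z).κ < 1) → V.FinancialIntegrable i₀ x l → V.RealIntegrable i₀ x l →
          V.LaborWedgeDefined i₀ x l →
          (∃ M : Market H, M.plan = x ∧ V.IsRegulatedCE i₀ M (V.ceaTaxes i₀ x l)) ∧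
          ∀ (M : Market H) (T : Taxes H), V.IsRegulatedCE i₀ M T → WelfareDefined E M.plan →
            ∀ z₀, welfare E M.plan z₀ ≤ welfare E x z₀)) ∧
      -- the financial wedges are the same functions of allocation and multipliers under flexible prices
      (∀ (x : Plan H) (l : Mult H), V.IsCEA i₀ .flexible x → V.IsMultiplier i₀ .flexible x l →
        V.FinancialIntegrable i₀ x l → ∀ t z,
          V.DepositCondition i₀ x l t z ∧ V.LoanCondition i₀ x l t z)) ∧
    -- steady states
    (∀ S : SteadyEnv E, S.κ < 1 →
      (∀ x m, S.ReducedSystem x m → S.IsSteadyState x m) ∧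
      (∀ (binding : Bool) (y₀ : SteadyEnv.Unk → ℝ), S.IsRegularAtZero binding y₀ →
        ∃ Dbar : ℝ, 0 < Dbar ∧ ∃ y : ℝ → SteadyEnv.Unk → ℝ, y 0 = y₀ ∧
          ∀ D ∈ Set.Icc 0 Dbar,
            S.IsSteadyState (SteadyEnv.unkPlan E D (y D)) (SteadyEnv.unkMult E (y D)) ∧
            S.LocallyIndeterminate (SteadyEnv.unkPlan E D (y D)) (SteadyEnv.unkMult E (y D))) ∧
      (∀ (x : Ctl → ℝ) (lC le lY lO : ℝ), S.IsOptimalSteady x →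
        S.IsSteadyMultiplier x lC le lY lO → (0 < x .D → 0 < lC) → x .D = 0)) := by
  refine ⟨fun H V i₀ hK hL => ⟨fun M hM hW => ⟨hM.1.feasible hK hW, fun z₀ hlb hκ hne =>
    Env.IsRegulatedCE.not_isCEA hL hM.1 hlb hκ hne⟩, fun x l hx hl => ?_, fun x l hx hl hi t z =>
      ⟨Env.depositCondition hL hx.1 hl hωb hi, Env.loanCondition hL hx.1 hl hωe hi⟩⟩,
    fun S hκ => ⟨fun x m h => h.isSteadyState hκ, fun binding y₀ h => h.exists_family hκ,
      fun x lC le lY lO hx hm hC => hm.D_eq_zero hκ hx.1 hC⟩⟩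
  have hDep (hi : V.FinancialIntegrable i₀ x l) (t) (z : H.Z t) : V.DepositCondition i₀ x l t z :=
    Env.depositCondition hL hx.1 hl hωb hi
  have hLoan (hi : V.FinancialIntegrable i₀ x l) (t) (z : H.Z t) : V.LoanCondition i₀ x l t z :=
    Env.loanCondition hL hx.1 hl hωe hi
  have hCap (hi : V.RealIntegrable i₀ x l) (t) (z : H.Z t) : V.CapitalCondition i₀ x l t z :=
    Env.capitalCondition hK hx.1 hl hωe hi
  have hLab (hw : V.LaborWedgeDefined i₀ x l) (t) (z : H.Z t) : V.LaborCondition i₀ x l t z :=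
    Env.laborCondition hx.1 hl hw
  -- Ramsey optimality needs no first-order condition: any regulated equilibrium is feasible for the
  -- planner, so its welfare cannot exceed that of the constrained efficient plan.
  refine ⟨fun hi t z => ⟨hDep hi t z, hLoan hi t z⟩, hCap, hLab, ?_, fun t z h0 h1 h2 =>
    Env.risk_sharing hL hx.1 hl h0 h1 h2, fun t z h => ?_, fun hκ hF hR hw =>
      ⟨⟨V.supportingMarket i₀ x l, Env.plan_supportingMarket,
        Env.isRegulatedCE_supportingMarket hK hL hωe hx.1 hl hκ hF hR (hDep hF) (hLoan hF) (hLab hw)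
          (hCap hR)⟩, fun M T hM hW z₀ => hx.2 _ (hM.feasible hK hW) z₀⟩⟩
  · rintro M hM rfl
    exact ⟨fun hw t z => Env.IsCE.ΨN_eq_zero hK hM (hLab hw t z),
      fun hi t z => ⟨Env.IsCE.ΨD_eq hM (hDep hi t z), Env.IsCE.ΨL_eq hL hM (hLoan hi t z)⟩,
      fun hi t z => Env.IsCE.ΨK_eq hK hM (hCap hi t z)⟩
  · obtain ⟨h0, h1, h2⟩ := Env.lamL_eq_zero_of_slack hx.1 hl t z h
    exact Env.risk_sharing hL hx.1 hl h0 h1 h2
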